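/- **Lower bound on the number of detections from single-photon emissions (decoy-state BB84, coherent attacks).** *Parameters.* Let $J,M\ge1$ and $N:=JM$; the $N$ rounds are grouped into $J$ consecutive blocks of $M$ rounds. Let $p_S,p_D,p_V>0$ with $p_S+p_D+p_V=1$, let $p_Z,p_X\ge0$ with $p_Z+p_X=1$, and let $0<\mu_D<\mu_S$, $0\le\mu_V<\mu_D(\mu_S-\mu_D)/\mu_S$ (for instance $\mu_V=0$). Let $0<\epsilon_{\rm secrecy}\le1$, and let $\tilde N_S^{\rm sift},\tilde N_D^{\rm sift},\tilde N_V^{\rm sift},\tilde N_{1,Z}\in[0,N]$ be arbitrary constants fixed in advance. Put $$p^{\rm CS}_{\mu,n}:=e^{-\mu}\frac{\mu^n}{n!},\qquad p^{\rm int}_{\omega,n}:=p_\omega\,p^{\rm CS}_{\mu_\omega,n},\qquad p^{\rm int}_{\omega|n}:=\frac{p^{\rm int}_{\omega,n}}{\sum_{\omega'\in\{S,D,V\}}p^{\rm int}_{\omega',n}} .$$ *Source.* In each round Alice prepares, on a classical-label register $A^{\rm CR}$ (intensity $\omega$, basis $\alpha$, bit $a$), a photon-number register $R$ and a double pulse $A^{\rm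 sig}$ (Fock states $|n-k\rangle|k\rangle$ of the first and second pulse), the pure state $$\sum_{\omega\in\{S,D,V\}}\sum_{\alpha\in\{Z,X\}}\sum_{a\in\{0,1\}}\sqrt{\tfrac12p_\omega p_\alpha}\;|\omega,\alpha,a\rangle_{A^{\rm CR}}\sum_{n\ge0}\sqrt{p^{\rm CS}_{\mu_\omega,n}}\;|n\rangle_R\sum_{k=0}^n\sqrt{2^{-n}\tbinom nk}\;e^{\mathrm i\theta_{a,\alpha}(n-k)}|n-k\rangle|k\rangle_{A^{\rm sig}},$$ with $\theta_{0,Z}=0$, $\theta_{1,Z}=\pi$, $\theta_{0,X}=\pi/2$, $\theta_{1,X}=3\pi/2$. *Communication.* Eve applies arbitrary completely positive trace-preserving (CPTP) maps: the first acts on all $N$ double pulses and outputs the $M$ signal systems of the first block and a memory; for $j\ge2$ the $j$-th acts on her memory and everything announced about block $j-1$ and outputs the $M$ signal systems of block $j$ and a memory; a final map acts after the announcements about block $J$. After receiving a block, Bob does the following to each signal system. He applies an arbitrary fixed CPTP (squashing) map to the span of the orthonormal vectors $|0\rangle,|1\rangle,|{\rm Noclick}\rangle$. He draws and stores a basis $\beta$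 with probability $p_\beta$, and finds out projectively whether there is a click (span of $|0\rangle,|1\rangle$) or not. If there is a click and $\beta=X$, he measures projectively in the basis $|b_X\rangle:=(|0\rangle+(-1)^b|1\rangle)/\sqrt2$ and keeps the post-measurement state; if there is a click and $\beta=Z$, he leaves the qubit untouched. Then Bob announces $\beta$, click or no click, and, for a click with $\beta=X$, the bit $b$. Alice announces $\omega$ and $\alpha$ if there was a click and $\alpha=\beta$, and in addition $a$ if $\alpha=\beta=X$; otherwise she announces "null". All announcements are copied coherently (in the label basis; Bob's bit $b$ in the basis $|b_X\rangle$) to the other party and to Eve. Let $\hat\rho$ be the final state. *Outcomes.* In each round of $\hat\rho$ one measures $R$, $\omega$, $\alpha$, $\beta$ in the label bases, obtaining $n\in\{0,1,\dots\}$ and $\omega,\alpha,\beta$; one finds $e_X={\rm Noclick}$ if Bob's register shows no click; and otherwise one measures Alice's bit register and Bob's qubit in the basis $|0_X\rangle,|1_X\rangle$, obtaining bits $x,y$, and $e_X:=x\oplus y$ (only this sum being recorded). Let $N_{1,Z}$ be the number of rounds with $n=1$, $\alpha=\beta=Z$, $e_X\neq{\rm Noclick}$, and $N^{\rm sift}_\omega$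 the number of rounds with intensity label $\omega$, $\alpha=\beta=Z$, $e_X\ne{\rm Noclick}$. *The bound.* Let $$\Delta:=-\frac{\mu_D^2}{\mu_S^2}\frac{p^{\rm int}_{S|1}}{p^{\rm int}_{S,0}}+\frac{p^{\rm int}_{D|1}}{p^{\rm int}_{D,0}}-\frac{p^{\rm int}_{V|1}}{p^{\rm int}_{V,0}},\quad \lambda:=-\frac{\mu_D^2/\mu_S^2}{\Delta\,p^{\rm int}_{S,0}},\quad \zeta:=\frac1{\Delta\,p^{\rm int}_{D,0}},\quad \gamma:=-\frac1{\Delta\,p^{\rm int}_{V,0}} .$$ For $s>0$, $0\le t\le s$, $0<\epsilon<1$ let $$a_K(s,t,\epsilon):=\frac{216\sqrt s\,t(s-t)\ln\epsilon-48s^{3/2}\ln^2\epsilon+27\sqrt2\,(s-2t)\sqrt{-s^2\ln\epsilon\,[9t(s-t)-2s\ln\epsilon]}}{4(9s-8\ln\epsilon)[9t(s-t)-2s\ln\epsilon]},$$ $$a'_K(s,t,\epsilon):=\frac{-216\sqrt s\,t(s-t)\ln\epsilon+48s^{3/2}\ln^2\epsilon+27\sqrt2\,(s-2t)\sqrt{-s^2\ln\epsilon\,[9t(s-t)-2s\ln\epsilon]}}{4(9s-8\ln\epsilon)[9t(s-t)-2s\ln\epsilon]},$$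 $$b_K:=\frac{\sqrt{18a_K^2s-(16a_K^2+24a_K\sqrt s+9s)\ln\epsilon}}{3\sqrt{2s}},\qquad b'_K:=\frac{\sqrt{18a_K'^2s-(16a_K'^2-24a'_K\sqrt s+9s)\ln\epsilon}}{3\sqrt{2s}} .$$ With $\delta:=\epsilon_{\rm secrecy}^2/32$ write $(a_K^{1,Z},b_K^{1,Z}):=(a_K,b_K)(N,\tilde N_{1,Z},\delta)$, $(a_K^\omega,b_K^\omega):=(a_K,b_K)(N,\tilde N^{\rm sift}_\omega,\delta)$ for $\omega\in\{S,V\}$, and $(a_K^D,b_K^D):=(a'_K,b'_K)(N,\tilde N^{\rm sift}_D,\delta)$. If $a_K^{1,Z}\le-\sqrt N/2$ put $\underline N_{1,Z}:=0$; otherwise $$\begin{aligned}\underline N_{1,Z}:=\Big(1+\tfrac{2a_K^{1,Z}}{\sqrt N}\Big)^{-1}\Big\{&\lambda\Big[N_S^{\rm sift}\Big(1+\tfrac{2a_K^S}{\sqrt N}\Big)+(b_K^S-a_K^S)\sqrt N\Big]+\gamma\Big[N_V^{\rm sift}\Big(1+\tfrac{2a_K^V}{\sqrt N}\Big)+(b_K^V-a_K^V)\sqrt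 N\Big]\\&+\zeta\Big[N_D^{\rm sift}-\Big(b_K^D+a_K^D\Big(\tfrac{2N_D^{\rm sift}}N-1\Big)\Big)\sqrt N\Big]-(b_K^{1,Z}-a_K^{1,Z})\sqrt N\Big\}.\end{aligned}$$ *Conclusion.* For every such choice of parameters, every squashing map and every attack of Eve (with arbitrary signal and memory Hilbert spaces), $$\Pr\big(N_{1,Z}<\underline N_{1,Z}\big)<\tfrac18\,\epsilon_{\rm secrecy}^2 .$$ -/

import Mathlib

open scoped ENNReal

noncomputable section

namespace DecoyBB84

/-! ### Hilbert spaces, operators and completely positive maps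

A quantum system is given by a set `ι` labelling an orthonormal basis; its Hilbert space is `ℓ²(ι)`,
and a composite system has the product of the label sets as its labels. -/

/-- The Hilbert space with orthonormal basis labelled by `ι`. -/
abbrev Hilb (ι : Type) : Type := lp (fun _ : ι => ℂ) 2

/-- Bounded operators between two systems. -/
abbrev Op (ι κ : Type) : Type := Hilb ι →L[ℂ] Hilb κ

open Classical in
/-- The basis vector `|i⟩`. -/
def ket {ι : Type} (i : ι) : Hilb ι := lp.single 2 i (1 : ℂ)

/-- `|x⟩⟨y|`. -/
def ketbra {ι κ : Type} (x : Hilb κ) (y : Hilb ι) : Op ι κ := InnerProductSpace.rankOne ℂ x y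

/-- The operator `|x⟩⟨x|`. -/
def proj {ι : Type} (x : Hilb ι) : Op ι ι := ketbra x x

/-- The trace, computed in the basis `|i⟩`. -/
def tr {ι : Type} (T : Op ι ι) : ℂ := ∑' i, inner ℂ (ket i) (T (ket i))

theorem memlp_two_iff {ι : Type} (f : ι → ℂ) :
    Memℓp f 2 ↔ Summable fun i => ‖f i‖ ^ 2 := by
  rw [memℓp_gen_iff (by norm_num)]
  simp

theorem norm_sq_hasSum {ι : Type} (x : Hilb ι) : HasSum (fun i => ‖x i‖ ^ 2) (‖x‖ ^ 2) := by
  have h := lp.hasSum_norm (p := 2) (by norm_num) x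
  simpa using h

/-- Relabelling of the basis along a bijection, as an operator. -/
def relabel {ι κ : Type} (e : ι ≃ κ) : Op ι κ :=
  LinearMap.mkContinuous
    { toFun := fun x => ⟨fun k => x (e.symm k), by
        have h := (norm_sq_hasSum x).summable
        exact (memlp_two_iff _).2 (e.symm.summable_iff (f := fun i => ‖x i‖ ^ 2) |>.2 h)⟩
      map_add' := fun _ _ => rfl
      map_smul' := fun _ _ => rfl }
    1 (fun x => by
      rw [one_mul, ← sq_le_sq₀ (norm_nonneg _) (norm_nonneg _)]
      refine le_of_eq ((norm_sq_hasSum _).unique ?_)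
      exact (e.symm.hasSum_iff (f := fun i => ‖x i‖ ^ 2)).2 (norm_sq_hasSum x))

/-- The component of a vector of `ι × γ` along `|g⟩`. -/
def slice {ι γ : Type} (x : Hilb (ι × γ)) (g : γ) : Hilb ι :=
  ⟨fun i => x (i, g), (memlp_two_iff _).2 ((norm_sq_hasSum x).summable.comp_injective
    (i := fun i => (i, g)) (fun _ _ h => (Prod.ext_iff.1 h).1))⟩

theorem slice_hasSum {ι γ : Type} (x : Hilb (ι × γ)) :
    HasSum (fun g => ‖slice x g‖ ^ 2) (‖x‖ ^ 2) := by
  have h := (Equiv.prodComm γ ι).hasSum_iff.2 (norm_sq_hasSum x)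
  exact h.prod_fiberwise fun g => norm_sq_hasSum (slice x g)

theorem ampl_hasSum {ι κ γ : Type} (A : Op ι κ) (x : Hilb (ι × γ)) :
    ∃ s, HasSum (fun p : κ × γ => ‖A (slice x p.2) p.1‖ ^ 2) s ∧ s ≤ ‖A‖ ^ 2 * ‖x‖ ^ 2 := by
  have hb : ∀ g, ‖A (slice x g)‖ ^ 2 ≤ ‖A‖ ^ 2 * ‖slice x g‖ ^ 2 := fun g => by
    rw [← mul_pow]
    exact pow_le_pow_left₀ (norm_nonneg _) (A.le_opNorm _) 2
  have hR := (slice_hasSum x).mul_left (‖A‖ ^ 2)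
  have hs : Summable fun g => ‖A (slice x g)‖ ^ 2 :=
    Summable.of_nonneg_of_le (fun _ => sq_nonneg _) hb hR.summable
  have hp : Summable fun p : γ × κ => ‖A (slice x p.1) p.2‖ ^ 2 := by
    refine (summable_prod_of_nonneg (fun _ => sq_nonneg _)).2
      ⟨fun g => (norm_sq_hasSum (A (slice x g))).summable, ?_⟩
    simpa only [(norm_sq_hasSum (A (slice x _))).tsum_eq] using hs
  have h1 := hp.hasSum.prod_fiberwise fun g => norm_sq_hasSum (A (slice x g))
  refine ⟨_, (Equiv.prodComm κ γ).hasSum_iff.2 hp.hasSum, ?_⟩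
  exact hasSum_le hb h1 hR

/-- The action of `A ⊗ 1` on vectors: `A` is applied to each component along `γ`. -/
def amplFun {ι κ γ : Type} (A : Op ι κ) (x : Hilb (ι × γ)) : Hilb (κ × γ) :=
  ⟨fun p => A (slice x p.2) p.1, (memlp_two_iff _).2 (ampl_hasSum A x).choose_spec.1.summable⟩

theorem amplFun_norm_le {ι κ γ : Type} (A : Op ι κ) (x : Hilb (ι × γ)) :
    ‖amplFun A x‖ ≤ ‖A‖ * ‖x‖ := by
  obtain ⟨s, hs, hle⟩ := ampl_hasSum A x
  have h : ‖amplFun A x‖ ^ 2 = s := (norm_sq_hasSum (amplFun A x)).unique hs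
  rw [← sq_le_sq₀ (norm_nonneg _) (mul_nonneg (norm_nonneg _) (norm_nonneg _)), mul_pow, h]
  exact hle

theorem amplFun_add {ι κ γ : Type} (A : Op ι κ) (x y : Hilb (ι × γ)) :
    amplFun A (x + y) = amplFun A x + amplFun A y := by
  ext p
  change A (slice (x + y) p.2) p.1 = A (slice x p.2) p.1 + A (slice y p.2) p.1
  rw [show slice (x + y) p.2 = slice x p.2 + slice y p.2 from rfl, map_add]
  rfl

theorem amplFun_smul {ι κ γ : Type} (A : Op ι κ) (c : ℂ) (x : Hilb (ι × γ)) :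
    amplFun A (c • x) = c • amplFun A x := by
  ext p
  change A (slice (c • x) p.2) p.1 = c • A (slice x p.2) p.1
  rw [show slice (c • x) p.2 = c • slice x p.2 from rfl, map_smul]
  rfl

/-- The operator `A ⊗ 1`. -/
def ampl {ι κ : Type} (γ : Type) (A : Op ι κ) : Op (ι × γ) (κ × γ) :=
  LinearMap.mkContinuous
    { toFun := amplFun A, map_add' := amplFun_add A, map_smul' := amplFun_smul A }
    ‖A‖ (amplFun_norm_le A)

/-- The operator `A ⊗ 1` on systems `σ`, `τ` that are identified with `ι × γ`, `κ × γ`. -/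
def amplAlong {ι κ γ σ τ : Type} (e : σ ≃ ι × γ) (f : τ ≃ κ × γ) (A : Op ι κ) : Op σ τ :=
  relabel f.symm ∘L ampl γ A ∘L relabel e

/-- The tensor product `A 0 ⊗ A 1 ⊗ ⋯ ⊗ A (k-1)`. -/
def tensorPi {ι κ : Type} : {k : ℕ} → (Fin k → Op ι κ) → Op (Fin k → ι) (Fin k → κ)
  | 0, _ => relabel (Equiv.ofUnique (Fin 0 → ι) (Fin 0 → κ))
  | k + 1, A =>
      relabel (Fin.consEquiv fun _ : Fin (k + 1) => κ) ∘L
        ampl (Fin k → κ) (A 0) ∘L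
        amplAlong (Equiv.prodComm _ _) (Equiv.prodComm _ _) (tensorPi fun i => A i.succ) ∘L
        relabel (Fin.consEquiv fun _ : Fin (k + 1) => ι).symm

/-- A completely positive map `ρ ↦ ∑ₗ Kₗ ρ Kₗ†`, given by its Kraus operators. -/
structure KrausMap (ι κ : Type) where
  /-- The labels of the Kraus operators. -/
  index : Type
  /-- The Kraus operators. -/
  op : index → Op ι κ

namespace KrausMap

/-- Trace preservation, `∑ₗ Kₗ† Kₗ = 1`. With it, the map is a CPTP map. -/
def IsTP {ι κ : Type} (Φ : KrausMap ι κ) : Prop :=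
  ∀ x : Hilb ι, HasSum (fun l => ‖Φ.op l x‖ ^ 2) (‖x‖ ^ 2)

/-- The image of an operator. For a trace-preserving map and a density operator `ρ`, the sum
converges absolutely in operator norm. -/
def map {ι κ : Type} (Φ : KrausMap ι κ) (ρ : Op ι ι) : Op κ κ :=
  ∑' l, Φ.op l ∘L ρ ∘L (Φ.op l).adjoint

/-- The map with a single Kraus operator. -/
def single {ι κ : Type} (A : Op ι κ) : KrausMap ι κ := ⟨Unit, fun _ => A⟩

/-- Composition: first `Φ`, then `Ψ`. -/
def comp {ι κ σ : Type} (Ψ : KrausMap κ σ) (Φ : KrausMap ι κ) : KrausMap ι σ :=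
  ⟨Ψ.index × Φ.index, fun l => Ψ.op l.1 ∘L Φ.op l.2⟩

/-- The map `Φ ⊗ id` on systems `σ`, `τ` that are identified with `ι × γ`, `κ × γ`. -/
def along {ι κ γ σ τ : Type} (e : σ ≃ ι × γ) (f : τ ≃ κ × γ) (Φ : KrausMap ι κ) :
    KrausMap σ τ :=
  ⟨Φ.index, fun l => amplAlong e f (Φ.op l)⟩

/-- The tensor power `Φ ⊗ ⋯ ⊗ Φ` with `k` factors. -/
def pow {ι κ : Type} (Φ : KrausMap ι κ) (k : ℕ) : KrausMap (Fin k → ι) (Fin k → κ) :=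
  ⟨Fin k → Φ.index, fun l => tensorPi fun i => Φ.op (l i)⟩

end KrausMap

/-! ### Labels, registers and parameters -/

/-- Intensity labels: signal, decoy, vacuum. -/
inductive Intensity where
  | S
  | D
  | V
  deriving DecidableEq

instance : Fintype Intensity := ⟨{.S, .D, .V}, fun ω => by cases ω <;> simp⟩

/-- The two bases. -/
inductive BasisLabel where
  | Z
  | X
  deriving DecidableEq

instance : Fintype BasisLabel := ⟨{.Z, .X}, fun α => by cases α <;> simp⟩

open Intensity BasisLabel

/-- Alice's register `A^CR` of one round: intensity, basis, bit. -/
abbrev AReg : Type := Intensity × BasisLabel × Bool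

/-- Bob's register `B^CR` of one round: basis, and outcome, where `none` means "no click". -/
abbrev BReg : Type := BasisLabel × Option Bool

/-- Bob's announcement for one round: basis, click (`true`) or no click, and bit (`none` for
"null"). -/
abbrev BMsg : Type := BasisLabel × Bool × Option Bool

/-- Alice's announcement for one round: intensity, basis and bit, each with `none` for "null". -/
abbrev AMsg : Type := Option Intensity × Option BasisLabel × Option Bool

/-- What Alice and Bob keep from one measured round besides Alice's own register: Bob's register
`B^CR`, Alice's copy `C^{A_B}` of his announcement, Bob's copy `C^{B_A}` of hers. -/
abbrev Kept : Type := BReg × BMsg × AMsg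

/-- What Eve hears in one round: Bob's announcement `C^{E_B}` and Alice's announcement
`C^{E_A}`. -/
abbrev Pub : Type := BMsg × AMsg

/-- The parameters of Alice's source and of the basis choices of Alice and Bob. -/
structure Params where
  /-- `p_ω`, the probability of the intensity label `ω`. -/
  pInt : Intensity → ℝ
  /-- `p_Z` and `p_X`, the probability of each basis, for Alice's and for Bob's choice. -/
  pBasis : BasisLabel → ℝ
  /-- `μ_ω`, the mean photon number of a double pulse with the intensity label `ω`. -/
  μ : Intensity → ℝ

namespace Params

/-- The two choices follow probability distributions, each intensity label being used, and the
intensities satisfy `0 < μ_D < μ_S` and `0 ≤ μ_V < μ_D (μ_S - μ_D) / μ_S`; the last condition holds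
when `V` is the vacuum, `μ_V = 0`. -/
structure Valid (P : Params) : Prop where
  pInt_pos : ∀ ω, 0 < P.pInt ω
  pInt_sum : ∑ ω, P.pInt ω = 1
  pBasis_nonneg : ∀ α, 0 ≤ P.pBasis α
  pBasis_sum : ∑ α, P.pBasis α = 1
  μD_pos : 0 < P.μ D
  μD_lt : P.μ D < P.μ S
  μV_nonneg : 0 ≤ P.μ V
  μV_lt : P.μ V < P.μ D * (P.μ S - P.μ D) / P.μ S

/-- The Poisson probability that a double pulse of intensity label `ω` has `n` photons. -/
def pCS (P : Params) (ω : Intensity) (n : ℕ) : ℝ :=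
  P.μ ω ^ n / (n.factorial : ℝ) * Real.exp (-P.μ ω)

/-- `p^int_{ω,n} = p_ω p^CS_{μ_ω,n}`. -/
def pJoint (P : Params) (ω : Intensity) (n : ℕ) : ℝ := P.pInt ω * P.pCS ω n

/-- `p^int_{ω|n}`. -/
def pCond (P : Params) (ω : Intensity) (n : ℕ) : ℝ := P.pJoint ω n / ∑ ω', P.pJoint ω' n

/-- The relative phase `θ_{a,α}`. -/
def phase : Bool → BasisLabel → ℝ
  | false, Z => 0
  | true, Z => Real.pi
  | false, X => Real.pi / 2
  | true, X => 3 * Real.pi / 2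

/-- Alice's state `|Ψ_in,vir⟩` of one round on the systems `A^CR`, `R` (photon number) and `A^sig`
(photon numbers of the first and of the second pulse). -/
def sourceState (P : Params) : Hilb (AReg × ℕ × (ℕ × ℕ)) :=
  ∑ ω, ∑ α, ∑ a : Bool, ((√(1 / 2 * P.pInt ω * P.pBasis α) : ℝ) : ℂ) •
    ∑' n : ℕ, ((√(P.pCS ω n) : ℝ) : ℂ) •
      ∑ k ∈ Finset.range (n + 1),
        (((√(1 / 2 ^ n * (n.choose k : ℝ)) : ℝ) : ℂ) *
            Complex.exp (Complex.I * (phase a α : ℂ) * ((n - k : ℕ) : ℂ))) •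
          ket ((ω, α, a), n, (n - k, k))

end Params

/-! ### One round after Eve's transmission -/

/-- `(-1)^x`. -/
def sgn (x : Bool) : ℂ := if x then -1 else 1

/-- The `X`-basis vector `(|f 0⟩ + (-1)^b |f 1⟩) / √2` of the qubit with `Z`-basis `|f 0⟩`,
`|f 1⟩`. -/
def xket {ι : Type} (f : Bool → ι) (b : Bool) : Hilb ι :=
  ((√2 : ℝ) : ℂ)⁻¹ • (ket (f false) + sgn b • ket (f true))

/-- Bob's measurement in the virtual protocol, after the squashing map: the basis `β` is drawn with
probability `p_β` and stored; it is found whether there is a click; in the `X` basis a click is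
followed by the projective `X`-measurement of the qubit, in the `Z` basis the qubit is left alone. -/
def bobVirtual (P : Params) : KrausMap (Option Bool) BReg where
  index := BasisLabel ⊕ Bool ⊕ Unit
  op
    | .inl β => ((√(P.pBasis β) : ℝ) : ℂ) • ketbra (ket (β, none)) (ket none)
    | .inr (.inl b) => ((√(P.pBasis X) : ℝ) : ℂ) • ketbra (xket (fun c => (X, some c)) b) (xket some b)
    | .inr (.inr ()) =>
        ((√(P.pBasis Z) : ℝ) : ℂ) • ∑ b : Bool, ketbra (ket (Z, some b)) (ket (some b))

/-- Bob's announcement, with a copy for Alice (`C^{A_B}`) and one for Eve (`C^{E_B}`): basis and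
click or no click, and the outcome of a click in the `X` basis. In the `X` basis the stored outcome
`b` is the `X`-eigenstate that the measurement leaves. -/
def bobAnnounce : Op BReg (BReg × BMsg × BMsg) :=
  (∑ β, ketbra (ket ((β, none), (β, false, none), (β, false, none))) (ket (β, none))) +
  (∑ b : Bool, ketbra (ket ((Z, some b), (Z, true, none), (Z, true, none))) (ket (Z, some b))) +
  ∑ b : Bool, ketbra (xket (fun c => ((X, some c), (X, true, some b), (X, true, some b))) b)
    (xket (fun c => (X, some c)) b)

/-- What Alice announces, given her register and Bob's announcement: intensity and basis if there
was a click and the bases agree, and then also the bit in the `X` basis. -/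
def aliceMsg : AReg → BMsg → AMsg
  | (ω, α, a), (β, click, _) =>
    if click = true ∧ α = β then (some ω, some α, if α = X then some a else none)
    else (none, none, none)

/-- Alice's announcement, with a copy for Bob (`C^{B_A}`) and one for Eve (`C^{E_A}`). -/
def aliceAnnounce : Op (AReg × BMsg) (AReg × BMsg × AMsg × AMsg) :=
  ∑ s : AReg × BMsg,
    ketbra (ket (s.1, s.2, aliceMsg s.1 s.2, aliceMsg s.1 s.2)) (ket s)

/-- The composition `E^{A,public} ∘ E^{B,public} ∘ E^{B,vir}` for one round, where Bob receives the
signal system `β` and applies the squashing map `squash` first. -/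
def roundMap (P : Params) {β : Type} (squash : KrausMap β (Option Bool)) :
    KrausMap (AReg × β) (AReg × Kept × Pub) :=
  let measure : KrausMap (AReg × β) (AReg × BReg) :=
    ((bobVirtual P).comp squash).along (Equiv.prodComm _ _) (Equiv.prodComm _ _)
  let bob : KrausMap (AReg × BReg) (AReg × BReg × BMsg × BMsg) :=
    (KrausMap.single bobAnnounce).along (Equiv.prodComm _ _) (Equiv.prodComm _ _)
  let alice : KrausMap (AReg × BReg × BMsg × BMsg) (AReg × Kept × Pub) :=
    (KrausMap.single aliceAnnounce).along
      (γ := BReg × BMsg)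
      ⟨fun s => ((s.1, s.2.2.1), s.2.1, s.2.2.2), fun s => (s.1.1, s.2.1, s.1.2, s.2.2),
        fun _ => rfl, fun _ => rfl⟩
      ⟨fun s => ((s.1, s.2.1.2.1, s.2.1.2.2, s.2.2.2), s.2.1.1, s.2.2.1),
        fun s => (s.1.1, (s.2.1, s.1.2.1, s.1.2.2.1), (s.2.2, s.1.2.2.2)),
        fun _ => rfl, fun _ => rfl⟩
  alice.comp (bob.comp measure)

/-! ### The whole virtual protocol: `J` blocks of `M` double pulses -/

/-- The system after `j` blocks: Alice's registers `A^CR` and `R` of all rounds, what is kept from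
the rounds of the first `j` blocks, and a system `Y` in Eve's hands or on its way to Bob. -/
abbrev Stage (J M j : ℕ) (Y : Type) : Type :=
  ((Fin J → Fin M → AReg) × (Fin J → Fin M → ℕ) × (Fin j → Fin M → Kept)) × Y

/-- What Eve holds when she prepares the signals of block number `j` (counted from `0`): at first all
of Alice's double pulses, later her memory and the announcements about the preceding block. -/
def EveIn (J M : ℕ) (ε : Type) : ℕ → Type
  | 0 => Fin J → Fin M → ℕ × ℕ
  | _ + 1 => (Fin M → Pub) × ε

/-- Eve's coherent attack. The signal system of one round is `β`, her memory is `ε`. A memory that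
she holds at the start is part of her first map. -/
structure Eve (J M : ℕ) (β ε : Type) where
  /-- The map that outputs the signals of block number `j`. -/
  deliver : ∀ j : ℕ, KrausMap (EveIn J M ε j) ((Fin M → β) × ε)
  /-- The map that she applies after the last announcement. -/
  final : KrausMap (EveIn J M ε J) ε

/-- All of Eve's maps are trace preserving. -/
def Eve.IsTP {J M : ℕ} {β ε : Type} (E : Eve J M β ε) : Prop :=
  (∀ j, (E.deliver j).IsTP) ∧ E.final.IsTP

/-- The registers of Alice that do not belong to block `j`, the photon numbers, what is kept from
earlier blocks, and Eve's memory. -/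
abbrev Rest (J M : ℕ) (j : Fin J) (ε : Type) : Type :=
  ({k : Fin J // k ≠ j} → Fin M → AReg) × (Fin J → Fin M → ℕ) × (Fin j.1 → Fin M → Kept) × ε

/-- Before the measurement of block `j`: its rounds, each with Alice's register and the signal, and
the rest. -/
def splitBefore {J M : ℕ} (j : Fin J) (β ε : Type) :
    Stage J M j.1 ((Fin M → β) × ε) ≃ (Fin M → AReg × β) × Rest J M j ε where
  toFun s := (fun m => (s.1.1 j m, s.2.1 m), fun k => s.1.1 k, s.1.2.1, s.1.2.2, s.2.2)
  invFun t := (((Equiv.funSplitAt j _).symm (fun m => (t.1 m).1, t.2.1), t.2.2.1, t.2.2.2.1),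
    fun m => (t.1 m).2, t.2.2.2.2)
  left_inv s := by
    have h := (Equiv.funSplitAt j (Fin M → AReg)).symm_apply_apply s.1.1
    exact Prod.ext (Prod.ext h rfl) rfl
  right_inv t := by
    have h := (Equiv.funSplitAt j (Fin M → AReg)).apply_symm_apply (fun m => (t.1 m).1, t.2.1)
    have h1 := congrArg Prod.fst h
    have h2 := congrArg Prod.snd h
    refine Prod.ext (funext fun m => Prod.ext (congrFun h1 m) rfl) (Prod.ext h2 rfl)

/-- After the announcements about block `j`: its rounds, and the rest. -/
def splitAfter {J M : ℕ} (j : Fin J) (ε : Type) :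
    Stage J M (j.1 + 1) ((Fin M → Pub) × ε) ≃ (Fin M → AReg × Kept × Pub) × Rest J M j ε where
  toFun s := (fun m => (s.1.1 j m, s.1.2.2 (Fin.last _) m, s.2.1 m),
    fun k => s.1.1 k, s.1.2.1, fun i => s.1.2.2 i.castSucc, s.2.2)
  invFun t := (((Equiv.funSplitAt j _).symm (fun m => (t.1 m).1, t.2.1), t.2.2.1,
    Fin.snoc (α := fun _ => Fin M → Kept) t.2.2.2.1 fun m => (t.1 m).2.1),
    fun m => (t.1 m).2.2, t.2.2.2.2)
  left_inv s := by
    have h := (Equiv.funSplitAt j (Fin M → AReg)).symm_apply_apply s.1.1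
    exact Prod.ext (Prod.ext h (Prod.ext rfl (Fin.snoc_init_self s.1.2.2))) rfl
  right_inv t := by
    have h := (Equiv.funSplitAt j (Fin M → AReg)).apply_symm_apply (fun m => (t.1 m).1, t.2.1)
    have h1 := congrArg Prod.fst h
    have h2 := congrArg Prod.snd h
    refine Prod.ext (funext fun m => Prod.ext (congrFun h1 m) (Prod.ext ?_ rfl))
      (Prod.ext h2 (Prod.ext rfl (Prod.ext ?_ rfl)))
    · exact congrFun (Fin.snoc_last (α := fun _ => Fin M → Kept) _ _) m
    · funext i
      exact Fin.snoc_castSucc (α := fun _ => Fin M → Kept) _ _ i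

/-- The measurement of block `j` and the announcements about it. -/
def blockMap (P : Params) {J M : ℕ} {β ε : Type} (squash : KrausMap β (Option Bool)) (j : Fin J) :
    KrausMap (Stage J M j.1 ((Fin M → β) × ε)) (Stage J M (j.1 + 1) ((Fin M → Pub) × ε)) :=
  ((roundMap P squash).pow M).along (splitBefore j β ε) (splitAfter j ε)

/-- Sorting the systems of all rounds into Alice's registers, photon numbers and double pulses. -/
def splitSource (J M : ℕ) :
    (Fin J → Fin M → AReg × ℕ × (ℕ × ℕ)) ≃ Stage J M 0 (Fin J → Fin M → ℕ × ℕ) where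
  toFun s := ((fun j m => (s j m).1, fun j m => (s j m).2.1, fun i => i.elim0),
    fun j m => (s j m).2.2)
  invFun t := fun j m => (t.1.1 j m, t.1.2.1 j m, t.2 j m)
  left_inv _ := rfl
  right_inv _ := Prod.ext (Prod.ext rfl (Prod.ext rfl (funext fun i => i.elim0))) rfl

/-- The state after `j` blocks have been sent, measured and announced. -/
def stateAfter (P : Params) {J M : ℕ} {β ε : Type} (squash : KrausMap β (Option Bool))
    (E : Eve J M β ε) :
    (j : ℕ) → j ≤ J → Op (Stage J M j (EveIn J M ε j)) (Stage J M j (EveIn J M ε j))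
  | 0, _ => relabel (splitSource J M) ∘L
      tensorPi (fun _ => tensorPi fun _ => proj P.sourceState) ∘L relabel (splitSource J M).symm
  | j + 1, h => (blockMap P squash (⟨j, h⟩ : Fin J)).map
      (((E.deliver j).along (Equiv.prodComm _ _) (Equiv.prodComm _ _)).map
        (stateAfter P squash E j (Nat.le_of_succ_le h)))

/-- The state `ρ_QC,vir` at the end of the quantum communication and of all announcements. -/
def rhoVir (P : Params) {J M : ℕ} {β ε : Type} (squash : KrausMap β (Option Bool))
    (E : Eve J M β ε) : Op (Stage J M J ε) (Stage J M J ε) :=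
  (E.final.along (Equiv.prodComm _ _) (Equiv.prodComm _ _)).map (stateAfter P squash E J le_rfl)

/-! ### The final measurement -/

/-- The outcome of one round: photon number, intensity, Alice's basis, Bob's basis, and `e_X`, where
`none` means "no click". -/
structure Outcome where
  /-- The photon number. -/
  n : ℕ
  /-- The intensity label. -/
  ω : Intensity
  /-- Alice's basis. -/
  α : BasisLabel
  /-- Bob's basis. -/
  β : BasisLabel
  /-- The `X`-basis error bit, or no click. -/
  e : Option Bool

/-- The POVM element of one round, on `A^CR`, `R` and `B^CR`. -/
def roundPOVM (o : Outcome) : Op (AReg × ℕ × BReg) (AReg × ℕ × BReg) :=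
  match o.e with
  | none => ∑ a : Bool, proj (ket ((o.ω, o.α, a), o.n, (o.β, none)))
  | some e => (1 / 4 : ℂ) • ∑ x : Bool, proj (∑ a : Bool, ∑ b : Bool,
      sgn (xor (a && x) (b && xor x e)) • ket ((o.ω, o.α, a), o.n, (o.β, some b)))

/-- The measured systems of all rounds, and the rest. -/
def splitFinal (J M : ℕ) (ε : Type) :
    Stage J M J ε ≃ (Fin J → Fin M → AReg × ℕ × BReg) × ((Fin J → Fin M → BMsg × AMsg) × ε) where
  toFun s := (fun j m => (s.1.1 j m, s.1.2.1 j m, (s.1.2.2 j m).1),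
    fun j m => (s.1.2.2 j m).2, s.2)
  invFun t := ((fun j m => (t.1 j m).1, fun j m => (t.1 j m).2.1,
    fun j m => ((t.1 j m).2.2, t.2.1 j m)), t.2.2)
  left_inv _ := rfl
  right_inv _ := rfl

/-- The POVM element of an outcome of all rounds. -/
def finalPOVM {J M : ℕ} (ε : Type) (o : Fin J → Fin M → Outcome) :
    Op (Stage J M J ε) (Stage J M J ε) :=
  amplAlong (splitFinal J M ε) (splitFinal J M ε)
    (tensorPi fun j => tensorPi fun m => roundPOVM (o j m))

/-- `Pr_QC(o) = tr (Ê_o ρ_QC,vir)`. -/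
def prOutcome (P : Params) {J M : ℕ} {β ε : Type} (squash : KrausMap β (Option Bool))
    (E : Eve J M β ε) (o : Fin J → Fin M → Outcome) : ℝ :=
  (tr (finalPOVM ε o ∘L rhoVir P squash E)).re

/-- The probability of an event about the outcomes. -/
def prEvent (P : Params) {J M : ℕ} {β ε : Type} (squash : KrausMap β (Option Bool))
    (E : Eve J M β ε) (A : Set (Fin J → Fin M → Outcome)) : ℝ≥0∞ :=
  ∑' o : A, ENNReal.ofReal (prOutcome P squash E o)

/-- `N_{1,Z}`: the number of rounds with one emitted photon, both bases `Z`, and a click. -/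
def N1Z {J M : ℕ} (o : Fin J → Fin M → Outcome) : ℕ :=
  {i : Fin J × Fin M | (o i.1 i.2).n = 1 ∧ (o i.1 i.2).α = Z ∧ (o i.1 i.2).β = Z ∧
    (o i.1 i.2).e ≠ none}.ncard

/-- `N_ω^sift`: the number of rounds with intensity label `ω`, both bases `Z`, and a click. -/
def Nsift {J M : ℕ} (o : Fin J → Fin M → Outcome) (ω : Intensity) : ℕ :=
  {i : Fin J × Fin M | (o i.1 i.2).ω = ω ∧ (o i.1 i.2).α = Z ∧ (o i.1 i.2).β = Z ∧
    (o i.1 i.2).e ≠ none}.ncard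

/-! ### The explicit lower bound -/

/-- `a_K(s,t,ε)`. -/
def aK (s t ε : ℝ) : ℝ :=
  (216 * √s * t * (s - t) * Real.log ε - 48 * s ^ (3 / 2 : ℝ) * Real.log ε ^ 2
      + 27 * √2 * (s - 2 * t) * √(-s ^ 2 * Real.log ε * (9 * t * (s - t) - 2 * s * Real.log ε)))
    / (4 * (9 * s - 8 * Real.log ε) * (9 * t * (s - t) - 2 * s * Real.log ε))

/-- `b_K(s,t,ε)`. -/
def bK (s t ε : ℝ) : ℝ :=
  √(18 * aK s t ε ^ 2 * s - (16 * aK s t ε ^ 2 + 24 * aK s t ε * √s + 9 * s) * Real.log ε)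
    / (3 * √(2 * s))

/-- `a'_K(s,t,ε)`. -/
def aK' (s t ε : ℝ) : ℝ :=
  (-216 * √s * t * (s - t) * Real.log ε + 48 * s ^ (3 / 2 : ℝ) * Real.log ε ^ 2
      + 27 * √2 * (s - 2 * t) * √(-s ^ 2 * Real.log ε * (9 * t * (s - t) - 2 * s * Real.log ε)))
    / (4 * (9 * s - 8 * Real.log ε) * (9 * t * (s - t) - 2 * s * Real.log ε))

/-- `b'_K(s,t,ε)`. -/
def bK' (s t ε : ℝ) : ℝ :=
  √(18 * aK' s t ε ^ 2 * s - (16 * aK' s t ε ^ 2 - 24 * aK' s t ε * √s + 9 * s) * Real.log ε)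
    / (3 * √(2 * s))

namespace Params

/-- The common factor `-(μ_D²/μ_S²) p_{S|1}/p_{S,0} + p_{D|1}/p_{D,0} - p_{V|1}/p_{V,0}`. -/
def decoyFactor (P : Params) : ℝ :=
  -(P.μ D ^ 2 / P.μ S ^ 2) * (P.pCond S 1 / P.pJoint S 0) + P.pCond D 1 / P.pJoint D 0
    - P.pCond V 1 / P.pJoint V 0

/-- The coefficient `λ` of the signal detections. -/
def lam (P : Params) : ℝ :=
  -(P.decoyFactor)⁻¹ * (1 / P.pJoint S 0) * (P.μ D ^ 2 / P.μ S ^ 2)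

/-- The coefficient `ζ` of the decoy detections. -/
def zeta (P : Params) : ℝ := (P.decoyFactor)⁻¹ * (1 / P.pJoint D 0)

/-- The coefficient `γ` of the vacuum detections. -/
def gam (P : Params) : ℝ := -(P.decoyFactor)⁻¹ * (1 / P.pJoint V 0)

/-- The lower bound on `N_{1,Z}`, for `N` rounds, observed counts `c ω` of `N_ω^sift`, predetermined
estimates `t ω` of `N_ω^sift` and `t1` of `N_{1,Z}`, and the secrecy parameter `εs`. -/
def lowerN1Z (P : Params) (N : ℝ) (c t : Intensity → ℝ) (t1 εs : ℝ) : ℝ :=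
  let δ := εs ^ 2 / 32
  let a1 := aK N t1 δ
  let b1 := bK N t1 δ
  let aS := aK N (t S) δ
  let bS := bK N (t S) δ
  let aV := aK N (t V) δ
  let bV := bK N (t V) δ
  let aD := aK' N (t D) δ
  let bD := bK' N (t D) δ
  if -√N / 2 < a1 then
    (1 + a1 * (2 / √N))⁻¹ *
      (P.lam * (c S * (1 + aS * (2 / √N)) + (bS - aS) * √N)
        + P.gam * (c V * (1 + aV * (2 / √N)) + (bV - aV) * √N)
        + P.zeta * (c D - (bD + aD * (2 * c D / N - 1)) * √N)
        - (b1 - a1) * √N)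
  else 0

end Params

end DecoyBB84

end

/-!
The count `N_{1,Z}` cannot be observed, but it is tied to the sifted counts `N_ω^sift`, because the
announced intensity of a round is independent of all that Eve and Bob did, given the number `n` of
photons in it. The proof has a quantum part, which establishes this independence for coherent attacks,
and a classical part, which turns it into a bound by a concentration inequality.

*Reduction to classical labels.* All events in question ignore the bits `e_X`. Summed over `e_X`, the
measurement of a round is diagonal in the label basis (`sum_roundPOVM`), so that the probability of an
event is a sum of diagonal entries of the final state (`prEvent_eq_tsum_marg`). The state is handled
as a sum `∑ |ψₗ⟩⟨ψₗ|` (`Unravels`), on which a completely positive map acts by applying its Kraus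
operators to the vectors `ψₗ`. For the distribution `qDist` of the labels after `j` blocks there are
two facts. It is consistent in `j`, because Eve's maps are trace preserving and so are Bob's
(`tsum_qDist_succ`). And for a round of the block that was measured last, its dependence on the
intensity `ω` of the round is a factor `p^int_{ω,n}` (`qDist_omega`): this is how `ω` enters into the
source state (`Params.sourceState_apply`), nothing that Eve or Bob does in or before that block acts
on Alice's register, and her announcements, which do depend on `ω`, are summed over; as they are
functions of the other labels, this leaves a weight of Bob's part alone (`tsum_messages`).

*Conditional probabilities.* The rounds are numbered block by block, and `roundFiltration` records the
labels of the rounds so far. By the two facts, given the past, the photon number `n` of a round and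
that it is sifted, the intensity has the distribution `p^int_{ω|n}`
(`labelMeasure_intensity_ratio`). Since `λ p_{S|n} + ζ p_{D|n} + γ p_{V|n}` equals `1` for `n = 1` and
is at most `0` otherwise (`Params.decoy_combination_le`), the conditional probability of a sifted
single-photon round is at least the combination of the conditional probabilities of the sifted rounds
of each intensity (`decoy_condExp_le`).

*Concentration.* Kato's inequality (`kato_inequality`) compares a count of dependent events with the
sum of their conditional probabilities. It is used once for each of the four counts, with failure
probability below `εs² / 32`; for the intensity `D`, where the sum is to be bounded from below, it is
applied to the rounds that are not counted. Off the four exceptional events the bound follows by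
arithmetic (`lowerN1Z_le`). Kato's inequality rests on the bound `bernoulli_mgf_le` for exponential
moments, which is dual to a refinement of Pinsker's inequality (`bernoulli_relEntropy_ge`).
-/

section Concentration

open MeasureTheory

/-! ### A concentration inequality for sums of dependent Bernoulli variables -/

/-- The Padé-type bound `log x ≤ (x² + 4x - 5) / (4x + 2)`; the derivative of the difference is
`4 (x - 1)³ / (x (4x + 2)²)`. -/
theorem Real.log_le_pade {x : ℝ} (hx : 0 < x) :
    Real.log x ≤ (x ^ 2 + 4 * x - 5) / (4 * x + 2) := by
  let f : ℝ → ℝ := fun y => (y ^ 2 + 4 * y - 5) / (4 * y + 2) - Real.log y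
  have hd : ∀ y : ℝ, 0 < y → HasDerivAt f (4 * (y - 1) ^ 3 / (y * (4 * y + 2) ^ 2)) y := by
    intro y hy
    have h1 : HasDerivAt (fun y : ℝ => y ^ 2 + 4 * y - 5) (2 * y + 4) y :=
      ((((hasDerivAt_id y).pow 2).add ((hasDerivAt_id y).const_mul 4)).sub_const 5).congr_deriv
        (by simp)
    have h2 : HasDerivAt (fun y : ℝ => 4 * y + 2) 4 y :=
      (((hasDerivAt_id y).const_mul 4).add_const 2).congr_deriv (by simp)
    refine ((h1.div h2 (by positivity)).sub (Real.hasDerivAt_log hy.ne')).congr_deriv ?_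
    field_simp
    ring
  have h1 : f 1 = 0 := by simp only [f]; norm_num
  suffices h : f 1 ≤ f x by
    rw [h1] at h
    simp only [f] at h
    linarith
  rcases le_total x 1 with h | h
  · have ha : AntitoneOn f (Set.Icc x 1) := by
      refine antitoneOn_of_deriv_nonpos (convex_Icc _ _) ?_ ?_ ?_
      · exact fun y hy => (hd y (hx.trans_le hy.1)).continuousAt.continuousWithinAt
      · intro y hy
        rw [interior_Icc] at hy
        exact (hd y (hx.trans hy.1)).differentiableAt.differentiableWithinAt
      · intro y hy
        rw [interior_Icc] at hy
        have hy0 := hx.trans hy.1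
        rw [(hd y hy0).deriv]
        refine div_nonpos_of_nonpos_of_nonneg ?_ (by positivity)
        have : (y - 1) ^ 3 ≤ 0 := Odd.pow_nonpos (by decide) (by linarith [hy.2])
        linarith
    exact ha (Set.left_mem_Icc.2 h) (Set.right_mem_Icc.2 h) h
  · have ha : MonotoneOn f (Set.Icc 1 x) := by
      refine monotoneOn_of_deriv_nonneg (convex_Icc _ _) ?_ ?_ ?_
      · exact fun y hy => (hd y (one_pos.trans_le hy.1)).continuousAt.continuousWithinAt
      · intro y hy
        rw [interior_Icc] at hy
        exact (hd y (one_pos.trans hy.1)).differentiableAt.differentiableWithinAt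
      · intro y hy
        rw [interior_Icc] at hy
        have hy0 := one_pos.trans hy.1
        rw [(hd y hy0).deriv]
        have : 0 ≤ y - 1 := by linarith [hy.1]
        positivity
    exact ha (Set.left_mem_Icc.2 h) (Set.right_mem_Icc.2 h) h

/-- The contribution of one outcome to the refined Pinsker inequality. -/
theorem mul_log_div_add_sub_ge {p q : ℝ} (hp : 0 < p) (hq : 0 < q) :
    (p - q) ^ 2 / (2 * ((q + 2 * p) / 3)) ≤ q * Real.log (q / p) + (p - q) := by
  have h := Real.log_le_pade (div_pos hp hq)
  have h2 : Real.log (q / p) = -Real.log (p / q) := by rw [← Real.log_inv, inv_div]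
  rw [h2]
  have h3 : q * Real.log (p / q) ≤ q * (((p / q) ^ 2 + 4 * (p / q) - 5) / (4 * (p / q) + 2)) :=
    mul_le_mul_of_nonneg_left h hq.le
  have h4 : q * (((p / q) ^ 2 + 4 * (p / q) - 5) / (4 * (p / q) + 2)) =
      (p - q) - (p - q) ^ 2 / (2 * ((q + 2 * p) / 3)) := by
    field_simp
    ring
  rw [h4] at h3
  linarith

/-- A refinement of Pinsker's inequality: the relative entropy of two Bernoulli distributions is at
least `(p - q)² / (2 m (1 - m))` with `m = (q + 2p) / 3`. -/
theorem bernoulli_relEntropy_ge {p q : ℝ} (hp : 0 < p) (hp1 : p < 1) (hq : 0 < q) (hq1 : q < 1) :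
    (p - q) ^ 2 / (2 * (((q + 2 * p) / 3) * (1 - (q + 2 * p) / 3))) ≤
      q * Real.log (q / p) + (1 - q) * Real.log ((1 - q) / (1 - p)) := by
  have h1 := mul_log_div_add_sub_ge hp hq
  have h2 := mul_log_div_add_sub_ge (sub_pos.2 hp1) (sub_pos.2 hq1)
  have hm : 0 < (q + 2 * p) / 3 := by positivity
  have hm1 : 0 < 1 - (q + 2 * p) / 3 := by linarith
  have h3 : (1 - q + 2 * (1 - p)) / 3 = 1 - (q + 2 * p) / 3 := by ring
  rw [h3] at h2
  have h4 : (p - q) ^ 2 / (2 * (((q + 2 * p) / 3) * (1 - (q + 2 * p) / 3))) =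
      (p - q) ^ 2 / (2 * ((q + 2 * p) / 3)) +
        (1 - p - (1 - q)) ^ 2 / (2 * (1 - (q + 2 * p) / 3)) := by
    generalize (q + 2 * p) / 3 = m at *
    field_simp
    ring
  linarith

/-- The exponential moment behind Kato's inequality: for a Bernoulli variable `ξ` of parameter `p`,
the variable `p - (1 + A) ξ + A / 2` has a logarithmic moment generating function of at most
`s² k² / 8 + A² / (2 k²)`, where `k = 1 + 2 A / 3`. -/
theorem bernoulli_mgf_le {p s A : ℝ} (hp : 0 ≤ p) (hp1 : p ≤ 1) (hk : 1 + 2 * A / 3 ≠ 0) :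
    Real.exp (s * (p + A / 2)) * (1 + (Real.exp (-(s * (1 + A))) - 1) * p) ≤
      Real.exp (s ^ 2 * (1 + 2 * A / 3) ^ 2 / 8 + A ^ 2 / (2 * (1 + 2 * A / 3) ^ 2)) := by
  have amgm : ∀ v : ℝ, s * v ≤ s ^ 2 * (1 + 2 * A / 3) ^ 2 / 8 +
      2 * v ^ 2 / (1 + 2 * A / 3) ^ 2 := by
    intro v
    have h := sq_nonneg (s * (1 + 2 * A / 3) / 4 - v / (1 + 2 * A / 3))
    have h2 : s ^ 2 * (1 + 2 * A / 3) ^ 2 / 8 + 2 * v ^ 2 / (1 + 2 * A / 3) ^ 2 - s * v =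
        2 * (s * (1 + 2 * A / 3) / 4 - v / (1 + 2 * A / 3)) ^ 2 := by
      generalize 1 + 2 * A / 3 = k at *
      field_simp
      ring
    linarith
  -- the two deterministic cases
  rcases hp.eq_or_lt with rfl | hp
  · simp only [mul_zero, add_zero, mul_one, zero_add]
    refine Real.exp_le_exp.2 ((amgm (A / 2)).trans_eq ?_)
    congr 1
    field_simp
  rcases hp1.eq_or_lt with rfl | hp1
  · rw [mul_one, add_sub_cancel, ← Real.exp_add]
    refine Real.exp_le_exp.2 (le_trans (le_of_eq ?_) ((amgm (-A / 2)).trans_eq ?_))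
    · ring
    · congr 1
      field_simp
  set y := s * (1 + A) with hy
  set Z := 1 + (Real.exp (-y) - 1) * p with hZ
  have hE := Real.exp_pos (-y)
  have hZpos : 0 < Z := by
    have : Z = (1 - p) + p * Real.exp (-y) := by rw [hZ]; ring
    rw [this]
    have := sub_pos.2 hp1
    positivity
  -- the tilted parameter
  set q := p * Real.exp (-y) / Z with hq
  have hq0 : 0 < q := by positivity
  have h1q : 1 - q = (1 - p) / Z := by
    rw [hq, eq_div_iff hZpos.ne', sub_mul, div_mul_cancel₀ _ hZpos.ne', hZ]
    ring
  have hq1 : q < 1 := by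
    have : 0 < 1 - q := by rw [h1q]; exact div_pos (sub_pos.2 hp1) hZpos
    linarith
  have hD := bernoulli_relEntropy_ge hp hp1 hq0 hq1
  have hl1 : Real.log (q / p) = -y - Real.log Z := by
    have : q / p = Real.exp (-y) / Z := by rw [hq]; field_simp
    rw [this, Real.log_div hE.ne' hZpos.ne', Real.log_exp]
  have hl2 : Real.log ((1 - q) / (1 - p)) = -Real.log Z := by
    have : (1 - q) / (1 - p) = Z⁻¹ := by
      rw [h1q]
      have := (sub_pos.2 hp1).ne'
      field_simp
    rw [this, Real.log_inv]
  rw [hl1, hl2] at hD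
  rw [← Real.exp_log hZpos, ← Real.exp_add]
  refine Real.exp_le_exp.2 ?_
  clear_value q Z
  have hv := amgm ((p - q) + A * (1 / 2 - q))
  set m := (q + 2 * p) / 3 with hm
  have hm0 : 0 < m := by rw [hm]; positivity
  have hm1 : 0 < 1 - m := by rw [hm]; linarith
  have hW : 0 < m * (1 - m) := mul_pos hm0 hm1
  -- completing the square shows that the entropy term compensates the quadratic one
  have key : 2 * ((p - q) + A * (1 / 2 - q)) ^ 2 / (1 + 2 * A / 3) ^ 2 -
      A ^ 2 / (2 * (1 + 2 * A / 3) ^ 2) ≤ (p - q) ^ 2 / (2 * (m * (1 - m))) := by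
    have hk2 : 0 < (1 + 2 * A / 3) ^ 2 := by positivity
    have e : 2 * ((p - q) + A * (1 / 2 - q)) ^ 2 / (1 + 2 * A / 3) ^ 2 -
        A ^ 2 / (2 * (1 + 2 * A / 3) ^ 2) =
        (4 * ((p - q) + A * (1 / 2 - q)) ^ 2 - A ^ 2) / (2 * (1 + 2 * A / 3) ^ 2) := by
      generalize 1 + 2 * A / 3 = k at *
      field_simp
      ring
    rw [e, div_le_div_iff₀ (by positivity) (by positivity)]
    have hsq := sq_nonneg ((p - q) * (1 - 2 * m) +
      A * (2 * (p - q) / 3 * (1 - 2 * m) - 2 * (m * (1 - m))))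
    have hid : ((p - q) * (1 - 2 * m) +
        A * (2 * (p - q) / 3 * (1 - 2 * m) - 2 * (m * (1 - m)))) ^ 2 =
        (1 + 2 * A / 3) ^ 2 * (p - q) ^ 2 + A ^ 2 * (m * (1 - m)) -
          4 * ((p - q) + A * (1 / 2 - q)) ^ 2 * (m * (1 - m)) := by
      rw [hm]
      ring
    linarith
  have e2 : s * (p + A / 2) + Real.log Z = s * ((p - q) + A * (1 / 2 - q)) -
      (q * (-y - Real.log Z) + (1 - q) * -Real.log Z) := by
    rw [hy]
    ring
  rw [e2]
  linarith

section Kato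

variable {Ω : Type*} {m0 : MeasurableSpace Ω} {μ : Measure Ω} [IsFiniteMeasure μ]

/-- Conditional expectations of a `{0, 1}`-valued variable lie in the unit interval. -/
theorem condExp_mem_Icc {m : MeasurableSpace Ω} (hm : m ≤ m0) {ξ : Ω → ℝ}
    (hξ : Integrable ξ μ) (h01 : ∀ ω, ξ ω ∈ Set.Icc (0 : ℝ) 1) :
    ∀ᵐ ω ∂μ, (μ[ξ|m]) ω ∈ Set.Icc (0 : ℝ) 1 := by
  have h0 : 0 ≤ᵐ[μ] μ[ξ|m] := condExp_nonneg (Filter.Eventually.of_forall fun ω => (h01 ω).1)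
  have h1 : μ[ξ|m] ≤ᵐ[μ] μ[fun _ => (1 : ℝ)|m] :=
    condExp_mono hξ (integrable_const _) (Filter.Eventually.of_forall fun ω => (h01 ω).2)
  rw [condExp_const hm] at h1
  filter_upwards [h0, h1] with ω a b using ⟨a, b⟩

/-- One step of the exponential supermartingale: replacing a Bernoulli variable by its conditional
expectation inside an affine factor. -/
theorem integral_mul_one_add_condExp {m : MeasurableSpace Ω} (hm : m ≤ m0) {ξ H : Ω → ℝ}
    (hξ : Integrable ξ μ) (hH : StronglyMeasurable[m] H) (hHi : Integrable H μ)
    (hHξ : Integrable (H * ξ) μ) (c : ℝ) :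
    ∫ ω, H ω * (1 + c * ξ ω) ∂μ = ∫ ω, H ω * (1 + c * (μ[ξ|m]) ω) ∂μ := by
  have hpull := condExp_mul_of_stronglyMeasurable_left hH hHξ hξ
  have hi : Integrable (H * μ[ξ|m]) μ := integrable_condExp.congr hpull
  have e1 : ∀ f : Ω → ℝ, Integrable (H * f) μ →
      ∫ ω, H ω * (1 + c * f ω) ∂μ = ∫ ω, H ω ∂μ + c * ∫ ω, (H * f) ω ∂μ := by
    intro f hf
    rw [← integral_const_mul, ← integral_add hHi (hf.const_mul c)]
    refine integral_congr_ae (Filter.Eventually.of_forall fun ω => ?_)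
    simp only [Pi.mul_apply]
    ring
  rw [e1 _ hHξ, e1 _ hi, ← integral_condExp hm (f := H * ξ), integral_congr_ae hpull]

variable {ℱ : Filtration ℕ m0} {ξ : ℕ → Ω → ℝ}

/-- The exponential moment of a sum of dependent Bernoulli variables, centred at their conditional
expectations. -/
theorem integral_exp_sum_le (h01 : ∀ k ω, ξ k ω = 0 ∨ ξ k ω = 1)
    (hξ : ∀ k, StronglyMeasurable[ℱ (k + 1)] (ξ k)) {s A : ℝ} (hk : 1 + 2 * A / 3 ≠ 0) (n : ℕ) :
    Integrable (fun ω => Real.exp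
        (s * ∑ k ∈ Finset.range n, ((μ[ξ k|ℱ k]) ω - (1 + A) * ξ k ω + A / 2))) μ ∧
      ∫ ω, Real.exp (s * ∑ k ∈ Finset.range n,
        ((μ[ξ k|ℱ k]) ω - (1 + A) * ξ k ω + A / 2)) ∂μ ≤
      Real.exp (s ^ 2 * (1 + 2 * A / 3) ^ 2 / 8 + A ^ 2 / (2 * (1 + 2 * A / 3) ^ 2)) ^ n *
        μ.real Set.univ := by
  set C := s ^ 2 * (1 + 2 * A / 3) ^ 2 / 8 + A ^ 2 / (2 * (1 + 2 * A / 3) ^ 2)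
  have hξi : ∀ k, Integrable (ξ k) μ := fun k =>
    Integrable.of_bound ((hξ k).mono (ℱ.le _)).aestronglyMeasurable 1
      (Filter.Eventually.of_forall fun ω => by rcases h01 k ω with h | h <;> simp [h])
  have hPb : ∀ k, ∀ᵐ ω ∂μ, (μ[ξ k|ℱ k]) ω ∈ Set.Icc (0 : ℝ) 1 := fun k =>
    condExp_mem_Icc (ℱ.le k) (hξi k) fun ω => by rcases h01 k ω with h | h <;> simp [h]
  set W : ℕ → Ω → ℝ := fun n ω => Real.exp
    (s * ∑ k ∈ Finset.range n, ((μ[ξ k|ℱ k]) ω - (1 + A) * ξ k ω + A / 2)) with hW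
  have hWpos : ∀ n ω, 0 < W n ω := fun n ω => Real.exp_pos _
  have hWm : ∀ n, StronglyMeasurable[ℱ n] (W n) := by
    intro n
    refine Real.continuous_exp.comp_stronglyMeasurable (StronglyMeasurable.const_mul ?_ s)
    refine Finset.stronglyMeasurable_fun_sum _ fun k hkn => ?_
    have hkn := Finset.mem_range.1 hkn
    exact ((stronglyMeasurable_condExp.mono (ℱ.mono hkn.le)).sub
      (((hξ k).mono (ℱ.mono hkn)).const_mul _)).add_const _
  have hWi : ∀ n, Integrable (W n) μ := by
    intro n
    refine Integrable.of_bound ((hWm n).mono (ℱ.le _)).aestronglyMeasurable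
      (Real.exp (|s| * ∑ k ∈ Finset.range n, (1 + |1 + A| + |A / 2|))) ?_
    filter_upwards [ae_all_iff.2 hPb] with ω hω
    rw [Real.norm_eq_abs, Real.abs_exp]
    refine Real.exp_le_exp.2 ((le_abs_self _).trans ?_)
    rw [abs_mul]
    refine mul_le_mul_of_nonneg_left ((Finset.abs_sum_le_sum_abs _ _).trans
      (Finset.sum_le_sum fun k _ => ?_)) (abs_nonneg _)
    have h1 : |(μ[ξ k|ℱ k]) ω| ≤ 1 := by
      rw [abs_of_nonneg (hω k).1]
      exact (hω k).2
    have h2 : |(1 + A) * ξ k ω| ≤ |1 + A| := by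
      rcases h01 k ω with h | h <;> simp [h]
    exact (abs_add_le _ _).trans (add_le_add ((abs_sub _ _).trans (add_le_add h1 h2)) le_rfl)
  refine ⟨hWi n, ?_⟩
  induction n with
  | zero => simp
  | succ n ih =>
    set c := Real.exp (-(s * (1 + A))) - 1
    set G : Ω → ℝ := fun ω => Real.exp (s * ((μ[ξ n|ℱ n]) ω + A / 2)) with hG
    -- the new factor is affine in `ξ n`, as `ξ n` has the values `0` and `1` only
    have hstep : ∀ ω, W (n + 1) ω = W n ω * G ω * (1 + c * ξ n ω) := by
      intro ω
      have h1 : Real.exp (-(s * (1 + A) * ξ n ω)) = 1 + c * ξ n ω := by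
        rcases h01 n ω with h | h <;> simp [h, c]
      rw [← h1]
      simp only [hW, hG]
      rw [Finset.sum_range_succ, ← Real.exp_add, ← Real.exp_add]
      congr 1
      ring
    have hGm : StronglyMeasurable[ℱ n] G :=
      Real.continuous_exp.comp_stronglyMeasurable
        ((stronglyMeasurable_condExp.add_const _).const_mul s)
    have hGb : ∀ᵐ ω ∂μ, ‖G ω‖ ≤ Real.exp (|s| * (1 + |A / 2|)) := by
      filter_upwards [hPb n] with ω hω
      rw [Real.norm_eq_abs, Real.abs_exp]
      refine Real.exp_le_exp.2 ((le_abs_self _).trans ?_)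
      rw [abs_mul]
      refine mul_le_mul_of_nonneg_left ((abs_add_le _ _).trans (add_le_add ?_ le_rfl))
        (abs_nonneg _)
      rw [abs_of_nonneg hω.1]
      exact hω.2
    have hHi : Integrable (W n * G) μ :=
      (hWi n).mul_bdd (c := Real.exp (|s| * (1 + |A / 2|)))
        (hGm.mono (ℱ.le n)).aestronglyMeasurable hGb
    have hHξ : Integrable (W n * G * ξ n) μ :=
      hHi.mul_bdd (c := 1) ((hξ n).mono (ℱ.le _)).aestronglyMeasurable
        (Filter.Eventually.of_forall fun ω => by rcases h01 n ω with h | h <;> simp [h])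
    calc ∫ ω, W (n + 1) ω ∂μ = ∫ ω, (W n * G) ω * (1 + c * ξ n ω) ∂μ := by
          simp only [hstep, Pi.mul_apply]
      _ = ∫ ω, (W n * G) ω * (1 + c * (μ[ξ n|ℱ n]) ω) ∂μ :=
          integral_mul_one_add_condExp (ℱ.le n) (hξi n) ((hWm n).mul hGm) hHi hHξ c
      _ ≤ ∫ ω, W n ω * Real.exp C ∂μ := by
          refine integral_mono_of_nonneg ?_ ((hWi n).mul_const _) ?_
          · filter_upwards [hPb n] with ω hω
            have h2 : 0 ≤ 1 + c * (μ[ξ n|ℱ n]) ω := by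
              have := Real.exp_pos (-(s * (1 + A)))
              have h3 : 1 + c * (μ[ξ n|ℱ n]) ω = (1 - (μ[ξ n|ℱ n]) ω) +
                Real.exp (-(s * (1 + A))) * (μ[ξ n|ℱ n]) ω := by simp only [c]; ring
              rw [h3]
              exact add_nonneg (sub_nonneg.2 hω.2) (mul_nonneg this.le hω.1)
            exact mul_nonneg (mul_nonneg (hWpos n ω).le (Real.exp_pos _).le) h2
          · filter_upwards [hPb n] with ω hω
            have := bernoulli_mgf_le (s := s) hω.1 hω.2 hk
            simp only [Pi.mul_apply, mul_assoc]
            exact mul_le_mul_of_nonneg_left this (hWpos n ω).le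
      _ ≤ Real.exp C ^ (n + 1) * μ.real Set.univ := by
          rw [integral_mul_const, pow_succ, mul_right_comm]
          exact mul_le_mul_of_nonneg_right ih (Real.exp_pos _).le

/-- Kato's inequality: the sum of the conditional probabilities exceeds the number of successes by
more than `(b + a (2 Λ / n - 1)) √n`, where `Λ` is that number, with probability less than `exp (-L)`.
The coefficient `a` is free, and `b` is the value that the Chernoff bound gives for it. In the
degenerate case `1 + 4 a / (3 √n) = 0`, where the exponent of the bound has the form `0 / 0`, the event
is null because each summand is bounded by `3 / 4`. -/
theorem kato_inequality (hμ : μ.real Set.univ ≤ 1) (h01 : ∀ k ω, ξ k ω = 0 ∨ ξ k ω = 1)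
    (hξ : ∀ k, StronglyMeasurable[ℱ (k + 1)] (ξ k)) {n : ℕ} (hn : 0 < n) {a b L : ℝ}
    (hL : 0 < L) (hb : 0 ≤ b)
    (hab : b ^ 2 = a ^ 2 + L / 2 * (1 + 4 * a / (3 * √n)) ^ 2) :
    μ.real {ω | (b + a * (2 * (∑ k ∈ Finset.range n, ξ k ω) / n - 1)) * √n <
        ∑ k ∈ Finset.range n, (μ[ξ k|ℱ k]) ω - ∑ k ∈ Finset.range n, ξ k ω} <
      Real.exp (-L) := by
  have hn' : (0 : ℝ) < n := Nat.cast_pos.2 hn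
  have hr : 0 < √(n : ℝ) := Real.sqrt_pos.2 hn'
  have hrr : √(n : ℝ) * √(n : ℝ) = n := Real.mul_self_sqrt hn'.le
  set A := 2 * a / √n with hA
  set E := {ω | (b + a * (2 * (∑ k ∈ Finset.range n, ξ k ω) / n - 1)) * √n <
        ∑ k ∈ Finset.range n, (μ[ξ k|ℱ k]) ω - ∑ k ∈ Finset.range n, ξ k ω} with hE
  have hkA : 1 + 4 * a / (3 * √n) = 1 + 2 * A / 3 := by rw [hA]; field_simp; ring
  rw [hkA] at hab
  have haA : a = A * √n / 2 := by rw [hA]; field_simp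
  have hmem : ∀ ω, ω ∈ E ↔ b * √n < ∑ k ∈ Finset.range n,
      ((μ[ξ k|ℱ k]) ω - (1 + A) * ξ k ω + A / 2) := by
    intro ω
    have e : ∑ k ∈ Finset.range n, ((μ[ξ k|ℱ k]) ω - (1 + A) * ξ k ω + A / 2) =
        ∑ k ∈ Finset.range n, (μ[ξ k|ℱ k]) ω - (1 + A) * ∑ k ∈ Finset.range n, ξ k ω +
          n * (A / 2) := by
      rw [Finset.sum_add_distrib, Finset.sum_sub_distrib, Finset.mul_sum, Finset.sum_const,
        Finset.card_range, nsmul_eq_mul]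
    have e2 : a * (2 * (∑ k ∈ Finset.range n, ξ k ω) / n - 1) * √n =
        A * ∑ k ∈ Finset.range n, ξ k ω - n * (A / 2) := by
      rw [haA]
      have : A * √n / 2 * (2 * (∑ k ∈ Finset.range n, ξ k ω) / n - 1) * √n =
        A / 2 * (2 * (∑ k ∈ Finset.range n, ξ k ω) / n - 1) * (√n * √n) := by ring
      rw [this, hrr]
      field_simp
    rw [hE, Set.mem_ofPred_eq, add_mul, e2, e]
    constructor <;> intro h <;> linarith
  have hξi : ∀ k, Integrable (ξ k) μ := fun k =>
    Integrable.of_bound ((hξ k).mono (ℱ.le _)).aestronglyMeasurable 1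
      (Filter.Eventually.of_forall fun ω => by rcases h01 k ω with h | h <;> simp [h])
  by_cases hk : 1 + 2 * A / 3 = 0
  · have hA' : A = -3 / 2 := by linarith
    have hb2 : b = 3 / 4 * √n := by
      rw [hk, haA, hA'] at hab
      have : b ^ 2 = (3 / 4 * √n) ^ 2 := by rw [hab]; ring
      exact (pow_left_inj₀ hb (by positivity) two_ne_zero).1 this
    have h0 : μ.real E = 0 := by
      rw [measureReal_eq_zero_iff]
      refine measure_mono_null (t := {ω | ¬ ∀ k, (μ[ξ k|ℱ k]) ω ∈ Set.Icc (0 : ℝ) 1}) ?_ ?_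
      · intro ω hω hP
        rw [hmem] at hω
        refine absurd hω (not_lt.2 ?_)
        calc _ ≤ ∑ k ∈ Finset.range n, (3 / 4 : ℝ) := by
              refine Finset.sum_le_sum fun k _ => ?_
              have := (hP k).2
              rcases h01 k ω with h | h <;> rw [h, hA'] <;> linarith
          _ = b * √n := by
              rw [hb2, mul_assoc, hrr, Finset.sum_const, Finset.card_range, nsmul_eq_mul]
              ring
      · exact ae_all_iff.2 fun k => condExp_mem_Icc (ℱ.le k) (hξi k) fun ω => by
          rcases h01 k ω with h | h <;> simp [h]
    rw [h0]
    exact Real.exp_pos _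
  -- the Chernoff parameter that optimizes the bound
  set B := 2 * b / √n with hB
  have hbB : b = B * √n / 2 := by rw [hB]; field_simp
  set s := 2 * B / (1 + 2 * A / 3) ^ 2 with hs
  have hk2 : 0 < (1 + 2 * A / 3) ^ 2 := by positivity
  have hs0 : 0 ≤ s := by positivity
  obtain ⟨hint, hle⟩ := integral_exp_sum_le (μ := μ) (s := s) h01 hξ hk n
  set Y : Ω → ℝ := fun ω => Real.exp (s * ∑ k ∈ Finset.range n,
    ((μ[ξ k|ℱ k]) ω - (1 + A) * ξ k ω + A / 2)) with hY
  have hn2 : (B ^ 2 - A ^ 2) * n = 2 * L * (1 + 2 * A / 3) ^ 2 := by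
    have e : ∀ x : ℝ, (x * √n / 2) ^ 2 = x ^ 2 * n / 4 := fun x => by
      rw [div_pow, mul_pow, Real.sq_sqrt hn'.le]
      norm_num
    rw [hbB, haA, e, e] at hab
    linarith
  have hspos : 0 < s := by
    have : 0 < B := by
      refine lt_of_le_of_ne (by positivity) fun h => ?_
      rw [← h] at hn2
      have h1 : 0 < 2 * L * (1 + 2 * A / 3) ^ 2 := by positivity
      have h2 : 0 ≤ A ^ 2 * n := by positivity
      linarith
    positivity
  rcases (measureReal_nonneg : 0 ≤ μ.real E).eq_or_lt with h0 | hE0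
  · rw [← h0]
    exact Real.exp_pos _
  have hEm : MeasurableSet E := by
    have hsum : Measurable fun ω => ∑ k ∈ Finset.range n, ξ k ω :=
      Finset.measurable_fun_sum _ fun k _ => ((hξ k).mono (ℱ.le _)).measurable
    have hsumP : Measurable fun ω => ∑ k ∈ Finset.range n, (μ[ξ k|ℱ k]) ω :=
      Finset.measurable_fun_sum _ fun k _ => (stronglyMeasurable_condExp.mono (ℱ.le k)).measurable
    exact measurableSet_lt (by fun_prop) (hsumP.sub hsum)
  have hlt : Real.exp (s * (b * √n)) * μ.real E < ∫ ω in E, Y ω ∂μ := by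
    have hpos : 0 < ∫ ω in E, (Y ω - Real.exp (s * (b * √n))) ∂μ := by
      have hp : ∀ ω ∈ E, 0 < Y ω - Real.exp (s * (b * √n)) := fun ω hω =>
        sub_pos.2 (Real.exp_lt_exp.2 (mul_lt_mul_of_pos_left ((hmem ω).1 hω) hspos))
      rw [setIntegral_pos_iff_support_of_nonneg_ae]
      · have : E ⊆ Function.support (fun ω => Y ω - Real.exp (s * (b * √n))) ∩ E :=
          fun ω hω => ⟨(hp ω hω).ne', hω⟩
        refine lt_of_lt_of_le ?_ (measure_mono this)
        exact (measureReal_ne_zero_iff (measure_ne_top _ _)).1 hE0.ne' |>.bot_lt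
      · filter_upwards [ae_restrict_mem hEm] with ω hω using (hp ω hω).le
      · exact (hint.sub (integrable_const _)).integrableOn
    rw [integral_sub hint.integrableOn (integrable_const _)] at hpos
    simp only [integral_const, measureReal_restrict_apply_univ, smul_eq_mul] at hpos
    linarith
  have hle2 : ∫ ω in E, Y ω ∂μ ≤ ∫ ω, Y ω ∂μ :=
    setIntegral_le_integral hint (Filter.Eventually.of_forall fun ω => (Real.exp_pos _).le)
  have hle3 := hle.trans (mul_le_of_le_one_right (by positivity) hμ)
  rw [← Real.exp_nat_mul] at hle3
  have hexp : (n : ℝ) * (s ^ 2 * (1 + 2 * A / 3) ^ 2 / 8 + A ^ 2 / (2 * (1 + 2 * A / 3) ^ 2)) =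
      s * (b * √n) + -L := by
    have e1 : b * √n = B * n / 2 := by linear_combination √(n : ℝ) * hbB + B / 2 * hrr
    rw [e1, hs]
    generalize 1 + 2 * A / 3 = k at *
    field_simp
    linarith
  rw [hexp, Real.exp_add] at hle3
  exact lt_of_mul_lt_mul_left (hlt.trans_le (hle2.trans hle3)) (Real.exp_pos _).le

end Kato

end Concentration

noncomputable section

namespace DecoyBB84

/-! ### Coordinates of vectors and operators -/

@[simp]
theorem ket_apply_self {ι : Type} (i : ι) : ket i i = 1 := by
  classical simp [ket]

theorem ket_apply_ne {ι : Type} {i j : ι} (h : j ≠ i) : ket i j = 0 := by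
  classical simp [ket, h]

theorem ket_apply {ι : Type} (i j : ι) [Decidable (j = i)] :
    ket i j = if j = i then 1 else 0 := by
  split_ifs with h
  · rw [h, ket_apply_self]
  · exact ket_apply_ne h

theorem inner_ket_left {ι : Type} (i : ι) (x : Hilb ι) : inner ℂ (ket i) x = x i := by
  classical
  unfold ket
  rw [lp.inner_single_left]
  simp

theorem hilb_ext {ι : Type} {x y : Hilb ι} (h : ∀ i, x i = y i) : x = y :=
  lp.ext (funext h)

theorem op_ext {ι κ : Type} {A B : Op ι κ} (h : ∀ i, A (ket i) = B (ket i)) : A = B := by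
  classical
  ext1 x
  have hx := lp.hasSum_single (p := 2) (by norm_num) x
  have key : ∀ i : ι, A (lp.single 2 i (x i)) = B (lp.single 2 i (x i)) := by
    intro i
    have : lp.single 2 i (x i) = x i • (ket i : Hilb ι) := by
      unfold ket
      rw [← lp.single_smul]
      simp
    rw [this, map_smul, map_smul, h]
  have h1 := hx.mapL A
  have h2 := hx.mapL B
  simp only [key] at h1
  exact h1.unique h2

@[simp]
theorem proj_apply {ι : Type} (x y : Hilb ι) : proj x y = inner ℂ x y • x := by
  simp [proj, ketbra]

theorem inner_proj_self {ι : Type} (x y : Hilb ι) :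
    inner ℂ y (proj x y) = ((‖inner ℂ x y‖ ^ 2 : ℝ) : ℂ) := by
  rw [proj_apply, inner_smul_right, ← inner_conj_symm y x, RCLike.mul_conj]
  simp

theorem enorm_sq_eq_tsum {ι : Type} (x : Hilb ι) : ‖x‖ₑ ^ 2 = ∑' i, ‖x i‖ₑ ^ 2 := by
  have h := norm_sq_hasSum x
  have e : ∀ {F : Type} [SeminormedAddCommGroup F] (z : F), ‖z‖ₑ ^ 2 = ENNReal.ofReal (‖z‖ ^ 2) := by
    intro F _ z
    rw [← ofReal_norm, ENNReal.ofReal_pow (norm_nonneg _)]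
  simp only [e]
  rw [← h.tsum_eq, ENNReal.ofReal_tsum_of_nonneg (fun _ => sq_nonneg _) h.summable]

/-- The vector with the coordinates `x (f k)`, for an injective map `f` of labels. -/
def comap {ι κ : Type} (f : κ → ι) (hf : f.Injective) (x : Hilb ι) : Hilb κ :=
  ⟨fun k => x (f k), (memlp_two_iff _).2 ((norm_sq_hasSum x).summable.comp_injective hf)⟩

@[simp]
theorem comap_apply {ι κ : Type} (f : κ → ι) (hf : f.Injective) (x : Hilb ι) (k : κ) :
    comap f hf x k = x (f k) := rfl

theorem relabel_apply {ι κ : Type} (e : ι ≃ κ) (x : Hilb ι) (k : κ) :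
    relabel e x k = x (e.symm k) := rfl

theorem symm_mk_injective {ι γ σ : Type} (e : σ ≃ ι × γ) (g : γ) :
    Function.Injective fun i => e.symm (i, g) :=
  fun _ _ h => (Prod.ext_iff.1 (e.symm.injective h)).1

theorem amplAlong_apply {ι κ γ σ τ : Type} (e : σ ≃ ι × γ) (f : τ ≃ κ × γ) (A : Op ι κ)
    (x : Hilb σ) (t : τ) :
    amplAlong e f A x t =
      A (comap (fun i => e.symm (i, (f t).2)) (symm_mk_injective e _) x) (f t).1 := rfl

theorem tensorPi_zero_apply {ι κ : Type} (A : Fin 0 → Op ι κ) (x : Hilb (Fin 0 → ι))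
    (s : Fin 0 → κ) : tensorPi A x s = x Fin.elim0 := by
  change x _ = x _
  congr 1

theorem cons_injective {ι : Type} {k : ℕ} (i : ι) :
    Function.Injective fun s : Fin k → ι => (Fin.cons i s : Fin (k + 1) → ι) :=
  fun _ _ h => Fin.cons_right_injective (α := fun _ => ι) i h

/-- The first factor of a tensor product acts on the vector `v` that results from the action of the
other factors. -/
theorem exists_tensorPi_succ_apply {ι κ : Type} {k : ℕ} (A : Fin (k + 1) → Op ι κ)
    (x : Hilb (Fin (k + 1) → ι)) (s : Fin (k + 1) → κ) :
    ∃ v : Hilb ι, (∀ i, v i = tensorPi (fun j => A j.succ)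
        (comap (fun s' => Fin.cons i s') (cons_injective i) x) (Fin.tail s)) ∧
      tensorPi A x s = A 0 v (s 0) :=
  ⟨slice (amplAlong (Equiv.prodComm _ _) (Equiv.prodComm _ _) (tensorPi fun j => A j.succ)
    (relabel (Fin.consEquiv fun _ : Fin (k + 1) => ι).symm x)) (Fin.tail s), fun _ => rfl, rfl⟩

/-! ### Product vectors -/

/-- The norm of a product vector, stated ahead of `tensorVec` since it shows that the product of the
coordinates is square-summable. -/
theorem tensorVec_tsum {ι : Type} : {k : ℕ} → (x : Fin k → Hilb ι) →
    ∑' s : Fin k → ι, ‖∏ i, x i (s i)‖ₑ ^ 2 = ∏ i, ‖x i‖ₑ ^ 2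
  | 0, x => by simp
  | k + 1, x => by
    have e : ∀ p : ι × (Fin k → ι),
        ‖∏ i, x i ((Fin.cons p.1 p.2 : Fin (k + 1) → ι) i)‖ₑ ^ 2 =
          ‖x 0 p.1‖ₑ ^ 2 * ‖∏ i : Fin k, x i.succ (p.2 i)‖ₑ ^ 2 := fun p => by
      rw [Fin.prod_univ_succ, enorm_mul, mul_pow]
      rfl
    refine ((Fin.consEquiv fun _ : Fin (k + 1) => ι).tsum_eq _).symm.trans ?_
    refine (tsum_congr e).trans ?_
    refine (ENNReal.tsum_prod (f := fun i (s : Fin k → ι) =>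
      ‖x 0 i‖ₑ ^ 2 * ‖∏ j : Fin k, x j.succ (s j)‖ₑ ^ 2)).trans ?_
    simp only [ENNReal.tsum_mul_left, ENNReal.tsum_mul_right]
    rw [tensorVec_tsum fun j => x j.succ, Fin.prod_univ_succ, enorm_sq_eq_tsum (x 0)]

theorem memlp_of_tsum_enorm_sq_ne_top {ι : Type} {f : ι → ℂ} (h : ∑' i, ‖f i‖ₑ ^ 2 ≠ ∞) :
    Memℓp f 2 := by
  rw [memlp_two_iff]
  have := ENNReal.summable_toReal h
  simpa using this

/-- The product vector `x 0 ⊗ x 1 ⊗ ⋯ ⊗ x (k-1)`. -/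
def tensorVec {ι : Type} {k : ℕ} (x : Fin k → Hilb ι) : Hilb (Fin k → ι) :=
  ⟨fun s => ∏ i, x i (s i), memlp_of_tsum_enorm_sq_ne_top (by
    rw [tensorVec_tsum]
    exact ENNReal.prod_ne_top fun i _ => ENNReal.pow_ne_top enorm_ne_top)⟩

theorem tensorVec_apply {ι : Type} {k : ℕ} (x : Fin k → Hilb ι) (s : Fin k → ι) :
    tensorVec x s = ∏ i, x i (s i) := rfl

theorem enorm_sq_tensorVec {ι : Type} {k : ℕ} (x : Fin k → Hilb ι) :
    ‖tensorVec x‖ₑ ^ 2 = ∏ i, ‖x i‖ₑ ^ 2 := by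
  rw [enorm_sq_eq_tsum, ← tensorVec_tsum]
  rfl

theorem ket_eq_tensorVec {ι : Type} {k : ℕ} (s : Fin k → ι) :
    ket s = tensorVec fun i => ket (s i) := by
  classical
  refine hilb_ext fun t => ?_
  rw [tensorVec_apply]
  simp only [ket_apply]
  have h : (∏ i, if t i = s i then (1 : ℂ) else 0) = if ∀ i, t i = s i then 1 else 0 := by
    simpa using Finset.prod_ite_zero (s := Finset.univ) (p := fun i => t i = s i) (f := fun _ => (1 : ℂ))
  rw [h]
  simp [funext_iff]

theorem tensorPi_tensorVec {ι κ : Type} : {k : ℕ} → (A : Fin k → Op ι κ) → (x : Fin k → Hilb ι) →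
    tensorPi A (tensorVec x) = tensorVec fun i => A i (x i)
  | 0, A, x => by
    refine hilb_ext fun s => ?_
    rw [tensorPi_zero_apply]
    simp [tensorVec_apply]
  | k + 1, A, x => by
    refine hilb_ext fun s => ?_
    obtain ⟨v, hv, h⟩ := exists_tensorPi_succ_apply A (tensorVec x) s
    rw [h]
    have hv' : v = (∏ i : Fin k, A i.succ (x i.succ) (s i.succ)) • x 0 := by
      refine hilb_ext fun i => ?_
      have e : comap (fun s' => Fin.cons i s') (cons_injective i) (tensorVec x) =
          x 0 i • tensorVec fun j => x j.succ := by
        refine hilb_ext fun s' => ?_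
        change ∏ j, x j ((Fin.cons i s' : Fin (k + 1) → ι) j) = x 0 i * ∏ j : Fin k, x j.succ (s' j)
        simp [Fin.prod_univ_succ]
      rw [hv, e, map_smul, tensorPi_tensorVec]
      exact mul_comm _ _
    rw [hv', map_smul, tensorVec_apply, Fin.prod_univ_succ]
    exact mul_comm _ _

theorem sum_apply' {ι X : Type} (T : Finset X) (u : X → Hilb ι) (t : ι) :
    (∑ x ∈ T, u x) t = ∑ x ∈ T, u x t := by
  rw [lp.coeFn_sum, Finset.sum_apply]

theorem inner_ket_right {ι : Type} (x : Hilb ι) (i : ι) : inner ℂ x (ket i) = star (x i) := by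
  rw [← inner_conj_symm, inner_ket_left]
  rfl

/-- The tensor product is additive in each factor. -/
theorem tensorPi_sum {ι κ X : Type} {k : ℕ} (T : Fin k → Finset X) (A : Fin k → X → Op ι κ) :
    tensorPi (fun i => ∑ x ∈ T i, A i x) =
      ∑ x ∈ Fintype.piFinset T, tensorPi fun i => A i (x i) := by
  refine op_ext fun s => hilb_ext fun t => ?_
  rw [ket_eq_tensorVec, tensorPi_tensorVec, tensorVec_apply]
  simp only [_root_.sum_apply, sum_apply']
  rw [Finset.prod_univ_sum]
  refine Finset.sum_congr rfl fun x _ => ?_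
  rw [tensorPi_tensorVec, tensorVec_apply]

theorem tensorPi_proj {ι : Type} {k : ℕ} (u : Fin k → Hilb ι) :
    tensorPi (fun i => proj (u i)) = proj (tensorVec u) := by
  refine op_ext fun s => hilb_ext fun t => ?_
  rw [ket_eq_tensorVec, tensorPi_tensorVec, ← ket_eq_tensorVec, tensorVec_apply]
  simp only [proj_apply, inner_ket_right]
  change ∏ i, (star (u i (s i)) * u i (t i)) = star (∏ i, u i (s i)) * ∏ i, u i (t i)
  rw [Finset.prod_mul_distrib, star_prod]

/-! ### Tensor products of controlled operators -/

theorem comp_mk_injective {ι γ : Type} {k : ℕ} (a : Fin k → γ) :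
    Function.Injective fun (s : Fin k → ι) => fun i => (a i, s i) :=
  fun _ _ h => funext fun i => (Prod.ext_iff.1 (congrFun h i)).2

/-- Each `K i` applies `B i` to the `ι`-part of its input while the `γ`-part is a label that is read
off from the output, and it is supported on outputs that satisfy `c`. Then so does the tensor
product. -/
theorem tensorPi_controlled {ι κ γ τ : Type} (a : τ → γ) (r : τ → κ) (c : τ → Prop) :
    {k : ℕ} → (K : Fin k → Op (γ × ι) τ) → (B : Fin k → Op ι κ) →
    (hc : ∀ i x t, c t → K i x t = B i (comap (Prod.mk (a t)) (Prod.mk_right_injective _) x) (r t)) →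
    (h0 : ∀ i x t, ¬c t → K i x t = 0) → (x : Hilb (Fin k → γ × ι)) → (t : Fin k → τ) →
    ((∀ i, c (t i)) → tensorPi K x t = tensorPi B
        (comap (fun s i => (a (t i), s i)) (comp_mk_injective _) x) (fun i => r (t i))) ∧
      ((¬∀ i, c (t i)) → tensorPi K x t = 0)
  | 0, K, B, _, _, x, t => by
    refine ⟨fun _ => ?_, fun h => absurd (fun i => i.elim0) h⟩
    rw [tensorPi_zero_apply, tensorPi_zero_apply, comap_apply]
    exact congrArg x (Subsingleton.elim _ _)
  | k + 1, K, B, hc, h0, x, t => by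
    obtain ⟨v, hv, h⟩ := exists_tensorPi_succ_apply K x t
    have ih := fun p => tensorPi_controlled a r c (fun i => K i.succ) (fun i => B i.succ)
      (fun i => hc i.succ) (fun i => h0 i.succ)
      (comap (fun s' => Fin.cons p s') (cons_injective p) x) (Fin.tail t)
    rw [h]
    constructor
    · intro hct
      obtain ⟨w, hw, h'⟩ := exists_tensorPi_succ_apply B
        (comap (fun s i => (a (t i), s i)) (comp_mk_injective _) x) (fun i => r (t i))
      rw [h', hc 0 v _ (hct 0)]
      refine congrArg (fun z : Hilb ι => B 0 z (r (t 0))) (hilb_ext fun i => ?_)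
      rw [comap_apply, hv, hw, (ih _).1 fun i => hct i.succ]
      refine congrArg (fun z : Hilb (Fin k → ι) => tensorPi (fun j => B j.succ) z fun j => r (t j.succ))
        (hilb_ext fun s => ?_)
      simp only [comap_apply]
      refine congrArg x (funext fun j => ?_)
      refine Fin.cases ?_ (fun j => ?_) j <;> simp [Fin.tail]
    · intro hct
      by_cases h1 : c (t 0)
      · have h2 : ¬∀ i, c (Fin.tail t i) := fun h2 => hct fun i => Fin.cases h1 h2 i
        have hv0 : v = 0 := hilb_ext fun i => by rw [hv, (ih _).2 h2]; rfl
        rw [hv0, map_zero]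
        rfl
      · exact h0 0 v _ h1

/-! ### Trace-preserving families of Kraus operators -/

theorem ofReal_norm_sq {F : Type*} [SeminormedAddCommGroup F] (z : F) :
    ENNReal.ofReal (‖z‖ ^ 2) = ‖z‖ₑ ^ 2 := by
  rw [← ofReal_norm, ENNReal.ofReal_pow (norm_nonneg _)]

/-- Trace preservation in terms of sums in `[0, ∞]`. -/
def IsTPFamily {ι κ L : Type} (K : L → Op ι κ) : Prop :=
  ∀ x, ∑' l, ‖K l x‖ₑ ^ 2 = ‖x‖ₑ ^ 2

theorem KrausMap.IsTP.family {ι κ : Type} {Φ : KrausMap ι κ} (h : Φ.IsTP) : IsTPFamily Φ.op := by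
  intro x
  simp only [← ofReal_norm_sq]
  rw [← (h x).tsum_eq, ENNReal.ofReal_tsum_of_nonneg (fun _ => sq_nonneg _) (h x).summable]

theorem IsTPFamily.comp {ι κ σ L L' : Type} {A : L → Op κ σ} {B : L' → Op ι κ}
    (hA : IsTPFamily A) (hB : IsTPFamily B) :
    IsTPFamily fun l : L × L' => A l.1 ∘L B l.2 := by
  intro x
  rw [ENNReal.tsum_prod (f := fun l l' => ‖(A l ∘L B l') x‖ₑ ^ 2), ENNReal.tsum_comm]
  simp only [ContinuousLinearMap.comp_apply]
  rw [← hB x]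
  exact tsum_congr fun l => hA _

theorem enorm_sq_relabel {ι κ : Type} (e : ι ≃ κ) (x : Hilb ι) : ‖relabel e x‖ₑ ^ 2 = ‖x‖ₑ ^ 2 := by
  rw [enorm_sq_eq_tsum, enorm_sq_eq_tsum]
  exact e.symm.tsum_eq fun i => ‖x i‖ₑ ^ 2

theorem enorm_sq_eq_tsum_slice {ι γ : Type} (x : Hilb (ι × γ)) :
    ‖x‖ₑ ^ 2 = ∑' g, ‖slice x g‖ₑ ^ 2 := by
  simp only [enorm_sq_eq_tsum]
  rw [ENNReal.tsum_prod (f := fun i g => ‖x (i, g)‖ₑ ^ 2), ENNReal.tsum_comm]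
  rfl

theorem IsTPFamily.ampl {ι κ L : Type} {A : L → Op ι κ} (hA : IsTPFamily A) (γ : Type) :
    IsTPFamily fun l => ampl γ (A l) := by
  intro x
  have h : ∀ l g, slice (DecoyBB84.ampl γ (A l) x) g = A l (slice x g) := fun _ _ => rfl
  simp only [enorm_sq_eq_tsum_slice, h]
  rw [ENNReal.tsum_comm]
  exact tsum_congr fun g => hA _

theorem IsTPFamily.amplAlong {ι κ γ σ τ L : Type} (e : σ ≃ ι × γ) (f : τ ≃ κ × γ)
    {A : L → Op ι κ} (hA : IsTPFamily A) : IsTPFamily fun l => amplAlong e f (A l) := by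
  intro x
  have h := (hA.ampl γ) (relabel e x)
  rw [enorm_sq_relabel] at h
  rw [← h]
  exact tsum_congr fun l => enorm_sq_relabel _ _

theorem IsTPFamily.tensorPi {ι κ L : Type} {A : L → Op ι κ} (hA : IsTPFamily A) :
    ∀ k, IsTPFamily fun l : Fin k → L => tensorPi fun i => A (l i)
  | 0 => fun x => by
    rw [tsum_eq_single (default : Fin 0 → L) fun l hl => absurd (Subsingleton.elim _ _) hl]
    exact enorm_sq_relabel _ _
  | k + 1 => fun x => by
    have h := ((hA.ampl (Fin k → κ)).comp ((hA.tensorPi k).amplAlong (Equiv.prodComm _ _)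
      (Equiv.prodComm _ _))) (relabel (Fin.consEquiv fun _ : Fin (k + 1) => ι).symm x)
    rw [enorm_sq_relabel] at h
    rw [← h, ← (Fin.consEquiv fun _ : Fin (k + 1) => L).tsum_eq]
    exact tsum_congr fun l => enorm_sq_relabel _ _

/-! ### Density operators as sums of rank-one operators -/

/-- The density operator `ρ` is the sum of the rank-one operators `|ψₗ⟩⟨ψₗ|`. -/
structure Unravels {σ L : Type} (ρ : Op σ σ) (ψ : L → Hilb σ) : Prop where
  ne_top : ∑' l, ‖ψ l‖ₑ ^ 2 ≠ ∞
  hasSum : HasSum (fun l => proj (ψ l)) ρ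

theorem summable_of_tsum_enorm_sq {F L : Type} [SeminormedAddCommGroup F] {ψ : L → F}
    (h : ∑' l, ‖ψ l‖ₑ ^ 2 ≠ ∞) : Summable fun l => ‖ψ l‖ ^ 2 := by
  simpa using ENNReal.summable_toReal h

theorem norm_proj {σ : Type} (x : Hilb σ) : ‖proj x‖ = ‖x‖ ^ 2 := by
  rw [proj, ketbra, InnerProductSpace.norm_rankOne, sq]

theorem comp_proj_comp_adjoint {σ τ : Type} (A : Op σ τ) (x : Hilb σ) :
    A ∘L proj x ∘L A.adjoint = proj (A x) := by
  ext1 y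
  simp [ContinuousLinearMap.adjoint_inner_right]

theorem unravels_proj {σ : Type} (x : Hilb σ) : Unravels (proj x) fun _ : Unit => x :=
  ⟨by simp, hasSum_unique _⟩

/-- A trace-preserving map acts on the vectors of an unravelling by its Kraus operators. -/
theorem Unravels.map {σ τ L : Type} {ρ : Op σ σ} {ψ : L → Hilb σ} (h : Unravels ρ ψ)
    {Φ : KrausMap σ τ} (hΦ : IsTPFamily Φ.op) :
    Unravels (Φ.map ρ) fun l : Φ.index × L => Φ.op l.1 (ψ l.2) := by
  have ht : ∑' l : Φ.index × L, ‖Φ.op l.1 (ψ l.2)‖ₑ ^ 2 ≠ ∞ := by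
    rw [ENNReal.tsum_prod (f := fun k l => ‖Φ.op k (ψ l)‖ₑ ^ 2), ENNReal.tsum_comm]
    simpa only [hΦ _] using h.ne_top
  refine ⟨ht, ?_⟩
  have hs : Summable fun l : Φ.index × L => proj (Φ.op l.1 (ψ l.2)) := by
    refine Summable.of_norm ?_
    simpa only [norm_proj] using summable_of_tsum_enorm_sq ht
  have hk : ∀ k, HasSum (fun l => proj (Φ.op k (ψ l))) (Φ.op k ∘L ρ ∘L (Φ.op k).adjoint) := by
    intro k
    have h1 := h.hasSum.mapL
      ((ContinuousLinearMap.compL ℂ (Hilb τ) (Hilb σ) (Hilb σ)).flip (Φ.op k).adjoint)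
    have h2 := h1.mapL (ContinuousLinearMap.compL ℂ (Hilb τ) (Hilb σ) (Hilb τ) (Φ.op k))
    simpa [comp_proj_comp_adjoint] using h2
  have := hs.hasSum.prod_fiberwise hk
  rw [KrausMap.map, this.tsum_eq]
  exact hs.hasSum

/-- The weight `⟨s|ρ|s⟩` of the label `s`. -/
def diag {σ : Type} (ρ : Op σ σ) (s : σ) : ℝ≥0∞ := ENNReal.ofReal (inner ℂ (ket s) (ρ (ket s))).re

theorem Unravels.hasSum_inner {σ L : Type} {ρ : Op σ σ} {ψ : L → Hilb σ} (h : Unravels ρ ψ)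
    (x : Hilb σ) : HasSum (fun l => ‖inner ℂ (ψ l) x‖ ^ 2) (inner ℂ x (ρ x)).re := by
  have h1 := (h.hasSum.mapL (ContinuousLinearMap.apply ℂ (Hilb σ) x)).mapL (innerSL ℂ x)
  have h2 : HasSum (fun l => (inner ℂ x (proj (ψ l) x)).re) (inner ℂ x (ρ x)).re :=
    Complex.hasSum_re h1
  simpa only [inner_proj_self, Complex.ofReal_re] using h2

theorem Unravels.diag_eq {σ L : Type} {ρ : Op σ σ} {ψ : L → Hilb σ} (h : Unravels ρ ψ) (s : σ) :
    diag ρ s = ∑' l, ‖ψ l s‖ₑ ^ 2 := by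
  have h1 := h.hasSum_inner (ket s)
  simp only [← ofReal_norm_sq]
  rw [diag, ← h1.tsum_eq, ENNReal.ofReal_tsum_of_nonneg (fun _ => sq_nonneg _) h1.summable]
  refine tsum_congr fun l => ?_
  rw [inner_ket_right, norm_star]

/-- The trace of `T ρ` may be computed from the vectors of an unravelling; the double sum over these
and the basis converges absolutely. -/
theorem Unravels.hasSum_tr {σ L : Type} {ρ : Op σ σ} {ψ : L → Hilb σ} (h : Unravels ρ ψ)
    (T : Op σ σ) : HasSum (fun l => inner ℂ (ψ l) (T (ψ l))) (tr (T ∘L ρ)) := by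
  set F : L × σ → ℂ := fun p => inner ℂ (ψ p.1 p.2) (T (ψ p.1) p.2) with hF
  have hT : ∑' l, ‖T (ψ l)‖ₑ ^ 2 ≠ ∞ := by
    refine ne_top_of_le_ne_top (ENNReal.mul_ne_top (ENNReal.pow_ne_top (n := 2) (enorm_ne_top (x := T)))
      h.ne_top) ?_
    rw [← ENNReal.tsum_mul_left]
    refine ENNReal.tsum_le_tsum fun l => ?_
    rw [← mul_pow]
    gcongr
    exact T.le_opENorm _
  have hs : ∀ φ : L → Hilb σ, ∑' l, ‖φ l‖ₑ ^ 2 ≠ ∞ →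
      Summable fun p : L × σ => ‖φ p.1 p.2‖ ^ 2 := by
    intro φ hφ
    refine summable_of_tsum_enorm_sq ?_
    rw [ENNReal.tsum_prod (f := fun l i => ‖φ l i‖ₑ ^ 2)]
    simpa only [← enorm_sq_eq_tsum] using hφ
  have hFs : Summable F := by
    refine Summable.of_norm_bounded ((hs _ h.ne_top).add (hs _ hT)) fun p => ?_
    have h1 := norm_inner_le_norm (𝕜 := ℂ) (ψ p.1 p.2) (T (ψ p.1) p.2)
    have h2 := two_mul_le_add_sq ‖ψ p.1 p.2‖ ‖T (ψ p.1) p.2‖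
    have h3 : 0 ≤ ‖ψ p.1 p.2‖ * ‖T (ψ p.1) p.2‖ := by positivity
    change ‖F p‖ ≤ ‖ψ p.1 p.2‖ ^ 2 + ‖T (ψ p.1) p.2‖ ^ 2
    linarith
  have h1 := hFs.hasSum.prod_fiberwise fun l => lp.hasSum_inner (ψ l) (T (ψ l))
  have h2 : ∀ i, HasSum (fun l => F (l, i)) (inner ℂ (ket i) ((T ∘L ρ) (ket i))) := by
    intro i
    have h3 : HasSum (fun l => inner ℂ (ket i) (T (proj (ψ l) (ket i))))
        (inner ℂ (ket i) ((T ∘L ρ) (ket i))) :=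
      ((h.hasSum.mapL (ContinuousLinearMap.apply ℂ (Hilb σ) (ket i))).mapL T).mapL
        (innerSL ℂ (ket i))
    convert h3 using 2 with l
    rw [proj_apply, map_smul, inner_smul_right, inner_ket_left, ← inner_conj_symm (ψ l),
      inner_ket_left]
    exact mul_comm _ _
  have h4 := ((Equiv.prodComm σ L).hasSum_iff.2 hFs.hasSum).prod_fiberwise h2
  rw [tr, h4.tsum_eq]
  exact h1

open Intensity BasisLabel

/-! ### One round of the protocol -/

theorem ketbra_apply {ι κ : Type} (x : Hilb κ) (y z : Hilb ι) :
    ketbra x y z = inner ℂ y z • x := rfl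

theorem norm_sq_eq_sum {ι : Type} [Fintype ι] (x : Hilb ι) : ‖x‖ ^ 2 = ∑ i, ‖x i‖ ^ 2 :=
  (norm_sq_hasSum x).unique (hasSum_fintype _)

theorem inner_xket_left {ι : Type} (f : Bool → ι) (b : Bool) (x : Hilb ι) :
    inner ℂ (xket f b) x = ((√2 : ℝ) : ℂ)⁻¹ * (x (f false) + sgn b * x (f true)) := by
  have h : star (sgn b) = sgn b := by cases b <;> simp [sgn]
  unfold xket
  rw [inner_smul_left, inner_add_left, inner_smul_left, inner_ket_left, inner_ket_left]
  congr 1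
  · simp
  · congr 2

theorem norm_eq_one_of_inner_self {ι : Type} {x : Hilb ι} (h : inner ℂ x x = 1) : ‖x‖ = 1 := by
  have h2 := inner_self_eq_norm_sq (𝕜 := ℂ) x
  rw [h] at h2
  refine (pow_eq_one_iff_of_nonneg (norm_nonneg x) two_ne_zero).1 ?_
  simpa using h2.symm

theorem norm_ket {ι : Type} (i : ι) : ‖(ket i : Hilb ι)‖ = 1 := by
  have h : inner ℂ (ket i) (ket i : Hilb ι) = 1 := by rw [inner_ket_left, ket_apply_self]
  exact norm_eq_one_of_inner_self h

theorem inv_sqrt_two_sq : ((√2 : ℝ) : ℂ)⁻¹ * ((√2 : ℝ) : ℂ)⁻¹ = 1 / 2 := by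
  rw [← mul_inv, ← Complex.ofReal_mul, Real.mul_self_sqrt (by norm_num)]
  norm_num

theorem norm_xket {ι : Type} {f : Bool → ι} (hf : f.Injective) (b : Bool) : ‖xket f b‖ = 1 := by
  have h : inner ℂ (xket f b) (xket f b) = 1 := by
    have h1 : f true ≠ f false := fun h => by simpa using hf h
    have e : ∀ i, xket f b i = ((√2 : ℝ) : ℂ)⁻¹ * (ket (f false) i + sgn b * ket (f true) i) :=
      fun _ => rfl
    have hs : sgn b * sgn b = 1 := by cases b <;> simp [sgn]
    rw [inner_xket_left, e, e, ket_apply_ne h1, ket_apply_ne h1.symm, ket_apply_self,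
      ket_apply_self]
    linear_combination (1 + sgn b * sgn b) * inv_sqrt_two_sq + 1 / 2 * hs
  exact norm_eq_one_of_inner_self h

/-- The two `X`-basis amplitudes carry the weight of the two `Z`-basis amplitudes. -/
theorem norm_sq_inner_xket_add {ι : Type} (f : Bool → ι) (x : Hilb ι) :
    ‖inner ℂ (xket f true) x‖ ^ 2 + ‖inner ℂ (xket f false) x‖ ^ 2 =
      ‖x (f true)‖ ^ 2 + ‖x (f false)‖ ^ 2 := by
  have h2 : ‖((√2 : ℝ) : ℂ)⁻¹‖ ^ 2 = 1 / 2 := by simp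
  have h := parallelogram_law_with_norm ℝ (x (f false)) (x (f true))
  simp only [inner_xket_left, norm_mul, mul_pow, h2, sgn]
  have e : x (f false) + -1 * x (f true) = x (f false) - x (f true) := by ring
  simp only [if_true, Bool.false_eq_true, if_false, e, one_mul]
  linarith

theorem bobVirtual_isTP {P : Params} (hP : P.Valid) : (bobVirtual P).IsTP := by
  intro x
  have hf : Function.Injective fun c : Bool => ((X, some c) : BReg) := fun a b h => by
    simpa using h
  have hsum : P.pBasis X = 1 - P.pBasis Z := by
    have h := hP.pBasis_sum
    have e : ∑ α, P.pBasis α = P.pBasis Z + P.pBasis X := by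
      change ∑ α ∈ ({Z, X} : Finset BasisLabel), P.pBasis α = _
      simp
    linarith
  have hsq : ∀ α, ‖((√(P.pBasis α) : ℝ) : ℂ)‖ ^ 2 = P.pBasis α := fun α => by
    rw [Complex.norm_real, Real.norm_eq_abs, sq_abs, Real.sq_sqrt (hP.pBasis_nonneg α)]
  have hx : ‖x‖ ^ 2 = ‖x none‖ ^ 2 + (‖x (some true)‖ ^ 2 + ‖x (some false)‖ ^ 2) := by
    rw [norm_sq_eq_sum]
    simp
  have hZ : ‖∑ b : Bool, ketbra (ket ((Z, some b) : BReg)) (ket (some b)) x‖ ^ 2 =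
      ‖x (some true)‖ ^ 2 + ‖x (some false)‖ ^ 2 := by
    have ho : inner ℂ (x (some true) • ket ((Z, some true) : BReg))
        (x (some false) • ket ((Z, some false) : BReg)) = 0 := by
      rw [inner_smul_left, inner_smul_right, inner_ket_left, ket_apply_ne (by simp)]
      simp
    simp only [ketbra_apply, inner_ket_left, Fintype.sum_bool]
    rw [sq, norm_add_sq_eq_norm_sq_add_norm_sq_of_inner_eq_zero _ _ ho]
    simp only [norm_smul, norm_ket, mul_one]
    ring
  have key : ∑ l : BasisLabel ⊕ Bool ⊕ Unit, ‖(bobVirtual P).op l x‖ ^ 2 = ‖x‖ ^ 2 := by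
    have e1 : ∀ β, ‖(bobVirtual P).op (.inl β) x‖ ^ 2 = P.pBasis β * ‖x none‖ ^ 2 := by
      intro β
      change ‖((√(P.pBasis β) : ℝ) : ℂ) • (inner ℂ (ket none) x • ket (β, none))‖ ^ 2 = _
      rw [norm_smul, norm_smul, norm_ket, mul_one, mul_pow, hsq, inner_ket_left]
    have e2 : ∀ b, ‖(bobVirtual P).op (.inr (.inl b)) x‖ ^ 2 =
        P.pBasis X * ‖inner ℂ (xket some b) x‖ ^ 2 := by
      intro b
      change ‖((√(P.pBasis X) : ℝ) : ℂ) • (inner ℂ (xket some b) x •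
        xket (fun c => ((X, some c) : BReg)) b)‖ ^ 2 = _
      rw [norm_smul, norm_smul, norm_xket hf, mul_one, mul_pow, hsq]
    have e3 : ‖(bobVirtual P).op (.inr (.inr ())) x‖ ^ 2 =
        P.pBasis Z * (‖x (some true)‖ ^ 2 + ‖x (some false)‖ ^ 2) := by
      change ‖((√(P.pBasis Z) : ℝ) : ℂ) •
        ((∑ b : Bool, ketbra (ket ((Z, some b) : BReg)) (ket (some b))) x)‖ ^ 2 = _
      rw [norm_smul, mul_pow, hsq, _root_.sum_apply, hZ]
    rw [Fintype.sum_sum_type, Fintype.sum_sum_type]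
    simp only [e1, e2, Finset.univ_unique, Finset.sum_singleton, Fintype.sum_bool]
    rw [← Finset.sum_mul, hP.pBasis_sum, ← mul_add, norm_sq_inner_xket_add, hx]
    erw [e3]
    rw [hsum]
    ring
  have h := hasSum_fintype fun l : BasisLabel ⊕ Bool ⊕ Unit => ‖(bobVirtual P).op l x‖ ^ 2
  rw [key] at h
  exact h

/-- The vector that Bob's announcement recognizes, for each outcome: in the `X` basis, an
`X`-eigenstate. -/
def announceIn : BReg → Hilb BReg
  | (X, some b) => xket (fun c => (X, some c)) b
  | (β, o) => ket (β, o)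

/-- The vector that Bob's announcement produces, for each outcome. -/
def announceOut : BReg → Hilb (BReg × BMsg × BMsg)
  | (X, some b) => xket (fun c => ((X, some c), (X, true, some b), (X, true, some b))) b
  | (Z, some b) => ket ((Z, some b), (Z, true, none), (Z, true, none))
  | (β, none) => ket ((β, none), (β, false, none), (β, false, none))

theorem sum_BReg {M : Type*} [AddCommMonoid M] (f : BReg → M) :
    ∑ k, f k = (∑ β, f (β, none)) + (∑ b : Bool, f (Z, some b)) + ∑ b : Bool, f (X, some b) := by
  have e : ∀ g : BasisLabel → M, ∑ α, g α = g Z + g X := fun g => by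
    change ∑ α ∈ ({Z, X} : Finset BasisLabel), g α = _
    simp
  rw [Fintype.sum_prod_type]
  simp only [Fintype.sum_option, e]
  abel

theorem bobAnnounce_eq : bobAnnounce = ∑ k, ketbra (announceOut k) (announceIn k) := by
  have e : ∀ (g : BasisLabel → Op BReg (BReg × BMsg × BMsg)), ∑ α, g α = g Z + g X := fun g => by
    change ∑ α ∈ ({Z, X} : Finset BasisLabel), g α = _
    simp
  rw [sum_BReg, bobAnnounce, e, e]
  rfl

/-- The message that goes with an outcome. -/
def announceMsg : BReg → BMsg
  | (X, some b) => (X, true, some b)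
  | (Z, some _) => (Z, true, none)
  | (β, none) => (β, false, none)

theorem xket_apply_ne {ι : Type} {f : Bool → ι} {b : Bool} {i : ι} (h : ∀ c, i ≠ f c) :
    xket f b i = 0 := by
  change ((√2 : ℝ) : ℂ)⁻¹ * (ket (f false) i + sgn b * ket (f true) i) = 0
  rw [ket_apply_ne (h _), ket_apply_ne (h _)]
  simp

theorem announceOut_support {k : BReg} {t : BReg × BMsg × BMsg}
    (h : t.2.1 ≠ announceMsg k) : announceOut k t = 0 := by
  obtain ⟨_ | _, _ | b⟩ := k
  · exact ket_apply_ne fun e => h (congrArg (fun s => s.2.1) e)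
  · exact ket_apply_ne fun e => h (congrArg (fun s => s.2.1) e)
  · exact ket_apply_ne fun e => h (congrArg (fun s => s.2.1) e)
  · exact xket_apply_ne (f := fun c => ((X, some c), (X, true, some b), (X, true, some b)))
      fun c e => h (congrArg (fun s => s.2.1) e)

theorem announceOut_orthonormal : Orthonormal ℂ announceOut := by
  refine ⟨?_, ?_⟩
  · rintro ⟨_ | _, _ | b⟩
    · exact norm_ket _
    · exact norm_ket _
    · exact norm_ket _
    · change ‖xket (fun c => ((X, some c), (X, true, some b), (X, true, some b))) b‖ = 1
      exact norm_xket (fun a b h => congrArg (fun s => s.1.2.getD false) h) b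
  · intro k k' h
    by_cases hm : announceMsg k = announceMsg k'
    · -- only the two outcomes of the `Z` basis go with the same message
      obtain ⟨b, c, rfl, rfl⟩ : ∃ b c, k = (Z, some b) ∧ k' = (Z, some c) := by
        obtain ⟨_ | _, _ | b⟩ := k <;> obtain ⟨_ | _, _ | c⟩ := k' <;>
          simp_all [announceMsg]
      change inner ℂ (ket _) (ket _) = 0
      rw [inner_ket_left]
      exact ket_apply_ne fun e => h (congrArg Prod.fst e)
    · rw [lp.inner_eq_tsum]
      refine (tsum_congr fun t => ?_).trans tsum_zero
      by_cases ht : t.2.1 = announceMsg k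
      · rw [announceOut_support (k := k') fun h' => hm (ht.symm.trans h'), inner_zero_right]
      · rw [announceOut_support (k := k) ht, inner_zero_left]

theorem bobAnnounce_isometry (x : Hilb BReg) : ‖bobAnnounce x‖ₑ ^ 2 = ‖x‖ₑ ^ 2 := by
  have h : ‖bobAnnounce x‖ ^ 2 = ‖x‖ ^ 2 := by
    have h1 : bobAnnounce x = ∑ k, inner ℂ (announceIn k) x • announceOut k := by
      rw [bobAnnounce_eq, _root_.sum_apply]
      rfl
    have h2 := announceOut_orthonormal.inner_sum (fun k => inner ℂ (announceIn k) x)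
      (fun k => inner ℂ (announceIn k) x) Finset.univ
    have h3 : ‖bobAnnounce x‖ ^ 2 = ∑ k, ‖inner ℂ (announceIn k) x‖ ^ 2 := by
      rw [← inner_self_eq_norm_sq (𝕜 := ℂ), h1, h2, map_sum]
      refine Finset.sum_congr rfl fun k _ => ?_
      rw [RCLike.conj_mul, ← RCLike.ofReal_pow, RCLike.ofReal_re]
    rw [h3, norm_sq_eq_sum, sum_BReg, sum_BReg]
    congr 1
    · congr 1
      · refine Finset.sum_congr rfl fun β _ => ?_
        cases β <;> simp only [announceIn, inner_ket_left]
      · simp only [announceIn, inner_ket_left]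
    · rw [Fintype.sum_bool, Fintype.sum_bool]
      simp only [announceIn]
      exact norm_sq_inner_xket_add (fun c => ((X, some c) : BReg)) x
  rw [← ofReal_norm_sq, h, ofReal_norm_sq]

/-- The Kraus operators of Bob's part of a round: squashing, measurement and announcement. -/
def bobOp (P : Params) {β : Type} (squash : KrausMap β (Option Bool))
    (l : (roundMap P squash).index) : Op β (BReg × BMsg × BMsg) :=
  bobAnnounce ∘L (bobVirtual P).op l.2.2.1 ∘L squash.op l.2.2.2

theorem bobOp_isTP {P : Params} (hP : P.Valid) {β : Type} {squash : KrausMap β (Option Bool)}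
    (hs : squash.IsTP) : IsTPFamily (bobOp P squash) := by
  intro x
  have h1 := (bobVirtual_isTP hP).family.comp hs.family
  have h2 := h1 x
  refine Eq.trans ?_ h2
  have h3 : ∀ l, ‖bobOp P squash l x‖ₑ ^ 2 =
      ‖((bobVirtual P).op l.2.2.1 ∘L squash.op l.2.2.2) x‖ₑ ^ 2 := fun l =>
    bobAnnounce_isometry _
  rw [tsum_congr h3]
  refine Eq.trans ((Equiv.punitProd _).tsum_eq fun l : Unit × (bobVirtual P).index × squash.index =>
    ‖((bobVirtual P).op l.2.1 ∘L squash.op l.2.2) x‖ₑ ^ 2) ?_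
  exact (Equiv.punitProd _).tsum_eq fun l : (bobVirtual P).index × squash.index =>
    ‖((bobVirtual P).op l.1 ∘L squash.op l.2) x‖ₑ ^ 2

theorem aliceAnnounce_apply (y : Hilb (AReg × BMsg)) (a : AReg) (m : BMsg) (c c' : AMsg)
    [Decidable (c = aliceMsg a m ∧ c' = aliceMsg a m)] :
    aliceAnnounce y (a, m, c, c') =
      if c = aliceMsg a m ∧ c' = aliceMsg a m then y (a, m) else 0 := by
  classical
  rw [aliceAnnounce, _root_.sum_apply, sum_apply']
  have h : ∀ s : AReg × BMsg,
      ketbra (ket (s.1, s.2, aliceMsg s.1 s.2, aliceMsg s.1 s.2)) (ket s) y (a, m, c, c') =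
        if (a, m) = s then (if c = aliceMsg a m ∧ c' = aliceMsg a m then y (a, m) else 0)
          else 0 := by
    intro s
    rw [ketbra_apply, inner_ket_left]
    change y s * ket (s.1, s.2, aliceMsg s.1 s.2, aliceMsg s.1 s.2) (a, m, c, c') = _
    rw [ket_apply]
    by_cases hs : (a, m) = s
    · subst hs
      simp
    · rw [if_neg hs, if_neg, mul_zero]
      intro h
      simp only [Prod.mk.injEq] at h
      exact hs (Prod.ext h.1 h.2.1)
  rw [Finset.sum_congr rfl fun s _ => h s]
  simp

/-- The messages of Alice in the labels after a round are the ones that she announces. -/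
def Consistent (t : AReg × Kept × Pub) : Prop :=
  t.2.1.2.2 = aliceMsg t.1 t.2.1.2.1 ∧ t.2.2.2 = aliceMsg t.1 t.2.1.2.1

/-- Bob's part of the labels after a round. -/
def bobPart (t : AReg × Kept × Pub) : BReg × BMsg × BMsg := (t.2.1.1, t.2.1.2.1, t.2.2.1)

/-- A round acts on Bob's systems for each fixed label of Alice's register. -/
theorem roundMap_op_apply (P : Params) {β : Type} (squash : KrausMap β (Option Bool))
    (l : (roundMap P squash).index) (x : Hilb (AReg × β)) (t : AReg × Kept × Pub) :
    (Consistent t → (roundMap P squash).op l x t =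
      bobOp P squash l (comap (Prod.mk t.1) (Prod.mk_right_injective _) x) (bobPart t)) ∧
    (¬Consistent t → (roundMap P squash).op l x t = 0) := by
  classical
  obtain ⟨a, ⟨b, m, c⟩, m', c'⟩ := t
  set y : Hilb (AReg × BReg × BMsg × BMsg) :=
    amplAlong (Equiv.prodComm _ _) (Equiv.prodComm _ _) bobAnnounce
      (amplAlong (Equiv.prodComm _ _) (Equiv.prodComm _ _)
        ((bobVirtual P).op l.2.2.1 ∘L squash.op l.2.2.2) x) with hy
  set z : Hilb (AReg × BMsg) := comap (fun p : AReg × BMsg => (p.1, b, p.2, m'))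
    (fun p q h => Prod.ext (congrArg (fun s => s.1) h) (congrArg (fun s => s.2.2.1) h)) y with hz
  have h0 : (roundMap P squash).op l = amplAlong (γ := BReg × BMsg)
      ⟨fun s => ((s.1, s.2.2.1), s.2.1, s.2.2.2), fun s => (s.1.1, s.2.1, s.1.2, s.2.2),
        fun _ => rfl, fun _ => rfl⟩
      ⟨fun s => ((s.1, s.2.1.2.1, s.2.1.2.2, s.2.2.2), s.2.1.1, s.2.2.1),
        fun s => (s.1.1, (s.2.1, s.1.2.1, s.1.2.2.1), (s.2.2, s.1.2.2.2)),
        fun _ => rfl, fun _ => rfl⟩ aliceAnnounce ∘L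
      (amplAlong (Equiv.prodComm _ _) (Equiv.prodComm _ _) bobAnnounce ∘L
        amplAlong (Equiv.prodComm _ _) (Equiv.prodComm _ _)
          ((bobVirtual P).op l.2.2.1 ∘L squash.op l.2.2.2)) := rfl
  have h1 : (roundMap P squash).op l x (a, (b, m, c), m', c') =
      aliceAnnounce z (a, m, c, c') := by
    rw [h0, ContinuousLinearMap.comp_apply, ContinuousLinearMap.comp_apply, amplAlong_apply]
    exact congrArg (fun w : Hilb (AReg × BMsg) => aliceAnnounce w (a, m, c, c'))
      (hilb_ext fun p => rfl)
  have h2 : z (a, m) = bobOp P squash l (comap (Prod.mk a) (Prod.mk_right_injective _) x)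
    (b, m, m') := rfl
  rw [h1, aliceAnnounce_apply, h2]
  exact ⟨fun hc => if_pos hc, fun hc => if_neg hc⟩

/-- The Kraus operators of a block, applied to Bob's systems. -/
def bobBlock (P : Params) {β : Type} (squash : KrausMap β (Option Bool)) (M : ℕ)
    (l : Fin M → (roundMap P squash).index) : Op (Fin M → β) (Fin M → BReg × BMsg × BMsg) :=
  tensorPi fun i => bobOp P squash (l i)

theorem bobBlock_isTP {P : Params} (hP : P.Valid) {β : Type} {squash : KrausMap β (Option Bool)}
    (hs : squash.IsTP) (M : ℕ) : IsTPFamily (bobBlock P squash M) :=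
  (bobOp_isTP hP hs).tensorPi M

theorem pow_roundMap_op_apply (P : Params) {β : Type} (squash : KrausMap β (Option Bool)) {M : ℕ}
    (l : ((roundMap P squash).pow M).index) (x : Hilb (Fin M → AReg × β))
    (t : Fin M → AReg × Kept × Pub) :
    ((∀ i, Consistent (t i)) → ((roundMap P squash).pow M).op l x t = bobBlock P squash M l
      (comap (fun s i => ((t i).1, s i)) (comp_mk_injective _) x) fun i => bobPart (t i)) ∧
    ((¬∀ i, Consistent (t i)) → ((roundMap P squash).pow M).op l x t = 0) :=
  tensorPi_controlled (fun t : AReg × Kept × Pub => t.1) bobPart Consistent _ _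
    (fun i x t => (roundMap_op_apply P squash (l i) x t).1)
    (fun i x t => (roundMap_op_apply P squash (l i) x t).2) x t

/-! ### The source -/

namespace Params

theorem μ_nonneg {P : Params} (hP : P.Valid) : ∀ ω, 0 ≤ P.μ ω
  | S => (hP.μD_pos.trans hP.μD_lt).le
  | D => hP.μD_pos.le
  | V => hP.μV_nonneg

theorem pCS_nonneg {P : Params} (hP : P.Valid) (ω : Intensity) (n : ℕ) : 0 ≤ P.pCS ω n := by
  have := μ_nonneg hP ω
  unfold pCS
  positivity

theorem pJoint_nonneg {P : Params} (hP : P.Valid) (ω : Intensity) (n : ℕ) : 0 ≤ P.pJoint ω n :=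
  mul_nonneg (hP.pInt_pos ω).le (pCS_nonneg hP ω n)

theorem pCS_hasSum (P : Params) (ω : Intensity) : HasSum (P.pCS ω) 1 := by
  have h := (NormedSpace.expSeries_div_hasSum_exp (P.μ ω)).mul_right (Real.exp (-P.μ ω))
  rw [← Real.exp_eq_exp_ℝ, ← Real.exp_add, add_neg_cancel, Real.exp_zero] at h
  exact h

/-- The amplitude of the Fock state `|k₁⟩|k₂⟩` in a double pulse of `n` photons. -/
def fockAmpl (a : Bool) (α : BasisLabel) (n : ℕ) (k : ℕ × ℕ) : ℂ :=
  if k.1 + k.2 = n then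
    ((√(1 / 2 ^ n * (n.choose k.2 : ℝ)) : ℝ) : ℂ) *
      Complex.exp (Complex.I * (phase a α : ℂ) * (k.1 : ℂ))
  else 0

/-- The `n`-photon component of the source state for given labels. -/
def fockState (r : AReg) (n : ℕ) : Hilb (AReg × ℕ × (ℕ × ℕ)) :=
  ∑ k ∈ Finset.range (n + 1),
    (((√(1 / 2 ^ n * (n.choose k : ℝ)) : ℝ) : ℂ) *
      Complex.exp (Complex.I * (phase r.2.2 r.2.1 : ℂ) * ((n - k : ℕ) : ℂ))) •
        ket (r, n, (n - k, k))

theorem norm_exp_phase (x : ℝ) (k : ℕ) :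
    ‖Complex.exp (Complex.I * (x : ℂ) * (k : ℂ))‖ = 1 := by
  rw [mul_assoc, mul_comm, ← Complex.ofReal_natCast, ← Complex.ofReal_mul,
    Complex.norm_exp_ofReal_mul_I]

theorem fockState_apply (r r' : AReg) (n n' : ℕ) (k : ℕ × ℕ) :
    fockState r n (r', n', k) =
      if r' = r ∧ n' = n then fockAmpl r.2.2 r.2.1 n k else 0 := by
  classical
  rw [fockState, sum_apply']
  have h : ∀ j ∈ Finset.range (n + 1), ((((√(1 / 2 ^ n * (n.choose j : ℝ)) : ℝ) : ℂ) *
      Complex.exp (Complex.I * (phase r.2.2 r.2.1 : ℂ) * ((n - j : ℕ) : ℂ))) •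
        (ket (r, n, (n - j, j)) : Hilb (AReg × ℕ × (ℕ × ℕ)))) (r', n', k) =
      if k.2 = j then (if r' = r ∧ n' = n then fockAmpl r.2.2 r.2.1 n k else 0) else 0 := by
    intro j hj
    have hjn : j ≤ n := Nat.lt_succ_iff.1 (Finset.mem_range.1 hj)
    change _ * ket (r, n, (n - j, j)) (r', n', k) = _
    rw [ket_apply]
    by_cases hk : k.2 = j
    · rw [if_pos hk]
      by_cases hr : r' = r ∧ n' = n
      · rw [if_pos hr]
        by_cases hk1 : k.1 = n - j
        · have e : k = (n - j, j) := Prod.ext hk1 hk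
          rw [if_pos (by rw [hr.1, hr.2, e]), mul_one, fockAmpl, if_pos (by omega), hk, hk1]
        · rw [if_neg (fun e => hk1 (congrArg (fun s => s.2.2.1) e)), mul_zero, fockAmpl,
            if_neg (by omega)]
      · rw [if_neg hr, if_neg, mul_zero]
        exact fun e => hr ⟨congrArg Prod.fst e, congrArg (fun s => s.2.1) e⟩
    · rw [if_neg hk, if_neg, mul_zero]
      exact fun e => hk (congrArg (fun s => s.2.2.2) e)
  rw [Finset.sum_congr rfl h, Finset.sum_ite_eq]
  by_cases hk : k.2 ∈ Finset.range (n + 1)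
  · rw [if_pos hk]
  · rw [if_neg hk]
    have : ¬k.1 + k.2 = n := fun e => hk (Finset.mem_range.2 (by omega))
    simp [fockAmpl, this]

theorem norm_fockState_le (r : AReg) (n : ℕ) : ‖fockState r n‖ ≤ 2 ^ n := by
  refine (norm_sum_le _ _).trans ((Finset.sum_le_sum (g := fun _ => (1 : ℝ)) fun k _ => ?_).trans ?_)
  · rw [norm_smul, norm_mul, norm_exp_phase, norm_ket, mul_one, mul_one, Complex.norm_real,
      Real.norm_eq_abs, abs_of_nonneg (Real.sqrt_nonneg _)]
    refine Real.sqrt_le_one.2 ?_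
    rw [one_div, inv_mul_le_iff₀ (by positivity), mul_one]
    exact_mod_cast Nat.choose_le_two_pow n k
  · rw [Finset.sum_const, Finset.card_range, nsmul_eq_mul, mul_one]
    exact_mod_cast Nat.lt_two_pow_self

theorem summable_fockState {P : Params} (hP : P.Valid) (ω : Intensity) (r : AReg) :
    Summable fun n : ℕ => ((√(P.pCS ω n) : ℝ) : ℂ) • fockState r n := by
  have h1 : Summable fun n : ℕ => 16 ^ n * P.pCS ω n := by
    refine ((Real.summable_pow_div_factorial (16 * P.μ ω)).mul_right
      (Real.exp (-P.μ ω))).congr fun n => ?_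
    rw [pCS, mul_pow]
    ring
  have h2 : Summable fun n : ℕ => (1 / 4 : ℝ) ^ n := summable_geometric_of_lt_one (by norm_num)
    (by norm_num)
  refine Summable.of_norm_bounded (h1.add h2) fun n => ?_
  rw [norm_smul, Complex.norm_real, Real.norm_eq_abs, abs_of_nonneg (Real.sqrt_nonneg _)]
  refine (mul_le_mul_of_nonneg_left (norm_fockState_le r n) (Real.sqrt_nonneg _)).trans ?_
  have h3 := two_mul_le_add_sq (4 ^ n * √(P.pCS ω n)) ((1 / 2 : ℝ) ^ n)
  have h4 : (4 ^ n * √(P.pCS ω n)) ^ 2 = 16 ^ n * P.pCS ω n := by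
    rw [mul_pow, Real.sq_sqrt (pCS_nonneg hP ω n), ← pow_mul, mul_comm n, pow_mul]
    norm_num
  have h5 : ((1 / 2 : ℝ) ^ n) ^ 2 = (1 / 4) ^ n := by
    rw [← pow_mul, mul_comm n, pow_mul]
    norm_num
  have h6 : 4 ^ n * √(P.pCS ω n) * (1 / 2 : ℝ) ^ n = √(P.pCS ω n) * 2 ^ n := by
    have : (4 : ℝ) ^ n * (1 / 2) ^ n = 2 ^ n := by
      rw [← mul_pow]
      norm_num
    rw [mul_right_comm, this, mul_comm]
  have h7 : 0 ≤ √(P.pCS ω n) * 2 ^ n := by positivity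
  rw [h4, h5, mul_assoc, h6] at h3
  linarith

/-- In the amplitudes of the source state, the intensity label occurs in the factor
`√(p^int_{ω,n})` only. -/
theorem sourceState_apply {P : Params} (hP : P.Valid) (ω : Intensity) (α : BasisLabel) (a : Bool)
    (n : ℕ) (k : ℕ × ℕ) :
    P.sourceState ((ω, α, a), n, k) =
      ((√(P.pJoint ω n) : ℝ) : ℂ) * (((√(1 / 2 * P.pBasis α) : ℝ) : ℂ) * fockAmpl a α n k) := by
  classical
  have h1 : ∀ ω' α' a', (∑' m : ℕ, ((√(P.pCS ω' m) : ℝ) : ℂ) • fockState (ω', α', a') m)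
      ((ω, α, a), n, k) =
      if a = a' then (if α = α' then (if ω = ω' then
        ((√(P.pCS ω n) : ℝ) : ℂ) * fockAmpl a α n k else 0) else 0) else 0 := by
    intro ω' α' a'
    have h2 : HasSum (fun m => inner ℂ (ket ((ω, α, a), n, k))
        (((√(P.pCS ω' m) : ℝ) : ℂ) • fockState (ω', α', a') m))
        (inner ℂ (ket ((ω, α, a), n, k))
          (∑' m : ℕ, ((√(P.pCS ω' m) : ℝ) : ℂ) • fockState (ω', α', a') m)) :=
      (summable_fockState hP ω' (ω', α', a')).hasSum.mapL (innerSL ℂ _)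
    rw [← inner_ket_left, ← h2.tsum_eq, tsum_eq_single n]
    · rw [inner_smul_right, inner_ket_left, fockState_apply]
      split_ifs with h3 h4 h5 h6 h4 h5 h6 <;> simp_all
    · intro m hm
      rw [inner_smul_right, inner_ket_left, fockState_apply, if_neg (fun h => hm h.2.symm),
        mul_zero]
  have h3 : P.sourceState ((ω, α, a), n, k) = ∑ ω', ∑ α', ∑ a' : Bool,
      ((√(1 / 2 * P.pInt ω' * P.pBasis α') : ℝ) : ℂ) *
        (∑' m : ℕ, ((√(P.pCS ω' m) : ℝ) : ℂ) • fockState (ω', α', a') m) ((ω, α, a), n, k) := by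
    unfold sourceState
    rw [sum_apply']
    refine Finset.sum_congr rfl fun ω' _ => ?_
    rw [sum_apply']
    refine Finset.sum_congr rfl fun α' _ => ?_
    rw [sum_apply']
    rfl
  rw [h3]
  simp only [h1, mul_ite, mul_zero, Finset.sum_ite_eq, Finset.mem_univ, if_true]
  have h4 : √(1 / 2 * P.pInt ω * P.pBasis α) * √(P.pCS ω n) =
      √(P.pJoint ω n) * √(1 / 2 * P.pBasis α) := by
    rw [← Real.sqrt_mul' _ (pCS_nonneg hP ω n), ← Real.sqrt_mul (pJoint_nonneg hP ω n), pJoint]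
    congr 1
    ring
  rw [← mul_assoc, ← mul_assoc, ← Complex.ofReal_mul, ← Complex.ofReal_mul, h4]

theorem tsum_fockAmpl (a : Bool) (α : BasisLabel) (n : ℕ) :
    ∑' k : ℕ × ℕ, ‖fockAmpl a α n k‖ₑ ^ 2 = 1 := by
  rw [tsum_eq_sum (s := Finset.HasAntidiagonal.antidiagonal n)]
  · have h : ∀ k ∈ Finset.HasAntidiagonal.antidiagonal n, ‖fockAmpl a α n k‖ₑ ^ 2 =
        ENNReal.ofReal (1 / 2 ^ n * (n.choose k.2 : ℝ)) := by
      intro k hk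
      rw [fockAmpl, if_pos (Finset.HasAntidiagonal.mem_antidiagonal.1 hk), ← ofReal_norm_sq, norm_mul,
        norm_exp_phase, mul_one, Complex.norm_real, Real.norm_eq_abs, sq_abs,
        Real.sq_sqrt (by positivity)]
    rw [Finset.sum_congr rfl h, ← ENNReal.ofReal_sum_of_nonneg fun _ _ => by positivity,
      ← Finset.mul_sum, Finset.Nat.sum_antidiagonal_eq_sum_range_succ_mk,
      ← Nat.cast_sum]
    have h2 : ∑ x ∈ Finset.range n.succ, n.choose (n - x) = 2 ^ n := by
      rw [← Nat.sum_range_choose, ← Finset.sum_range_reflect]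
      refine Finset.sum_congr rfl fun x hx => ?_
      have := Finset.mem_range.1 hx
      congr 1
      omega
    rw [h2]
    simp
  · intro k hk
    rw [fockAmpl, if_neg fun h => hk (Finset.HasAntidiagonal.mem_antidiagonal.2 h)]
    simp

theorem enorm_sq_sourceState {P : Params} (hP : P.Valid) : ‖P.sourceState‖ₑ ^ 2 = 1 := by
  have e : ∀ {x : ℝ}, 0 ≤ x → ‖((√x : ℝ) : ℂ)‖ₑ ^ 2 = ENNReal.ofReal x := fun {x} hx => by
    rw [← ofReal_norm_sq, Complex.norm_real, Real.norm_eq_abs, sq_abs, Real.sq_sqrt hx]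
  have h1 : ∀ r : AReg, ∀ n k, ‖P.sourceState (r, n, k)‖ₑ ^ 2 =
      ENNReal.ofReal (1 / 2 * P.pBasis r.2.1 * P.pInt r.1) * (ENNReal.ofReal (P.pCS r.1 n) *
        ‖fockAmpl r.2.2 r.2.1 n k‖ₑ ^ 2) := by
    rintro ⟨ω, α, a⟩ n k
    have hb : 0 ≤ 1 / 2 * P.pBasis α := mul_nonneg (by norm_num) (hP.pBasis_nonneg α)
    rw [sourceState_apply hP, enorm_mul, enorm_mul, mul_pow, mul_pow, e (pJoint_nonneg hP ω n),
      e hb, pJoint, ENNReal.ofReal_mul (hP.pInt_pos ω).le, ENNReal.ofReal_mul hb]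
    ring
  rw [enorm_sq_eq_tsum, ENNReal.tsum_prod (f := fun r q => ‖P.sourceState (r, q)‖ₑ ^ 2)]
  have h2 : ∀ r : AReg, ∑' q : ℕ × ℕ × ℕ, ‖P.sourceState (r, q)‖ₑ ^ 2 =
      ENNReal.ofReal (1 / 2 * P.pBasis r.2.1 * P.pInt r.1) := by
    intro r
    rw [ENNReal.tsum_prod (f := fun n k => ‖P.sourceState (r, n, k)‖ₑ ^ 2)]
    simp only [h1, ENNReal.tsum_mul_left, tsum_fockAmpl, mul_one]
    rw [← ENNReal.ofReal_tsum_of_nonneg (pCS_nonneg hP r.1) (pCS_hasSum P r.1).summable,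
      (pCS_hasSum P r.1).tsum_eq, ENNReal.ofReal_one, mul_one]
  simp only [h2]
  rw [tsum_fintype, ← ENNReal.ofReal_sum_of_nonneg, Fintype.sum_prod_type]
  · have h3 : ∀ ω, ∑ q : BasisLabel × Bool, 1 / 2 * P.pBasis q.1 * P.pInt ω = P.pInt ω := by
      intro ω
      have h4 : ∀ α, 1 / 2 * P.pBasis α * P.pInt ω + 1 / 2 * P.pBasis α * P.pInt ω =
        P.pBasis α * P.pInt ω := fun α => by ring
      simp only [Fintype.sum_prod_type, Fintype.sum_bool, h4]
      rw [← Finset.sum_mul, hP.pBasis_sum, one_mul]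
    simp only [h3, hP.pInt_sum]
    exact ENNReal.ofReal_one
  · exact fun r _ => mul_nonneg (mul_nonneg (by norm_num) (hP.pBasis_nonneg _)) (hP.pInt_pos _).le

end Params

/-! ### The registers of Alice and Bob in the course of the protocol -/

section Stage

variable {J M : ℕ}

/-- The labels `A` and `A'` of Alice's registers differ at most in the intensity of round `m` of
block `i`. -/
def SameExcept (i : Fin J) (m : Fin M) (A A' : Fin J → Fin M → AReg) : Prop :=
  (A i m).2 = (A' i m).2 ∧ ∀ i' m', (i' ≠ i ∨ m' ≠ m) → A i' m' = A' i' m'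

/-- For a round in block number `j` or later, the intensity label `ω` occurs in the amplitudes of
`x` in a factor `√(p^int_{ω,n})` only. -/
def OmegaFactor (P : Params) {j : ℕ} {Y : Type} (x : Hilb (Stage J M j Y)) : Prop :=
  ∀ (i : Fin J) (m : Fin M), j ≤ i.1 → ∀ A A', SameExcept i m A A' → ∀ n K y,
    ((√(P.pJoint (A' i m).1 (n i m)) : ℝ) : ℂ) * x ((A, n, K), y) =
      ((√(P.pJoint (A i m).1 (n i m)) : ℝ) : ℂ) * x ((A', n, K), y)

theorem mul_prod_eq_mul_prod {k : ℕ} {f g : Fin k → ℂ} {c d : ℂ} (m : Fin k)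
    (h : c * f m = d * g m) (h' : ∀ m', m' ≠ m → f m' = g m') : c * ∏ i, f i = d * ∏ i, g i := by
  rw [← Finset.mul_prod_erase _ _ (Finset.mem_univ m), ← Finset.mul_prod_erase _ g
    (Finset.mem_univ m), ← mul_assoc, ← mul_assoc, h]
  congr 1
  exact Finset.prod_congr rfl fun i hi => h' i (Finset.ne_of_mem_erase hi)

/-- The vector of all sources. -/
def sourceVec (P : Params) (J M : ℕ) : Hilb (Stage J M 0 (Fin J → Fin M → ℕ × ℕ)) :=
  relabel (splitSource J M) (tensorVec fun _ => tensorVec fun _ => P.sourceState)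

theorem sourceVec_apply (P : Params) (A : Fin J → Fin M → AReg) (n : Fin J → Fin M → ℕ)
    (K : Fin 0 → Fin M → Kept) (y : Fin J → Fin M → ℕ × ℕ) :
    sourceVec P J M ((A, n, K), y) = ∏ i, ∏ m, P.sourceState (A i m, n i m, y i m) := rfl

theorem omegaFactor_sourceVec {P : Params} (hP : P.Valid) : OmegaFactor P (sourceVec P J M) := by
  intro i m _ A A' h n K y
  rw [sourceVec_apply, sourceVec_apply]
  refine mul_prod_eq_mul_prod i (mul_prod_eq_mul_prod m ?_ ?_) ?_
  · have e : ∀ r : AReg, P.sourceState (r, n i m, y i m) = _ :=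
      fun r => Params.sourceState_apply hP r.1 r.2.1 r.2.2 _ _
    rw [e, e, h.1]
    ring
  · exact fun m' hm' => by rw [h.2 i m' (Or.inr hm')]
  · exact fun i' hi' => Finset.prod_congr rfl fun m' _ => by rw [h.2 i' m' (Or.inl hi')]

theorem enorm_sq_sourceVec {P : Params} (hP : P.Valid) : ‖sourceVec P J M‖ₑ ^ 2 = 1 := by
  rw [sourceVec, enorm_sq_relabel, enorm_sq_tensorVec]
  simp [enorm_sq_tensorVec, Params.enorm_sq_sourceState hP]

/-- The components of a state that belong to a fixed label of the first system. -/
def fiber {C Y : Type} (x : Hilb (C × Y)) (c : C) : Hilb Y :=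
  comap (Prod.mk c) (Prod.mk_right_injective c) x

theorem along_op_apply {C Y Y' : Type} (Φ : KrausMap Y Y') (k : Φ.index) (x : Hilb (C × Y)) (c : C)
    (y : Y') : (Φ.along (Equiv.prodComm C Y) (Equiv.prodComm C Y')).op k x (c, y) =
      Φ.op k (fiber x c) y := rfl

theorem OmegaFactor.along {P : Params} {j : ℕ} {Y Y' : Type} {x : Hilb (Stage J M j Y)}
    (hx : OmegaFactor P x) (Φ : KrausMap Y Y') (k : Φ.index) :
    OmegaFactor P ((Φ.along (Equiv.prodComm _ _) (Equiv.prodComm _ _)).op k x :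
      Hilb (Stage J M j Y')) := by
  intro i m hi A A' h n K y
  rw [along_op_apply, along_op_apply]
  have e : ((√(P.pJoint (A' i m).1 (n i m)) : ℝ) : ℂ) • fiber x (A, n, K) =
      ((√(P.pJoint (A i m).1 (n i m)) : ℝ) : ℂ) • fiber x (A', n, K) :=
    hilb_ext fun y => hx i m hi A A' h n K y
  have e2 := congrArg (fun v => Φ.op k v y) e
  simp only [map_smul] at e2
  exact e2

/-- A trace-preserving map on the second system does not change the distribution of the label of
the first. -/
theorem Unravels.tsum_diag_along {C Y Y' L : Type} {ρ : Op (C × Y) (C × Y)} {ψ : L → Hilb (C × Y)}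
    (h : Unravels ρ ψ) {Φ : KrausMap Y Y'} (hΦ : Φ.IsTP) (c : C) :
    ∑' y, diag ((Φ.along (Equiv.prodComm C Y) (Equiv.prodComm C Y')).map ρ) (c, y) =
      ∑' y, diag ρ (c, y) := by
  have h' := h.map (Φ := Φ.along (Equiv.prodComm C Y) (Equiv.prodComm C Y'))
    (hΦ.family.amplAlong (Equiv.prodComm C Y) (Equiv.prodComm C Y'))
  have e : ∀ y, diag ((Φ.along (Equiv.prodComm C Y) (Equiv.prodComm C Y')).map ρ) (c, y) =
      ∑' l, ∑' k, ‖Φ.op k (fiber (ψ l) c) y‖ₑ ^ 2 := by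
    intro y
    rw [h'.diag_eq]
    refine (ENNReal.tsum_prod (f := fun k l => ‖Φ.op k (fiber (ψ l) c) y‖ₑ ^ 2)).trans ?_
    exact ENNReal.tsum_comm
  simp only [e, h.diag_eq]
  rw [ENNReal.tsum_comm, ENNReal.tsum_comm (f := fun y l => ‖ψ l (c, y)‖ₑ ^ 2)]
  refine tsum_congr fun l => ?_
  rw [ENNReal.tsum_comm]
  simp only [← enorm_sq_eq_tsum]
  rw [hΦ.family, enorm_sq_eq_tsum]
  rfl

/-- The signals of a block, for fixed labels of the other systems. -/
def sigVec {j : ℕ} {β ε : Type} (x : Hilb (Stage J M j ((Fin M → β) × ε)))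
    (A : Fin J → Fin M → AReg) (n : Fin J → Fin M → ℕ) (K : Fin j → Fin M → Kept) (e : ε) :
    Hilb (Fin M → β) :=
  comap (fun s => ((A, n, K), (s, e))) (fun _ _ h => congrArg (fun t => t.2.1) h) x

/-- The Kraus operators of a block act on the signals for fixed labels of the other systems. -/
theorem blockMap_op_apply (P : Params) {β ε : Type} (squash : KrausMap β (Option Bool)) (j : Fin J)
    (l : Fin M → (roundMap P squash).index)
    (x : Hilb (Stage J M j.1 ((Fin M → β) × ε))) (A : Fin J → Fin M → AReg)
    (n : Fin J → Fin M → ℕ) (K : Fin (j.1 + 1) → Fin M → Kept) (u : Fin M → Pub) (e : ε) :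
    ((∀ m, Consistent (A j m, K (Fin.last _) m, u m)) →
      (blockMap P squash j).op l x ((A, n, K), (u, e)) =
        bobBlock P squash M l (sigVec x A n (fun i => K i.castSucc) e)
          fun m => bobPart (A j m, K (Fin.last _) m, u m)) ∧
    ((¬∀ m, Consistent (A j m, K (Fin.last _) m, u m)) →
      (blockMap P squash j).op l x ((A, n, K), (u, e)) = 0) := by
  set t : Stage J M (j.1 + 1) ((Fin M → Pub) × ε) := ((A, n, K), (u, e)) with ht
  have h := pow_roundMap_op_apply P squash l
    (comap (fun s => (splitBefore j β ε).symm (s, (splitAfter j ε t).2))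
      (symm_mk_injective _ _) x) (splitAfter j ε t).1
  have h1 : (blockMap P squash j).op l x t = ((roundMap P squash).pow M).op l
    (comap (fun s => (splitBefore j β ε).symm (s, (splitAfter j ε t).2))
      (symm_mk_injective _ _) x) (splitAfter j ε t).1 := rfl
  have h2 : comap (fun s m => (((splitAfter j ε t).1 m).1, s m)) (comp_mk_injective _)
      (comap (fun s => (splitBefore j β ε).symm (s, (splitAfter j ε t).2))
        (symm_mk_injective _ _) x) = sigVec x A n (fun i => K i.castSucc) e := by
    refine hilb_ext fun s => ?_
    rw [comap_apply, comap_apply]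
    refine congrArg x ((Equiv.symm_apply_eq _).2 ?_)
    rfl
  rw [h1]
  rw [h2] at h
  exact h

theorem sigVec_smul_eq {P : Params} {j : ℕ} {β ε : Type}
    {x : Hilb (Stage J M j ((Fin M → β) × ε))} (hx : OmegaFactor P x) {i : Fin J} {m : Fin M}
    (hi : j ≤ i.1) {A A' : Fin J → Fin M → AReg} (h : SameExcept i m A A') (n : Fin J → Fin M → ℕ)
    (K : Fin j → Fin M → Kept) (e : ε) :
    ((√(P.pJoint (A' i m).1 (n i m)) : ℝ) : ℂ) • sigVec x A n K e =
      ((√(P.pJoint (A i m).1 (n i m)) : ℝ) : ℂ) • sigVec x A' n K e :=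
  hilb_ext fun s => hx i m hi A A' h n K (s, e)

theorem OmegaFactor.blockMap {P : Params} {β ε : Type} {squash : KrausMap β (Option Bool)}
    {j : Fin J} {x : Hilb (Stage J M j.1 ((Fin M → β) × ε))} (hx : OmegaFactor P x)
    (l : Fin M → (roundMap P squash).index) :
    OmegaFactor P ((DecoyBB84.blockMap P squash j).op l x) := by
  rintro i m hi A A' h n K ⟨u, e⟩
  have hij : j ≠ i := fun h => by
    rw [h] at hi
    omega
  have hA : ∀ m, A j m = A' j m := fun m' => h.2 j m' (Or.inl hij)
  have h1 := blockMap_op_apply P squash j l x A n K u e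
  have h2 := blockMap_op_apply P squash j l x A' n K u e
  simp only [hA] at h1
  by_cases hc : ∀ m, Consistent (A' j m, K (Fin.last _) m, u m)
  · rw [h1.1 hc, h2.1 hc]
    have e1 := congrArg (fun v => bobBlock P squash M l v
      fun m => bobPart (A' j m, K (Fin.last _) m, u m))
      (sigVec_smul_eq hx (i := i) (by omega) h n (fun i => K i.castSucc) e)
    simp only [map_smul] at e1
    exact e1
  · rw [h1.2 hc, h2.2 hc, mul_zero, mul_zero]

/-! ### The distribution of Alice's labels and Bob's outcomes -/

/-- The distribution of Alice's labels, photon numbers and Bob's registers of the first `j`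
blocks. -/
def marg {j : ℕ} {Y : Type} (w : Stage J M j Y → ℝ≥0∞) (A : Fin J → Fin M → AReg)
    (n : Fin J → Fin M → ℕ) (b : Fin j → Fin M → BReg) : ℝ≥0∞ :=
  ∑' (k : Fin j → Fin M → BMsg × AMsg), ∑' y, w ((A, n, fun i m => (b i m, k i m)), y)

/-- The weight of Bob's outcomes `b` of a block when he receives the signals `φ`. It does not depend
on Alice's labels. -/
def blockWeight (P : Params) {β : Type} (squash : KrausMap β (Option Bool)) (b : Fin M → BReg)
    (φ : Hilb (Fin M → β)) : ℝ≥0∞ :=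
  ∑' (l : Fin M → (roundMap P squash).index) (c : Fin M → BMsg × BMsg),
    ‖bobBlock P squash M l φ fun m => (b m, c m)‖ₑ ^ 2

theorem tsum_blockWeight {P : Params} (hP : P.Valid) {β : Type} {squash : KrausMap β (Option Bool)}
    (hs : squash.IsTP) (φ : Hilb (Fin M → β)) :
    ∑' b, blockWeight P squash b φ = ‖φ‖ₑ ^ 2 := by
  rw [← bobBlock_isTP hP hs M φ]
  unfold blockWeight
  rw [ENNReal.tsum_comm]
  refine tsum_congr fun l => ?_
  rw [enorm_sq_eq_tsum, ← (Equiv.arrowProdEquivProdArrow (Fin M) (fun _ => BReg)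
    (fun _ => BMsg × BMsg)).symm.tsum_eq]
  exact (ENNReal.tsum_prod (f := fun (b : Fin M → BReg) (c : Fin M → BMsg × BMsg) =>
    ‖bobBlock P squash M l φ fun m => (b m, c m)‖ₑ ^ 2)).symm

theorem blockWeight_smul (P : Params) {β : Type} (squash : KrausMap β (Option Bool))
    (b : Fin M → BReg) (c : ℂ) (φ : Hilb (Fin M → β)) :
    blockWeight P squash b (c • φ) = ‖c‖ₑ ^ 2 * blockWeight P squash b φ := by
  have e : ∀ (l : Fin M → (roundMap P squash).index) (t : Fin M → BReg × BMsg × BMsg),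
      ‖bobBlock P squash M l (c • φ) t‖ₑ ^ 2 = ‖c‖ₑ ^ 2 * ‖bobBlock P squash M l φ t‖ₑ ^ 2 := by
    intro l t
    rw [map_smul]
    change ‖c * _‖ₑ ^ 2 = _
    rw [enorm_mul, mul_pow]
  simp only [blockWeight, e, ENNReal.tsum_mul_left]

/-- Alice's messages are determined by the other labels, so that the sum over the messages of a block
is a sum over Bob's messages. -/
theorem tsum_messages {P : Params} {β ε : Type} {squash : KrausMap β (Option Bool)} {j : Fin J}
    (l : Fin M → (roundMap P squash).index) (x : Hilb (Stage J M j.1 ((Fin M → β) × ε)))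
    (A : Fin J → Fin M → AReg) (n : Fin J → Fin M → ℕ) (b : Fin (j.1 + 1) → Fin M → BReg)
    (k : Fin j.1 → Fin M → BMsg × AMsg) (e : ε) :
    ∑' (k' : Fin M → BMsg × AMsg) (u : Fin M → Pub), ‖(blockMap P squash j).op l x
        ((A, n, fun i m => (b i m, (Fin.snoc (α := fun _ => Fin M → BMsg × AMsg) k k' :
          Fin (j.1 + 1) → Fin M → BMsg × AMsg) i m)), (u, e))‖ₑ ^ 2 =
      ∑' c : Fin M → BMsg × BMsg, ‖bobBlock P squash M l
        (sigVec x A n (fun i m => (b i.castSucc m, k i m)) e)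
          fun m => (b (Fin.last _) m, c m)‖ₑ ^ 2 := by
  set F : (Fin M → BMsg × AMsg) × (Fin M → Pub) → ℝ≥0∞ := fun p => ‖(blockMap P squash j).op l x
        ((A, n, fun i m => (b i m, (Fin.snoc (α := fun _ => Fin M → BMsg × AMsg) k p.1 :
          Fin (j.1 + 1) → Fin M → BMsg × AMsg) i m)), (p.2, e))‖ₑ ^ 2 with hF
  set g : (Fin M → BMsg × BMsg) → (Fin M → BMsg × AMsg) × (Fin M → Pub) := fun c =>
    (fun m => ((c m).1, aliceMsg (A j m) (c m).1), fun m => ((c m).2, aliceMsg (A j m) (c m).1))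
    with hg
  have hginj : g.Injective := by
    intro c c' h
    funext m
    exact Prod.ext (congrArg (fun p => (p.1 m).1) h) (congrArg (fun p => (p.2 m).1) h)
  have hFc : ∀ p, ((∀ m, Consistent (A j m, (b (Fin.last _) m, p.1 m), p.2 m)) → F p =
      ‖bobBlock P squash M l (sigVec x A n (fun i m => (b i.castSucc m, k i m)) e)
        fun m => bobPart (A j m, (b (Fin.last _) m, p.1 m), p.2 m)‖ₑ ^ 2) ∧
      ((¬∀ m, Consistent (A j m, (b (Fin.last _) m, p.1 m), p.2 m)) → F p = 0) := by
    intro p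
    have h := blockMap_op_apply P squash j l x A n (fun i m => (b i m,
      (Fin.snoc (α := fun _ => Fin M → BMsg × AMsg) k p.1 :
          Fin (j.1 + 1) → Fin M → BMsg × AMsg) i m)) p.2 e
    simp only [Fin.snoc_last, Fin.snoc_castSucc] at h
    refine ⟨fun hc => ?_, fun hc => ?_⟩
    · rw [hF]
      simp only
      rw [h.1 hc]
    · rw [hF]
      simp only
      rw [h.2 hc]
      simp
  rw [← ENNReal.tsum_prod (f := fun k' u => F (k', u))]
  have hsupp : Function.support F ⊆ Set.range g := by
    rintro ⟨k', u⟩ hp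
    have hc : ∀ m, Consistent (A j m, (b (Fin.last _) m, k' m), u m) := by
      by_contra hc
      exact hp ((hFc (k', u)).2 hc)
    refine ⟨fun m => ((k' m).1, (u m).1), Prod.ext (funext fun m => ?_) (funext fun m => ?_)⟩
    · exact Prod.ext rfl (hc m).1.symm
    · exact Prod.ext rfl (hc m).2.symm
  rw [← hginj.tsum_eq hsupp]
  refine tsum_congr fun c => ?_
  rw [(hFc (g c)).1 fun m => ⟨rfl, rfl⟩]
  rfl

theorem tsum_fin_succ_eq {X : Type} {j : ℕ} (f : (Fin (j + 1) → X) → ℝ≥0∞) :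
    ∑' k, f k = ∑' (k : Fin j → X) (k' : X), f (Fin.snoc (α := fun _ => X) k k') := by
  rw [← (Fin.snocEquiv fun _ : Fin (j + 1) => X).tsum_eq, ENNReal.tsum_comm]
  exact ENNReal.tsum_prod (f := fun (k' : X) (k : Fin j → X) =>
    f (Fin.snoc (α := fun _ => X) k k'))

theorem tsum_marg {j : ℕ} {Y : Type} (w : Stage J M j Y → ℝ≥0∞) :
    ∑' (A) (n) (b), marg w A n b = ∑' s, w s := by
  rw [ENNReal.tsum_prod (f := fun c y => w (c, y)),
    ENNReal.tsum_prod (f := fun A p => ∑' y, w ((A, p), y))]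
  refine tsum_congr fun A => ?_
  rw [ENNReal.tsum_prod (f := fun n K => ∑' y, w ((A, n, K), y))]
  refine tsum_congr fun n => ?_
  let e : ((Fin j → Fin M → BReg) × (Fin j → Fin M → BMsg × AMsg)) ≃ (Fin j → Fin M → Kept) :=
    ⟨fun p i m => (p.1 i m, p.2 i m), fun K => (fun i m => (K i m).1, fun i m => (K i m).2),
      fun _ => rfl, fun _ => rfl⟩
  rw [← e.tsum_eq]
  exact (ENNReal.tsum_prod (f := fun (b : Fin j → Fin M → BReg) (k : Fin j → Fin M → BMsg × AMsg) =>
    ∑' y, w ((A, n, fun i m => (b i m, k i m)), y))).symm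

theorem marg_tsum {j : ℕ} {Y L : Type} (w : L → Stage J M j Y → ℝ≥0∞) (A : Fin J → Fin M → AReg)
    (n : Fin J → Fin M → ℕ) (b : Fin j → Fin M → BReg) :
    marg (fun s => ∑' l, w l s) A n b = ∑' l, marg (w l) A n b := by
  exact (tsum_congr fun k => ENNReal.tsum_comm).trans ENNReal.tsum_comm

section Block

variable {P : Params} {β ε : Type} {squash : KrausMap β (Option Bool)} {j : Fin J}

/-- The distribution after the measurement of a block, in terms of the signals that Bob receives. -/
theorem marg_blockMap (x : Hilb (Stage J M j.1 ((Fin M → β) × ε))) (A : Fin J → Fin M → AReg)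
    (n : Fin J → Fin M → ℕ) (b : Fin (j.1 + 1) → Fin M → BReg) :
    marg (fun s => ∑' l : Fin M → (roundMap P squash).index,
        ‖(blockMap (ε := ε) P squash j).op l x s‖ₑ ^ 2) A n b =
      ∑' (k : Fin j.1 → Fin M → BMsg × AMsg) (e : ε), blockWeight P squash (b (Fin.last _))
        (sigVec x A n (fun i m => (b i.castSucc m, k i m)) e) := by
  unfold marg
  rw [tsum_fin_succ_eq]
  refine tsum_congr fun k => ?_
  simp only [blockWeight, ← tsum_messages]
  have h : ∀ k', ∑' y : (Fin M → Pub) × ε, ∑' l : Fin M → (roundMap P squash).index,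
      ‖(blockMap (ε := ε) P squash j).op l x ((A, n, fun i m => (b i m,
        (Fin.snoc (α := fun _ => Fin M → BMsg × AMsg) k k' :
          Fin (j.1 + 1) → Fin M → BMsg × AMsg) i m)), y)‖ₑ ^ 2 =
      ∑' (e : ε) (l : Fin M → (roundMap P squash).index) (u : Fin M → Pub),
        ‖(blockMap (ε := ε) P squash j).op l x ((A, n, fun i m => (b i m,
        (Fin.snoc (α := fun _ => Fin M → BMsg × AMsg) k k' :
          Fin (j.1 + 1) → Fin M → BMsg × AMsg) i m)), (u, e))‖ₑ ^ 2 := by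
    intro k'
    rw [ENNReal.tsum_prod (f := fun u e => ∑' l : Fin M → (roundMap P squash).index,
      ‖(blockMap (ε := ε) P squash j).op l x ((A, n, fun i m => (b i m,
        (Fin.snoc (α := fun _ => Fin M → BMsg × AMsg) k k' :
          Fin (j.1 + 1) → Fin M → BMsg × AMsg) i m)), (u, e))‖ₑ ^ 2), ENNReal.tsum_comm]
    exact tsum_congr fun e => ENNReal.tsum_comm
  rw [tsum_congr h, ENNReal.tsum_comm]
  exact tsum_congr fun e => ENNReal.tsum_comm

theorem tsum_marg_blockMap (hP : P.Valid) (hs : squash.IsTP)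
    (x : Hilb (Stage J M j.1 ((Fin M → β) × ε))) (A : Fin J → Fin M → AReg)
    (n : Fin J → Fin M → ℕ) (b : Fin j.1 → Fin M → BReg) :
    ∑' b' : Fin M → BReg, marg (fun s => ∑' l : Fin M → (roundMap P squash).index,
        ‖(blockMap (ε := ε) P squash j).op l x s‖ₑ ^ 2) A n
          (Fin.snoc (α := fun _ => Fin M → BReg) b b') =
      marg (fun s => ‖x s‖ₑ ^ 2) A n b := by
  simp only [marg_blockMap, Fin.snoc_last, Fin.snoc_castSucc]
  rw [ENNReal.tsum_comm]
  refine tsum_congr fun k => ENNReal.tsum_comm.trans (Eq.trans ?_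
    ((ENNReal.tsum_prod (f := fun s e => ‖x ((A, n, fun i m => (b i m, k i m)),
      (s, e))‖ₑ ^ 2)).trans ENNReal.tsum_comm).symm)
  refine tsum_congr fun e => ?_
  rw [tsum_blockWeight hP hs, enorm_sq_eq_tsum]
  rfl

theorem blockMap_isTP (hP : P.Valid) (hs : squash.IsTP) :
    IsTPFamily (blockMap (M := M) (ε := ε) P squash j).op := by
  intro x
  change ∑' l : Fin M → (roundMap P squash).index, _ = _
  simp only [enorm_sq_eq_tsum]
  rw [ENNReal.tsum_comm, ← tsum_marg, ← tsum_marg (fun s => ‖x s‖ₑ ^ 2)]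
  refine tsum_congr fun A => tsum_congr fun n => ?_
  rw [tsum_fin_succ_eq]
  exact tsum_congr fun b => tsum_marg_blockMap hP hs x A n b

theorem marg_blockMap_omega (hP : P.Valid) {x : Hilb (Stage J M j.1 ((Fin M → β) × ε))}
    (hx : OmegaFactor P x) {m : Fin M} {A A' : Fin J → Fin M → AReg} (h : SameExcept j m A A')
    (n : Fin J → Fin M → ℕ) (b : Fin (j.1 + 1) → Fin M → BReg) :
    ENNReal.ofReal (P.pJoint (A' j m).1 (n j m)) *
      marg (fun s => ∑' l : Fin M → (roundMap P squash).index,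
        ‖(blockMap (ε := ε) P squash j).op l x s‖ₑ ^ 2) A n b =
    ENNReal.ofReal (P.pJoint (A j m).1 (n j m)) *
      marg (fun s => ∑' l : Fin M → (roundMap P squash).index,
        ‖(blockMap (ε := ε) P squash j).op l x s‖ₑ ^ 2) A' n b := by
  have e : ∀ ω k, ENNReal.ofReal (P.pJoint ω k) = ‖((√(P.pJoint ω k) : ℝ) : ℂ)‖ₑ ^ 2 := by
    intro ω k
    rw [← ofReal_norm_sq, Complex.norm_real, Real.norm_eq_abs, sq_abs,
      Real.sq_sqrt (Params.pJoint_nonneg hP ω k)]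
  simp only [marg_blockMap, e, ← ENNReal.tsum_mul_left, ← blockWeight_smul,
    sigVec_smul_eq hx le_rfl h]

variable {L : Type} {ρ : Op (Stage J M j.1 ((Fin M → β) × ε)) (Stage J M j.1 ((Fin M → β) × ε))}
  {ψ : L → Hilb (Stage J M j.1 ((Fin M → β) × ε))}

theorem Unravels.marg_diag_blockMap (hP : P.Valid) (hs : squash.IsTP) (h : Unravels ρ ψ)
    (A : Fin J → Fin M → AReg) (n : Fin J → Fin M → ℕ) (b : Fin (j.1 + 1) → Fin M → BReg) :
    marg (diag ((blockMap P squash j).map ρ)) A n b =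
      ∑' l, marg (fun s => ∑' k : Fin M → (roundMap P squash).index,
        ‖(blockMap (ε := ε) P squash j).op k (ψ l) s‖ₑ ^ 2) A n b := by
  have h1 : diag ((blockMap P squash j).map ρ) = fun s => ∑' l,
      ∑' k : Fin M → (roundMap P squash).index,
        ‖(blockMap (ε := ε) P squash j).op k (ψ l) s‖ₑ ^ 2 := by
    funext s
    rw [(h.map (blockMap_isTP (j := j) hP hs)).diag_eq]
    refine (ENNReal.tsum_prod (f := fun (k : Fin M → (roundMap P squash).index) l =>
      ‖(blockMap (ε := ε) P squash j).op k (ψ l) s‖ₑ ^ 2)).trans ?_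
    exact ENNReal.tsum_comm
  rw [h1, marg_tsum]

theorem Unravels.tsum_marg_diag_blockMap (hP : P.Valid) (hs : squash.IsTP) (h : Unravels ρ ψ)
    (A : Fin J → Fin M → AReg) (n : Fin J → Fin M → ℕ) (b : Fin j.1 → Fin M → BReg) :
    ∑' b', marg (diag ((blockMap P squash j).map ρ)) A n
      (Fin.snoc (α := fun _ => Fin M → BReg) b b') = marg (diag ρ) A n b := by
  have h1 : diag ρ = fun s => ∑' l, ‖ψ l s‖ₑ ^ 2 := funext h.diag_eq
  simp only [h.marg_diag_blockMap hP hs]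
  rw [ENNReal.tsum_comm, h1, marg_tsum]
  exact tsum_congr fun l => tsum_marg_blockMap hP hs (ψ l) A n b

theorem Unravels.marg_diag_blockMap_omega (hP : P.Valid) (hs : squash.IsTP) (h : Unravels ρ ψ)
    (hψ : ∀ l, OmegaFactor P (ψ l)) {m : Fin M} {A A' : Fin J → Fin M → AReg}
    (hA : SameExcept j m A A') (n : Fin J → Fin M → ℕ) (b : Fin (j.1 + 1) → Fin M → BReg) :
    ENNReal.ofReal (P.pJoint (A' j m).1 (n j m)) * marg (diag ((blockMap P squash j).map ρ)) A n b =
    ENNReal.ofReal (P.pJoint (A j m).1 (n j m)) *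
      marg (diag ((blockMap P squash j).map ρ)) A' n b := by
  simp only [h.marg_diag_blockMap hP hs, ← ENNReal.tsum_mul_left,
    marg_blockMap_omega hP (hψ _) hA]

end Block

variable {P : Params} {β ε : Type} {squash : KrausMap β (Option Bool)} {E : Eve J M β ε}

theorem marg_along {Y Y' L : Type} {j : ℕ} {ρ : Op (Stage J M j Y) (Stage J M j Y)}
    {ψ : L → Hilb (Stage J M j Y)} (h : Unravels ρ ψ) {Φ : KrausMap Y Y'} (hΦ : Φ.IsTP)
    (A : Fin J → Fin M → AReg) (n : Fin J → Fin M → ℕ) (b : Fin j → Fin M → BReg) :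
    marg (diag ((Φ.along (Equiv.prodComm _ Y) (Equiv.prodComm _ Y')).map ρ)) A n b =
      marg (diag ρ) A n b :=
  tsum_congr fun _ => h.tsum_diag_along hΦ _

theorem unravels_stateAfter_zero :
    Unravels (stateAfter P squash E 0 (Nat.zero_le _)) fun _ : Unit => sourceVec P J M := by
  have h : stateAfter P squash E 0 (Nat.zero_le _) = proj (sourceVec P J M) := by
    have h1 : stateAfter P squash E 0 (Nat.zero_le _) = relabel (splitSource J M) ∘L
      tensorPi (fun _ => tensorPi fun _ => proj P.sourceState) ∘L
        relabel (splitSource J M).symm := rfl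
    rw [h1, tensorPi_proj, tensorPi_proj]
    refine op_ext fun s => ?_
    have h2 : relabel (splitSource J M).symm (ket s) = ket ((splitSource J M).symm s) := by
      classical
      refine hilb_ext fun t => ?_
      rw [relabel_apply, ket_apply, ket_apply]
      simp [Equiv.eq_symm_apply]
    simp only [ContinuousLinearMap.comp_apply, proj_apply, map_smul, h2, inner_ket_right]
    rfl
  rw [h]
  exact unravels_proj _

/-- The state in front of the measurement of block `j` is a sum of rank-one operators in whose vectors
the intensity labels of that block and of later ones are still as in the source. -/
theorem exists_unravels_stateAfter (hP : P.Valid) (hs : squash.IsTP) (hE : E.IsTP) :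
    ∀ (j : ℕ) (hj : j ≤ J), ∃ (L : Type) (ψ : L → Hilb (Stage J M j (EveIn J M ε j))),
      Unravels (stateAfter P squash E j hj) ψ ∧ ∀ l, OmegaFactor P (ψ l)
  | 0, hj => ⟨Unit, fun _ => sourceVec P J M, unravels_stateAfter_zero,
      fun _ => omegaFactor_sourceVec hP⟩
  | j + 1, hj => by
    obtain ⟨L, ψ, h, hψ⟩ := exists_unravels_stateAfter hP hs hE j (Nat.le_of_succ_le hj)
    have h1 := h.map (Φ := (E.deliver j).along (Equiv.prodComm _ _) (Equiv.prodComm _ _))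
      ((hE.1 j).family.amplAlong (Equiv.prodComm _ _) (Equiv.prodComm _ _))
    have h2 := h1.map (blockMap_isTP (M := M) (ε := ε) (j := (⟨j, hj⟩ : Fin J)) hP hs)
    exact ⟨_, _, h2, fun l => ((hψ l.2.2).along (E.deliver j) l.2.1).blockMap l.1⟩

/-- The distribution of Alice's labels, photon numbers and Bob's registers after `j` blocks. -/
def qDist (P : Params) {J M : ℕ} {β ε : Type} (squash : KrausMap β (Option Bool)) (E : Eve J M β ε)
    (j : ℕ) (hj : j ≤ J) (A : Fin J → Fin M → AReg) (n : Fin J → Fin M → ℕ)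
    (b : Fin j → Fin M → BReg) : ℝ≥0∞ :=
  marg (diag (stateAfter P squash E j hj)) A n b

/-- What Eve does in front of block `j`, and the measurement of the block, do not change the
distribution of what has been found out before. -/
theorem tsum_qDist_succ (hP : P.Valid) (hs : squash.IsTP) (hE : E.IsTP) (j : ℕ) (hj : j + 1 ≤ J)
    (A : Fin J → Fin M → AReg) (n : Fin J → Fin M → ℕ) (b : Fin j → Fin M → BReg) :
    ∑' b', qDist P squash E (j + 1) hj A n (Fin.snoc (α := fun _ => Fin M → BReg) b b') =
      qDist P squash E j (Nat.le_of_succ_le hj) A n b := by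
  obtain ⟨L, ψ, h, hψ⟩ := exists_unravels_stateAfter hP hs hE j (Nat.le_of_succ_le hj)
  have h1 := h.map (Φ := (E.deliver j).along (Equiv.prodComm _ _) (Equiv.prodComm _ _))
    ((hE.1 j).family.amplAlong (Equiv.prodComm _ _) (Equiv.prodComm _ _))
  have h2 := h1.tsum_marg_diag_blockMap (j := (⟨j, hj⟩ : Fin J)) hP hs A n b
  have h3 := marg_along h (hE.1 j) A n b
  exact h2.trans h3

/-- After the measurement of block `j`, the intensity of one of its rounds is independent of
everything except the photon number of the round. -/
theorem qDist_omega (hP : P.Valid) (hs : squash.IsTP) (hE : E.IsTP) (j : ℕ) (hj : j < J)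
    {m : Fin M} {A A' : Fin J → Fin M → AReg} (hA : SameExcept ⟨j, hj⟩ m A A')
    (n : Fin J → Fin M → ℕ) (b : Fin (j + 1) → Fin M → BReg) :
    ENNReal.ofReal (P.pJoint (A' ⟨j, hj⟩ m).1 (n ⟨j, hj⟩ m)) * qDist P squash E (j + 1) hj A n b =
    ENNReal.ofReal (P.pJoint (A ⟨j, hj⟩ m).1 (n ⟨j, hj⟩ m)) *
      qDist P squash E (j + 1) hj A' n b := by
  obtain ⟨L, ψ, h, hψ⟩ := exists_unravels_stateAfter hP hs hE j (Nat.le_of_succ_le hj)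
  have h1 := h.map (Φ := (E.deliver j).along (Equiv.prodComm _ _) (Equiv.prodComm _ _))
    ((hE.1 j).family.amplAlong (Equiv.prodComm _ _) (Equiv.prodComm _ _))
  exact h1.marg_diag_blockMap_omega (j := (⟨j, hj⟩ : Fin J)) hP hs
    (fun l => (hψ l.2).along (E.deliver j) l.1) hA n b

theorem tsum_qDist_zero (hP : P.Valid) :
    ∑' (A) (n) (b), qDist P squash E 0 (Nat.zero_le _) A n b = 1 := by
  unfold qDist
  rw [tsum_marg, ← enorm_sq_sourceVec (J := J) (M := M) hP, enorm_sq_eq_tsum]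
  refine tsum_congr fun s => ?_
  rw [unravels_stateAfter_zero.diag_eq, tsum_fintype]
  simp

theorem marg_rhoVir (hP : P.Valid) (hs : squash.IsTP) (hE : E.IsTP)
    (A : Fin J → Fin M → AReg) (n : Fin J → Fin M → ℕ) (b : Fin J → Fin M → BReg) :
    marg (diag (rhoVir P squash E)) A n b = qDist P squash E J le_rfl A n b := by
  obtain ⟨L, ψ, h, hψ⟩ := exists_unravels_stateAfter hP hs hE J le_rfl
  exact marg_along h hE.2 A n b

theorem exists_unravels_rhoVir (hP : P.Valid) (hs : squash.IsTP) (hE : E.IsTP) :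
    ∃ (L : Type) (ψ : L → Hilb (Stage J M J ε)), Unravels (rhoVir P squash E) ψ := by
  obtain ⟨L, ψ, h, hψ⟩ := exists_unravels_stateAfter hP hs hE J le_rfl
  exact ⟨_, _, h.map (Φ := E.final.along (Equiv.prodComm _ _) (Equiv.prodComm _ _))
    (hE.2.family.amplAlong (Equiv.prodComm _ _) (Equiv.prodComm _ _))⟩

end Stage

/-! ### The final measurement -/

/-- The expectation value of the operator `T`. -/
def quad {σ : Type} (T : Op σ σ) (x : Hilb σ) : ℝ := (inner ℂ x (T x)).re

theorem quad_sum {σ X : Type} (s : Finset X) (T : X → Op σ σ) (x : Hilb σ) :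
    quad (∑ i ∈ s, T i) x = ∑ i ∈ s, quad (T i) x := by
  simp only [quad, _root_.sum_apply, inner_sum, Complex.re_sum]

theorem quad_proj {σ : Type} (v x : Hilb σ) : quad (proj v) x = ‖inner ℂ v x‖ ^ 2 := by
  rw [quad, inner_proj_self, Complex.ofReal_re]

theorem quad_proj_ket {σ : Type} (s : σ) (x : Hilb σ) : quad (proj (ket s)) x = ‖x s‖ ^ 2 := by
  rw [quad_proj, inner_ket_left]

/-- The expectation value of `T ⊗ 1` is a sum over the labels of the other system. -/
theorem hasSum_quad_amplAlong {ι γ σ : Type} (e : σ ≃ ι × γ) (T : Op ι ι) (x : Hilb σ) :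
    HasSum (fun g => quad T (comap (fun i => e.symm (i, g)) (symm_mk_injective e g) x))
      (quad (amplAlong e e T) x) := by
  have h : HasSum (fun i => inner ℂ (x i) (amplAlong e e T x i)) (inner ℂ x (amplAlong e e T x)) :=
    lp.hasSum_inner x _
  have h1 := ((Equiv.prodComm γ ι).trans e.symm).hasSum_iff.2 h
  have h2 : HasSum (fun g => inner ℂ (comap (fun i => e.symm (i, g)) (symm_mk_injective e g) x)
      (T (comap (fun i => e.symm (i, g)) (symm_mk_injective e g) x)))
      (inner ℂ x (amplAlong e e T x)) := h1.prod_fiberwise fun g => by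
    set y := comap (fun i => e.symm (i, g)) (symm_mk_injective e g) x
    have h3 : HasSum (fun i => inner ℂ (y i) (T y i)) (inner ℂ y (T y)) := lp.hasSum_inner y _
    convert h3 using 2 with i
    change inner ℂ (x (e.symm (i, g))) (amplAlong e e T x (e.symm (i, g))) = _
    rw [amplAlong_apply]
    simp only [Equiv.apply_symm_apply]
    rfl
  exact Complex.hasSum_re h2

/-- The label of an outcome in which only the click is kept of `e_X`. -/
def core (o : Outcome) : Outcome := { o with e := o.e.map fun _ => false }

/-- The outcome, up to the bit `e_X`, that belongs to the labels of a round. -/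
def labOf (s : AReg × ℕ × BReg) : Outcome :=
  ⟨s.2.1, s.1.1, s.1.2.1, s.2.2.1, s.2.2.2.map fun _ => false⟩

open Classical in
/-- The outcomes with a given core. -/
def coreFiber (c : Outcome) : Finset Outcome :=
  match c.e with
  | none => {c}
  | some false => Finset.univ.image fun e : Bool => { c with e := some e }
  | some true => ∅

theorem mem_coreFiber {o c : Outcome} : o ∈ coreFiber c ↔ core o = c := by
  obtain ⟨n, ω, α, β, _ | _ | _⟩ := c <;> obtain ⟨n', ω', α', β', _ | _ | _⟩ := o <;>
    simp [coreFiber, core, eq_comm]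

open Classical in
/-- The labels of a round with a given core. -/
def labFiber (c : Outcome) : Finset (AReg × ℕ × BReg) :=
  match c.e with
  | none => Finset.univ.image fun a : Bool => ((c.ω, c.α, a), c.n, (c.β, none))
  | some false =>
    Finset.univ.image fun p : Bool × Bool => ((c.ω, c.α, p.1), c.n, (c.β, some p.2))
  | some true => ∅

theorem mem_labFiber {s : AReg × ℕ × BReg} {c : Outcome} : s ∈ labFiber c ↔ labOf s = c := by
  obtain ⟨n, ω, α, β, _ | _ | _⟩ := c <;>
    obtain ⟨⟨ω', α', _ | _⟩, n', β', _ | _ | _⟩ := s <;>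
    simp [labFiber, labOf] <;> grind

/-- When the bit `e_X` is forgotten, the measurement of a round only finds out labels: the
`X`-measurement of the two qubits has complete sets of outcomes. -/
theorem sum_roundPOVM (c : Outcome) :
    ∑ o ∈ coreFiber c, roundPOVM o = ∑ s ∈ labFiber c, proj (ket s) := by
  obtain ⟨n, ω, α, β, _ | _ | _⟩ := c
  · simp only [coreFiber, labFiber, Finset.sum_singleton]
    rw [Finset.sum_image fun a _ a' _ h => congrArg (fun s => s.1.2.2) h]
    rfl
  · simp only [coreFiber, labFiber]
    classical
    rw [Finset.sum_image (f := roundPOVM) (g := fun e : Bool => (⟨n, ω, α, β, some e⟩ : Outcome))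
        fun e _ e' _ h => Option.some.inj (congrArg Outcome.e h),
      Finset.sum_image (f := fun s => proj (ket s))
        (g := fun p : Bool × Bool => (((ω, α, p.1), n, (β, some p.2)) : AReg × ℕ × BReg))
        fun p _ p' _ h => Prod.ext (congrArg (fun s => s.1.2.2) h)
        (Option.some.inj (congrArg (fun s => s.2.2.2) h))]
    ext1 y
    simp only [roundPOVM, Fintype.sum_prod_type, Fintype.sum_bool, sgn, Bool.and_true,
      Bool.and_false, Bool.xor_true, Bool.xor_false, Bool.not_true, Bool.not_false,
      Bool.false_eq_true, if_true, if_false]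
    simp only [_root_.add_apply, _root_.smul_apply, proj_apply, inner_add_left, inner_smul_left,
      map_neg, map_one]
    module
  · rfl

/-- The POVM element of one round is a sum of two projectors. -/
theorem exists_roundPOVM_eq (o : Outcome) :
    ∃ u : Bool → Hilb (AReg × ℕ × BReg), roundPOVM o = ∑ x, proj (u x) := by
  obtain ⟨n, ω, α, β, _ | e⟩ := o
  · exact ⟨_, rfl⟩
  · refine ⟨fun x => (1 / 2 : ℂ) • ∑ a : Bool, ∑ b : Bool,
      sgn (xor (a && x) (b && xor x e)) • ket ((ω, α, a), n, (β, some b)), ?_⟩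
    simp only [roundPOVM]
    rw [Finset.smul_sum]
    refine Finset.sum_congr rfl fun x _ => ?_
    ext1 y
    rw [_root_.smul_apply, proj_apply, proj_apply, inner_smul_left, smul_smul,
      smul_smul]
    congr 1
    have : (starRingEnd ℂ) (1 / 2 : ℂ) = 1 / 2 := by rw [map_div₀, map_one, map_ofNat]
    rw [this]
    ring

section Final

variable {J M : ℕ}

/-- The measurement operator of an outcome of all rounds, on the measured systems. -/
def allPOVM (o : Fin J → Fin M → Outcome) :
    Op (Fin J → Fin M → AReg × ℕ × BReg) (Fin J → Fin M → AReg × ℕ × BReg) :=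
  tensorPi fun j => tensorPi fun m => roundPOVM (o j m)

theorem quad_allPOVM_nonneg (o : Fin J → Fin M → Outcome)
    (x : Hilb (Fin J → Fin M → AReg × ℕ × BReg)) : 0 ≤ quad (allPOVM o) x := by
  choose u hu using exists_roundPOVM_eq
  simp only [allPOVM, hu, tensorPi_sum, tensorPi_proj, quad_sum, quad_proj]
  exact Finset.sum_nonneg fun _ _ => sq_nonneg _

/-- The measurement of all rounds without the bits `e_X` only finds out labels. -/
theorem sum_allPOVM (c : Fin J → Fin M → Outcome) :
    ∑ o ∈ Fintype.piFinset fun j => Fintype.piFinset fun m => coreFiber (c j m), allPOVM o =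
      ∑ s ∈ Fintype.piFinset fun j => Fintype.piFinset fun m => labFiber (c j m),
        proj (ket s) := by
  unfold allPOVM
  rw [← tensorPi_sum (fun j => Fintype.piFinset fun m => coreFiber (c j m))
    fun j o => tensorPi fun m => roundPOVM (o m)]
  simp only [← tensorPi_sum (fun m => coreFiber (c _ m)) fun m o => roundPOVM o, sum_roundPOVM]
  simp only [tensorPi_sum, tensorPi_proj, ← ket_eq_tensorVec]

theorem quad_finalPOVM_nonneg {ε : Type} (o : Fin J → Fin M → Outcome)
    (x : Hilb (Stage J M J ε)) : 0 ≤ quad (finalPOVM ε o) x :=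
  (hasSum_quad_amplAlong _ _ x).nonneg fun _ => quad_allPOVM_nonneg o _

open Classical in
/-- The outcomes with the core `c` have the total weight of the labels that belong to `c`. -/
theorem sum_quad_finalPOVM {ε : Type} (c : Fin J → Fin M → Outcome) (x : Hilb (Stage J M J ε)) :
    ∑ o ∈ Fintype.piFinset fun j => Fintype.piFinset fun m => coreFiber (c j m),
        ENNReal.ofReal (quad (finalPOVM ε o) x) =
      ∑' s : Stage J M J ε, if (fun j m => labOf (s.1.1 j m, s.1.2.1 j m, (s.1.2.2 j m).1)) = c
        then ‖x s‖ₑ ^ 2 else 0 := by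
  set e := splitFinal J M ε
  have h1 : ∀ o, ENNReal.ofReal (quad (finalPOVM ε o) x) =
      ∑' g, ENNReal.ofReal (quad (allPOVM o)
        (comap (fun i => e.symm (i, g)) (symm_mk_injective e g) x)) := by
    intro o
    have h := hasSum_quad_amplAlong e (allPOVM o) x
    rw [← ENNReal.ofReal_tsum_of_nonneg (fun _ => quad_allPOVM_nonneg o _) h.summable, h.tsum_eq]
    rfl
  simp only [h1]
  rw [← Summable.tsum_finsetSum fun _ _ => ENNReal.summable]
  rw [← e.symm.tsum_eq, ENNReal.tsum_prod (f := fun i g =>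
    if (fun j m => labOf ((e.symm (i, g)).1.1 j m, (e.symm (i, g)).1.2.1 j m,
      ((e.symm (i, g)).1.2.2 j m).1)) = c then ‖x (e.symm (i, g))‖ₑ ^ 2 else 0), ENNReal.tsum_comm]
  refine tsum_congr fun g => ?_
  rw [← ENNReal.ofReal_sum_of_nonneg fun _ _ => quad_allPOVM_nonneg _ _, ← quad_sum, sum_allPOVM,
    quad_sum]
  simp only [quad_proj_ket]
  rw [ENNReal.ofReal_sum_of_nonneg fun _ _ => sq_nonneg _]
  simp only [ofReal_norm_sq, comap_apply]
  have hmem : ∀ s : Fin J → Fin M → AReg × ℕ × BReg,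
      (s ∈ Fintype.piFinset fun j => Fintype.piFinset fun m => labFiber (c j m)) ↔
        (fun j m => labOf (s j m)) = c := by
    intro s
    simp [Fintype.mem_piFinset, mem_labFiber, funext_iff]
  rw [tsum_eq_sum (s := Fintype.piFinset fun j => Fintype.piFinset fun m => labFiber (c j m))]
  · exact Finset.sum_congr rfl fun s hs => (if_pos ((hmem s).1 hs)).symm
  · exact fun s hs => if_neg fun h => hs ((hmem s).2 h)

theorem tsum_eq_tsum_tsum_ite {X C : Type} [DecidableEq C] (f : X → ℝ≥0∞) (g : X → C) :
    ∑' x, f x = ∑' c, ∑' x, if g x = c then f x else 0 := by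
  rw [ENNReal.tsum_comm]
  refine tsum_congr fun x => ?_
  rw [tsum_ite_eq' (g x)]

open Classical in
/-- The probability of an event that does not depend on the bits `e_X` is read off from the diagonal
of the state. -/
theorem prEvent_eq_tsum_marg {P : Params} (hP : P.Valid) {β ε : Type}
    {squash : KrausMap β (Option Bool)} (hs : squash.IsTP) {E : Eve J M β ε} (hE : E.IsTP)
    {S : Set (Fin J → Fin M → Outcome)} (hS : ∀ o, o ∈ S ↔ (fun j m => core (o j m)) ∈ S) :
    prEvent P squash E S = ∑' (A : Fin J → Fin M → AReg) (n : Fin J → Fin M → ℕ)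
      (b : Fin J → Fin M → BReg), if (fun j m => labOf (A j m, n j m, b j m)) ∈ S then
        qDist P squash E J le_rfl A n b else 0 := by
  obtain ⟨L, ψ, h⟩ := exists_unravels_rhoVir (P := P) (squash := squash) (E := E) hP hs hE
  have h1 : ∀ o, ENNReal.ofReal (prOutcome P squash E o) =
      ∑' l, ENNReal.ofReal (quad (finalPOVM ε o) (ψ l)) := by
    intro o
    have h2 := Complex.hasSum_re (h.hasSum_tr (finalPOVM ε o))
    have h3 : HasSum (fun l => quad (finalPOVM ε o) (ψ l)) (prOutcome P squash E o) := h2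
    rw [← h3.tsum_eq, ENNReal.ofReal_tsum_of_nonneg (fun _ => quad_finalPOVM_nonneg o _)
      h3.summable]
  set lab : Stage J M J ε → Fin J → Fin M → Outcome :=
    fun s j m => labOf (s.1.1 j m, s.1.2.1 j m, (s.1.2.2 j m).1)
  have h4 : ∀ c, ∑ o ∈ Fintype.piFinset fun j => Fintype.piFinset fun m => coreFiber (c j m),
      ENNReal.ofReal (prOutcome P squash E o) =
        ∑' s, if lab s = c then diag (rhoVir P squash E) s else 0 := by
    intro c
    simp only [h1]
    rw [← Summable.tsum_finsetSum fun _ _ => ENNReal.summable]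
    simp only [sum_quad_finalPOVM, h.diag_eq]
    rw [ENNReal.tsum_comm]
    refine tsum_congr fun s => ?_
    by_cases hc : lab s = c
    · simp [hc, lab]
    · simp [hc, lab]
  calc prEvent P squash E S = ∑' o, if o ∈ S then ENNReal.ofReal (prOutcome P squash E o) else 0 := by
        unfold prEvent
        rw [tsum_subtype S fun o => ENNReal.ofReal (prOutcome P squash E o)]
        rfl
    _ = ∑' c, if c ∈ S then
          ∑ o ∈ Fintype.piFinset fun j => Fintype.piFinset fun m => coreFiber (c j m),
            ENNReal.ofReal (prOutcome P squash E o) else 0 := by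
        rw [tsum_eq_tsum_tsum_ite _ fun (o : Fin J → Fin M → Outcome) j m => core (o j m)]
        refine tsum_congr fun c => ?_
        have hmem : ∀ o : Fin J → Fin M → Outcome,
            (o ∈ Fintype.piFinset fun j => Fintype.piFinset fun m => coreFiber (c j m)) ↔
              (fun j m => core (o j m)) = c := by
          intro o
          simp [Fintype.mem_piFinset, mem_coreFiber, funext_iff]
        rw [tsum_eq_sum (s := Fintype.piFinset fun j => Fintype.piFinset fun m =>
          coreFiber (c j m))]
        · by_cases hc : c ∈ S
          · rw [if_pos hc]
            refine Finset.sum_congr rfl fun o ho => ?_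
            have ho' := (hmem o).1 ho
            rw [if_pos ho', if_pos ((hS o).2 (ho' ▸ hc))]
          · rw [if_neg hc]
            refine Finset.sum_eq_zero fun o ho => ?_
            have ho' := (hmem o).1 ho
            rw [if_pos ho', if_neg fun h => hc (ho' ▸ (hS o).1 h)]
        · exact fun o ho => if_neg fun h => ho ((hmem o).2 h)
    _ = ∑' s, if lab s ∈ S then diag (rhoVir P squash E) s else 0 := by
        rw [tsum_eq_tsum_tsum_ite _ lab]
        refine tsum_congr fun c => ?_
        rw [h4]
        by_cases hc : c ∈ S
        · rw [if_pos hc]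
          refine tsum_congr fun s => ?_
          by_cases h : lab s = c
          · rw [if_pos h, if_pos h, if_pos (h ▸ hc)]
          · rw [if_neg h, if_neg h]
        · rw [if_neg hc]
          symm
          refine ENNReal.tsum_eq_zero.2 fun s => ?_
          by_cases h : lab s = c
          · rw [if_pos h, if_neg (h ▸ hc)]
          · rw [if_neg h]
    _ = _ := by
        rw [← tsum_marg]
        refine tsum_congr fun A => tsum_congr fun n => tsum_congr fun b => ?_
        rw [← marg_rhoVir hP hs hE]
        unfold marg
        by_cases h : (fun j m => labOf (A j m, n j m, b j m)) ∈ S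
        · rw [if_pos h]
          exact tsum_congr fun k => tsum_congr fun y => if_pos h
        · rw [if_neg h]
          exact ENNReal.tsum_eq_zero.2 fun k => ENNReal.tsum_eq_zero.2 fun y => if_neg h

end Final

open MeasureTheory

/-! ### The decoy-state inequality and the explicit bound -/

namespace Params

variable {P : Params}

theorem μS_pos (hP : P.Valid) : 0 < P.μ S := hP.μD_pos.trans hP.μD_lt

theorem pJoint_zero_pos (hP : P.Valid) (ω : Intensity) : 0 < P.pJoint ω 0 := by
  have := hP.pInt_pos ω
  unfold pJoint pCS
  rw [pow_zero]
  positivity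

/-- The ratio of the Poisson weights of `n` photons and of none. -/
theorem pJoint_eq (ω : Intensity) (n : ℕ) :
    P.pJoint ω n = P.pJoint ω 0 * (P.μ ω ^ n / n.factorial) := by
  simp only [pJoint, pCS, pow_zero, Nat.factorial_zero, Nat.cast_one, div_one, one_mul]
  ring

theorem sum_pJoint_pos (hP : P.Valid) (n : ℕ) : 0 < ∑ ω, P.pJoint ω n := by
  refine Finset.sum_pos' (fun ω _ => pJoint_nonneg hP ω n) ⟨S, Finset.mem_univ _, ?_⟩
  have := pJoint_zero_pos hP S
  have := μS_pos hP
  rw [pJoint_eq]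
  positivity

/-- The positive number that the condition on the intensities is about. -/
theorem decoyGap_pos (hP : P.Valid) : 0 < -(P.μ D ^ 2 / P.μ S ^ 2) * P.μ S + P.μ D - P.μ V := by
  have hS := μS_pos hP
  have h := hP.μV_lt
  have : -(P.μ D ^ 2 / P.μ S ^ 2) * P.μ S + P.μ D = P.μ D * (P.μ S - P.μ D) / P.μ S := by
    field_simp
    ring
  linarith

theorem decoyFactor_eq (hP : P.Valid) : P.decoyFactor =
    (-(P.μ D ^ 2 / P.μ S ^ 2) * P.μ S + P.μ D - P.μ V) / ∑ ω, P.pJoint ω 1 := by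
  have h : ∀ ω, P.pCond ω 1 / P.pJoint ω 0 = P.μ ω / ∑ ω, P.pJoint ω 1 := by
    intro ω
    rw [pCond, pJoint_eq ω 1, Nat.factorial_one, Nat.cast_one, div_one, pow_one, div_right_comm,
      mul_div_cancel_left₀ _ (pJoint_zero_pos hP ω).ne']
  rw [decoyFactor, h, h, h]
  ring

theorem decoyFactor_pos (hP : P.Valid) : 0 < P.decoyFactor := by
  rw [decoyFactor_eq hP]
  exact div_pos (decoyGap_pos hP) (sum_pJoint_pos hP 1)

theorem lam_nonpos (hP : P.Valid) : P.lam ≤ 0 := by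
  have h1 := inv_pos.2 (decoyFactor_pos hP)
  have h2 := pJoint_zero_pos hP S
  have : 0 ≤ P.decoyFactor⁻¹ * (1 / P.pJoint S 0) * (P.μ D ^ 2 / P.μ S ^ 2) := by positivity
  unfold lam
  linarith

theorem zeta_nonneg (hP : P.Valid) : 0 ≤ P.zeta := by
  have h1 := inv_pos.2 (decoyFactor_pos hP)
  have h2 := pJoint_zero_pos hP D
  unfold zeta
  positivity

theorem gam_nonpos (hP : P.Valid) : P.gam ≤ 0 := by
  have h1 := inv_pos.2 (decoyFactor_pos hP)
  have h2 := pJoint_zero_pos hP V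
  have : 0 ≤ P.decoyFactor⁻¹ * (1 / P.pJoint V 0) := by positivity
  unfold gam
  linarith

theorem decoy_combination_eq (hP : P.Valid) (n : ℕ) :
    P.lam * P.pJoint S n + P.zeta * P.pJoint D n + P.gam * P.pJoint V n =
      P.decoyFactor⁻¹ / n.factorial *
        (-(P.μ D ^ 2 / P.μ S ^ 2) * P.μ S ^ n + P.μ D ^ n - P.μ V ^ n) := by
  have hS := (pJoint_zero_pos hP S).ne'
  have hD := (pJoint_zero_pos hP D).ne'
  have hV := (pJoint_zero_pos hP V).ne'
  have hμ := (μS_pos hP).ne'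
  have hf := (decoyFactor_pos hP).ne'
  rw [pJoint_eq S, pJoint_eq D, pJoint_eq V, lam, zeta, gam]
  field_simp
  ring

/-- The decoy-state inequality: the combination `λ, ζ, γ` of the intensities counts single-photon
emissions with weight one and other emissions with weight at most zero. -/
theorem decoy_combination_le (hP : P.Valid) (n : ℕ) :
    P.lam * P.pJoint S n + P.zeta * P.pJoint D n + P.gam * P.pJoint V n ≤
      if n = 1 then ∑ ω, P.pJoint ω n else 0 := by
  rw [decoy_combination_eq hP]
  have hf := decoyFactor_pos hP
  have hS := μS_pos hP
  split_ifs with h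
  · subst h
    have hg := decoyGap_pos hP
    rw [decoyFactor_eq hP, Nat.factorial_one, Nat.cast_one, div_one, inv_div, pow_one, pow_one,
      pow_one, div_mul_cancel₀ _ hg.ne']
  · refine mul_nonpos_of_nonneg_of_nonpos (by positivity) ?_
    obtain _ | _ | n := n
    · simp only [pow_zero]
      have : 0 ≤ P.μ D ^ 2 / P.μ S ^ 2 := by positivity
      linarith
    · exact absurd rfl h
    · have h1 : -(P.μ D ^ 2 / P.μ S ^ 2) * P.μ S ^ (n + 1 + 1) = -(P.μ D ^ 2 * P.μ S ^ n) := by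
        rw [add_assoc, one_add_one_eq_two, pow_add]
        field_simp
      have h2 : P.μ D ^ n ≤ P.μ S ^ n := pow_le_pow_left₀ hP.μD_pos.le hP.μD_lt.le n
      have h3 := mul_le_mul_of_nonneg_left h2 (sq_nonneg (P.μ D))
      have h4 := pow_nonneg hP.μV_nonneg (n + 1 + 1)
      have h5 : P.μ D ^ (n + 1 + 1) = P.μ D ^ 2 * P.μ D ^ n := by ring
      rw [h1, h5]
      linarith

end Params

/-- The relation of Kato's inequality between the coefficients `a` and `b` holds whenever `b` is
computed from `a` as in `bK` or `bK'`, no matter what `a` is. -/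
theorem sq_sqrt_div_eq {s ε : ℝ} (hs : 0 < s) (hε : 0 < ε) (hε1 : ε < 1) (a : ℝ) :
    (√(18 * a ^ 2 * s - (16 * a ^ 2 + 24 * a * √s + 9 * s) * Real.log ε) / (3 * √(2 * s))) ^ 2 =
      a ^ 2 + -Real.log ε / 2 * (1 + 4 * a / (3 * √s)) ^ 2 := by
  have hl := Real.log_neg hε hε1
  have hr : 0 < √s := Real.sqrt_pos.2 hs
  have hrr : √s ^ 2 = s := Real.sq_sqrt hs.le
  have hX : 18 * a ^ 2 * s - (16 * a ^ 2 + 24 * a * √s + 9 * s) * Real.log ε =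
      18 * a ^ 2 * s + (4 * a + 3 * √s) ^ 2 * -Real.log ε := by
    linear_combination 9 * Real.log ε * hrr
  have h0 : 0 ≤ -Real.log ε := by linarith
  rw [hX, div_pow, Real.sq_sqrt (by positivity), mul_pow, Real.sq_sqrt (by positivity)]
  nth_rewrite 1 3 [← hrr]
  field_simp
  ring

theorem bK_sq {s ε : ℝ} (hs : 0 < s) (hε : 0 < ε) (hε1 : ε < 1) (t : ℝ) :
    bK s t ε ^ 2 = aK s t ε ^ 2 + -Real.log ε / 2 * (1 + 4 * aK s t ε / (3 * √s)) ^ 2 :=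
  sq_sqrt_div_eq hs hε hε1 _

theorem bK'_sq {s ε : ℝ} (hs : 0 < s) (hε : 0 < ε) (hε1 : ε < 1) (t : ℝ) :
    bK' s t ε ^ 2 =
      (-aK' s t ε) ^ 2 + -Real.log ε / 2 * (1 + 4 * -aK' s t ε / (3 * √s)) ^ 2 := by
  rw [← sq_sqrt_div_eq hs hε hε1, bK']
  congr 3
  ring

theorem bK_nonneg (s t ε : ℝ) : 0 ≤ bK s t ε := by
  unfold bK
  positivity

theorem bK'_nonneg (s t ε : ℝ) : 0 ≤ bK' s t ε := by
  unfold bK'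
  positivity

/-- The explicit lower bound follows from the four concentration bounds between the counts `c` and
the sums `T` of conditional probabilities, and from the decoy-state inequality for these sums. The
bound for `D` concerns the rounds that are not counted. -/
theorem lowerN1Z_le {P : Params} (hP : P.Valid) {N : ℝ} (hN : 0 < N) {c1 T1 t1 εs : ℝ}
    {c T t : Intensity → ℝ} (hc1 : 0 ≤ c1)
    (h1 : T1 - c1 ≤
      (bK N t1 (εs ^ 2 / 32) + aK N t1 (εs ^ 2 / 32) * (2 * c1 / N - 1)) * √N)
    (hS : T S - c S ≤
      (bK N (t S) (εs ^ 2 / 32) + aK N (t S) (εs ^ 2 / 32) * (2 * c S / N - 1)) * √N)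
    (hV : T V - c V ≤
      (bK N (t V) (εs ^ 2 / 32) + aK N (t V) (εs ^ 2 / 32) * (2 * c V / N - 1)) * √N)
    (hD : N - T D - (N - c D) ≤
      (bK' N (t D) (εs ^ 2 / 32) + -aK' N (t D) (εs ^ 2 / 32) * (2 * (N - c D) / N - 1)) * √N)
    (hT : P.lam * T S + P.zeta * T D + P.gam * T V ≤ T1) :
    P.lowerN1Z N c t t1 εs ≤ c1 := by
  unfold Params.lowerN1Z
  set δ := εs ^ 2 / 32
  have hr : 0 < √N := Real.sqrt_pos.2 hN
  have hrr : √N ^ 2 = N := Real.sq_sqrt hN.le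
  have key : ∀ a b x : ℝ, (b + a * (2 * x / N - 1)) * √N =
      x * (1 + a * (2 / √N)) + (b - a) * √N - x := by
    intro a b x
    have : x / N * √N = x / √N := by
      nth_rewrite 1 [← hrr]
      field_simp
    linear_combination 2 * a * this
  have keyD : 2 * (N - c D) / N - 1 = -(2 * c D / N - 1) := by
    field_simp
    ring
  rw [key] at h1 hS hV
  rw [keyD, neg_mul_neg] at hD
  dsimp only
  split_ifs with ha
  · have hpos : 0 < 1 + aK N t1 δ * (2 / √N) := by
      have h := mul_lt_mul_of_pos_right ha (div_pos two_pos hr)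
      have h' : -√N / 2 * (2 / √N) = -1 := by field_simp
      linarith
    rw [inv_mul_le_iff₀ hpos]
    have eS := mul_le_mul_of_nonpos_left
      (show T S ≤ c S * (1 + aK N (t S) δ * (2 / √N)) + (bK N (t S) δ - aK N (t S) δ) * √N by
        linarith) (Params.lam_nonpos hP)
    have eV := mul_le_mul_of_nonpos_left
      (show T V ≤ c V * (1 + aK N (t V) δ * (2 / √N)) + (bK N (t V) δ - aK N (t V) δ) * √N by
        linarith) (Params.gam_nonpos hP)
    have eD := mul_le_mul_of_nonneg_left
      (show c D - (bK' N (t D) δ + aK' N (t D) δ * (2 * c D / N - 1)) * √N ≤ T D by linarith)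
      (Params.zeta_nonneg hP)
    linarith
  · exact hc1

section Concentration

variable {Ω : Type*} {m0 : MeasurableSpace Ω} {μ : Measure Ω} [IsProbabilityMeasure μ]
  {ℱ : Filtration ℕ m0} {η : ℕ → Ω → ℝ} {ξ : Intensity → ℕ → Ω → ℝ}

theorem integrable_of_zero_or_one (h01 : ∀ k s, η k s = 0 ∨ η k s = 1)
    (hη : ∀ k, StronglyMeasurable[ℱ (k + 1)] (η k)) (k : ℕ) : Integrable (η k) μ := by
  refine Integrable.of_bound ((hη k).mono (ℱ.le _)).aestronglyMeasurable 1 (ae_of_all _ fun s => ?_)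
  rcases h01 k s with h | h <;> simp [h]

/-- The lower bound for counts of a general adapted process whose conditional probabilities satisfy
the decoy-state inequality. -/
theorem measure_lt_lowerN1Z_lt {P : Params} (hP : P.Valid) {N : ℕ} (hN : 0 < N) {εs : ℝ}
    (hε : 0 < εs) (hε1 : εs ≤ 1) (t : Intensity → ℝ) (t1 : ℝ)
    (h01 : ∀ k s, η k s = 0 ∨ η k s = 1) (hη : ∀ k, StronglyMeasurable[ℱ (k + 1)] (η k))
    (hξ01 : ∀ ω k s, ξ ω k s = 0 ∨ ξ ω k s = 1)
    (hξ : ∀ ω k, StronglyMeasurable[ℱ (k + 1)] (ξ ω k))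
    (hcond : ∀ k, ∀ᵐ s ∂μ, P.lam * (μ[ξ S k|ℱ k]) s + P.zeta * (μ[ξ D k|ℱ k]) s +
      P.gam * (μ[ξ V k|ℱ k]) s ≤ (μ[η k|ℱ k]) s) :
    μ {s | ∑ k ∈ Finset.range N, η k s <
        P.lowerN1Z N (fun ω => ∑ k ∈ Finset.range N, ξ ω k s) t t1 εs} <
      ENNReal.ofReal (εs ^ 2 / 8) := by
  set δ := εs ^ 2 / 32 with hδ
  have hδ0 : 0 < δ := by positivity
  have hδ1 : δ < 1 := by
    have : εs ^ 2 ≤ 1 := pow_le_one₀ hε.le hε1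
    linarith
  have hN' : (0 : ℝ) < N := Nat.cast_pos.2 hN
  have hL : 0 < -Real.log δ := neg_pos.2 (Real.log_neg hδ0 hδ1)
  have hexp : Real.exp (- -Real.log δ) = δ := by rw [neg_neg, Real.exp_log hδ0]
  have hμ : μ.real Set.univ ≤ 1 := by simp
  have hD01 : ∀ k s, (1 - ξ D k) s = 0 ∨ (1 - ξ D k) s = 1 := by
    intro k s
    rcases hξ01 D k s with h | h <;> simp [h]
  have hDm : ∀ k, StronglyMeasurable[ℱ (k + 1)] (1 - ξ D k) := fun k =>
    stronglyMeasurable_one.sub (hξ D k)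
  have k1 := kato_inequality (μ := μ) hμ h01 hη hN hL (bK_nonneg N t1 δ) (bK_sq hN' hδ0 hδ1 t1)
  have kS := kato_inequality (μ := μ) hμ (hξ01 S) (hξ S) hN hL (bK_nonneg N (t S) δ)
    (bK_sq hN' hδ0 hδ1 (t S))
  have kV := kato_inequality (μ := μ) hμ (hξ01 V) (hξ V) hN hL (bK_nonneg N (t V) δ)
    (bK_sq hN' hδ0 hδ1 (t V))
  have kD := kato_inequality (μ := μ) hμ hD01 hDm hN hL (bK'_nonneg N (t D) δ)
    (bK'_sq hN' hδ0 hδ1 (t D))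
  rw [hexp] at k1 kS kV kD
  set B1 := {s | _ < ∑ k ∈ Finset.range N, (μ[η k|ℱ k]) s - _}
  set BS := {s | _ < ∑ k ∈ Finset.range N, (μ[ξ S k|ℱ k]) s - _}
  set BV := {s | _ < ∑ k ∈ Finset.range N, (μ[ξ V k|ℱ k]) s - _}
  set BD := {s | _ < ∑ k ∈ Finset.range N, (μ[1 - ξ D k|ℱ k]) s - _}
  have hsub : ∀ᵐ s ∂μ, ∑ k ∈ Finset.range N, η k s <
      P.lowerN1Z N (fun ω => ∑ k ∈ Finset.range N, ξ ω k s) t t1 εs →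
        s ∈ B1 ∪ BS ∪ BV ∪ BD := by
    have hcD : ∀ k, ∀ᵐ s ∂μ, (μ[1 - ξ D k|ℱ k]) s = 1 - (μ[ξ D k|ℱ k]) s := by
      intro k
      have h := condExp_sub (μ := μ) (f := (1 : Ω → ℝ)) (integrable_const 1)
        (integrable_of_zero_or_one (hξ01 D) (hξ D) k) (ℱ k)
      filter_upwards [h] with s hs
      rw [hs, Pi.sub_apply]
      congr 1
      exact congrFun (condExp_const (ℱ.le k) (1 : ℝ)) s
    filter_upwards [ae_all_iff.2 hcond, ae_all_iff.2 hcD] with s hs hsD hlt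
    by_contra hB
    simp only [Set.mem_union, not_or] at hB
    obtain ⟨⟨⟨n1, nS⟩, nV⟩, nD⟩ := hB
    refine absurd hlt (not_lt.2 ?_)
    have hsum : ∑ k ∈ Finset.range N, (1 - ξ D k) s = N - ∑ k ∈ Finset.range N, ξ D k s := by
      simp [Finset.sum_sub_distrib]
    have hsumD : ∑ k ∈ Finset.range N, (μ[1 - ξ D k|ℱ k]) s =
        N - ∑ k ∈ Finset.range N, (μ[ξ D k|ℱ k]) s := by
      simp [hsD, Finset.sum_sub_distrib]
    simp only [BD, Set.mem_ofPred_eq, not_lt] at nD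
    rw [hsum, hsumD] at nD
    refine lowerN1Z_le hP hN' (T := fun ω => ∑ k ∈ Finset.range N, (μ[ξ ω k|ℱ k]) s)
      (T1 := ∑ k ∈ Finset.range N, (μ[η k|ℱ k]) s)
      (Finset.sum_nonneg fun k _ => ?_) (not_lt.1 n1) (not_lt.1 nS) (not_lt.1 nV) nD ?_
    · rcases h01 k s with h | h <;> simp [h]
    · rw [Finset.mul_sum, Finset.mul_sum, Finset.mul_sum, ← Finset.sum_add_distrib,
        ← Finset.sum_add_distrib]
      exact Finset.sum_le_sum fun k _ => hs k
  refine (measure_mono_ae hsub).trans_lt ?_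
  change μ (B1 ∪ BS ∪ BV ∪ BD) < _
  rw [← ENNReal.ofReal_toReal (measure_ne_top μ (B1 ∪ BS ∪ BV ∪ BD))]
  refine (ENNReal.ofReal_lt_ofReal_iff (by positivity)).2 ?_
  change μ.real (B1 ∪ BS ∪ BV ∪ BD) < _
  have u1 := measureReal_union_le (μ := μ) (B1 ∪ BS ∪ BV) BD
  have u2 := measureReal_union_le (μ := μ) (B1 ∪ BS) BV
  have u3 := measureReal_union_le (μ := μ) B1 BS
  linarith

end Concentration

/-! ### The measure on the labels of all rounds -/

section Labels

variable {J M : ℕ}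

/-- The labels of all rounds: Alice's registers, the photon numbers and Bob's registers. -/
abbrev Labels (J M : ℕ) : Type :=
  (Fin J → Fin M → AReg) × (Fin J → Fin M → ℕ) × (Fin J → Fin M → BReg)

instance : MeasurableSpace (Labels J M) := ⊤

theorem measurableSet_labels (B : Set (Labels J M)) : MeasurableSet B :=
  MeasurableSpace.measurableSet_top

/-- The labels of one round. -/
def roundAt (s : Labels J M) (i : Fin J × Fin M) : AReg × ℕ × BReg :=
  (s.1 i.1 i.2, s.2.1 i.1 i.2, s.2.2 i.1 i.2)

/-- Membership in `B` is determined by the labels of the rounds that precede round number `k`, where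
the rounds are numbered block by block. -/
def DependsOnPrefix (k : ℕ) (B : Set (Labels J M)) : Prop :=
  ∀ s s', (∀ i, (finProdFinEquiv i).1 < k → roundAt s i = roundAt s' i) → (s ∈ B ↔ s' ∈ B)

/-- The filtration generated by the labels of the successive rounds. -/
def roundFiltration (J M : ℕ) : Filtration ℕ (⊤ : MeasurableSpace (Labels J M)) where
  seq k :=
    { MeasurableSet' := DependsOnPrefix k
      measurableSet_empty := fun _ _ _ => Iff.rfl
      measurableSet_compl := fun _ hB s s' h => not_congr (hB s s' h)
      measurableSet_iUnion := fun f hf s s' h => by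
        simp only [Set.mem_iUnion]
        exact exists_congr fun l => hf l s s' h }
  mono' _ _ hkl _ hB s s' h := hB s s' fun i hi => h i (hi.trans_le hkl)
  le' _ := le_top

variable {P : Params} {β ε : Type} {squash : KrausMap β (Option Bool)} {E : Eve J M β ε}

/-- The rounds after block `j` may be summed out. -/
theorem tsum_qDist_mul_comp_castLE (hP : P.Valid) (hs : squash.IsTP) (hE : E.IsTP) {j : ℕ}
    (G : (Fin J → Fin M → AReg) → (Fin J → Fin M → ℕ) → (Fin j → Fin M → BReg) → ℝ≥0∞) {l : ℕ}
    (hjl : j ≤ l) : ∀ hl : l ≤ J,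
      ∑' (A) (n) (b : Fin l → Fin M → BReg), qDist P squash E l hl A n b *
        G A n (fun i => b (Fin.castLE hjl i)) =
      ∑' (A) (n) (b : Fin j → Fin M → BReg), qDist P squash E j (hjl.trans hl) A n b *
        G A n b := by
  induction l, hjl using Nat.le_induction with
  | base => exact fun _ => rfl
  | succ l hjl ih =>
    intro hl
    rw [← ih (Nat.le_of_succ_le hl)]
    refine tsum_congr fun A => tsum_congr fun n => ?_
    rw [tsum_fin_succ_eq]
    refine tsum_congr fun b => ?_
    rw [← tsum_qDist_succ hP hs hE l hl A n b, ← ENNReal.tsum_mul_right]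
    refine tsum_congr fun b' => ?_
    congr 2
    funext i
    exact Fin.snoc_castSucc (α := fun _ => Fin M → BReg) b' b (Fin.castLE hjl i)

/-- The distribution of the labels of all rounds at the end of the protocol. -/
def labelMeasure (P : Params) (squash : KrausMap β (Option Bool)) (E : Eve J M β ε) :
    Measure (Labels J M) :=
  Measure.sum fun s => qDist P squash E J le_rfl s.1 s.2.1 s.2.2 • Measure.dirac s

open Classical in
theorem labelMeasure_apply (B : Set (Labels J M)) : labelMeasure P squash E B =
    ∑' (A) (n) (b), if (A, n, b) ∈ B then qDist P squash E J le_rfl A n b else 0 := by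
  rw [labelMeasure, Measure.sum_apply _ (measurableSet_labels B)]
  refine (ENNReal.tsum_prod (f := fun A (p : (Fin J → Fin M → ℕ) × (Fin J → Fin M → BReg)) =>
    (qDist P squash E J le_rfl A p.1 p.2 • Measure.dirac ((A, p) : Labels J M)) B)).trans ?_
  refine tsum_congr fun A => ?_
  refine (ENNReal.tsum_prod (f := fun n b =>
    (qDist P squash E J le_rfl A n b • Measure.dirac ((A, n, b) : Labels J M)) B)).trans ?_
  refine tsum_congr fun n => tsum_congr fun b => ?_
  rw [Measure.smul_apply, Measure.dirac_apply' _ (measurableSet_labels B), Set.indicator_apply, smul_eq_mul]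
  split_ifs <;> simp

theorem isProbabilityMeasure_labelMeasure (hP : P.Valid) (hs : squash.IsTP) (hE : E.IsTP) :
    IsProbabilityMeasure (labelMeasure P squash E) := by
  constructor
  rw [labelMeasure_apply, ← tsum_qDist_zero (J := J) (M := M) (squash := squash) (E := E) hP]
  have h := tsum_qDist_mul_comp_castLE hP hs hE (fun _ _ _ => 1) (Nat.zero_le J) le_rfl
  simpa using h

/-- The rounds whose click survives the sifting in the `Z` basis. -/
def Sifted (r : AReg × ℕ × BReg) : Prop := r.1.2.1 = Z ∧ r.2.2.1 = Z ∧ r.2.2.2 ≠ none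

/-- The relabelling of the intensities `ω` and `ω'` in one round. -/
def swapIntensity (i : Fin J × Fin M) (ω ω' : Intensity) (A : Fin J → Fin M → AReg) :
    Fin J → Fin M → AReg := fun j m =>
  if (j, m) = i then (Equiv.swap ω ω' (A j m).1, (A j m).2) else A j m

theorem swapIntensity_involutive (i : Fin J × Fin M) (ω ω' : Intensity) :
    Function.Involutive (swapIntensity i ω ω') := by
  intro A
  funext j m
  simp only [swapIntensity]
  split_ifs with h <;> simp

theorem sameExcept_swapIntensity (i : Fin J × Fin M) (ω ω' : Intensity)
    (A : Fin J → Fin M → AReg) : SameExcept i.1 i.2 A (swapIntensity i ω ω' A) := by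
  refine ⟨by simp [swapIntensity], fun j m h => ?_⟩
  have : (j, m) ≠ i := by
    rintro rfl
    simp at h
  simp [swapIntensity, this]

theorem fst_le_of_finProdFinEquiv_lt {i i' : Fin J × Fin M}
    (h : (finProdFinEquiv i').1 < (finProdFinEquiv i).1) : i'.1.1 ≤ i.1.1 := by
  by_contra hlt
  have h1 : M * (i.1.1 + 1) ≤ M * i'.1.1 := Nat.mul_le_mul_left M (by omega)
  have h2 := i.2.2
  simp only [finProdFinEquiv_apply_val] at h
  rw [mul_add] at h1
  omega

/-- Conditioned on the past, on the photon number of a round and on its being sifted, the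
probabilities of the intensities are in the ratio of the source: Eve and Bob have seen only the
photon number when the intensity is announced. -/
theorem labelMeasure_intensity_ratio (hP : P.Valid) (hs : squash.IsTP) (hE : E.IsTP)
    (i : Fin J × Fin M) {B : Set (Labels J M)} (hB : DependsOnPrefix (finProdFinEquiv i).1 B)
    (n₀ : ℕ) (ω ω' : Intensity) :
    ENNReal.ofReal (P.pJoint ω' n₀) * labelMeasure P squash E
        (B ∩ {s | (roundAt s i).1.1 = ω ∧ (roundAt s i).2.1 = n₀ ∧ Sifted (roundAt s i)}) =
      ENNReal.ofReal (P.pJoint ω n₀) * labelMeasure P squash E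
        (B ∩ {s | (roundAt s i).1.1 = ω' ∧ (roundAt s i).2.1 = n₀ ∧ Sifted (roundAt s i)}) := by
  classical
  obtain ⟨j, m⟩ := i
  -- The event, expressed by what is known after block `j`.
  let C (ω : Intensity) (A : Fin J → Fin M → AReg) (n : Fin J → Fin M → ℕ)
      (b : Fin (j.1 + 1) → Fin M → BReg) : Prop :=
    (A, n, fun j' => if h : j'.1 < j.1 + 1 then b ⟨j'.1, h⟩ else fun _ => (Z, none)) ∈ B ∧
      (A j m).1 = ω ∧ n j m = n₀ ∧ Sifted (A j m, n j m, b (Fin.last _) m)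
  have hj : j.1 + 1 ≤ J := j.2
  have hred : ∀ ω, labelMeasure P squash E
      (B ∩ {s | (roundAt s (j, m)).1.1 = ω ∧ (roundAt s (j, m)).2.1 = n₀ ∧
        Sifted (roundAt s (j, m))}) =
      ∑' (A) (n) (b), qDist P squash E (j.1 + 1) hj A n b * if C ω A n b then 1 else 0 := by
    intro ω
    rw [labelMeasure_apply, ← tsum_qDist_mul_comp_castLE hP hs hE
      (fun A n b => if C ω A n b then 1 else 0) hj le_rfl]
    refine tsum_congr fun A => tsum_congr fun n => tsum_congr fun b => ?_
    rw [mul_ite, mul_one, mul_zero]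
    have hiff : ((A, n, b) ∈ B ∩ {s | (roundAt s (j, m)).1.1 = ω ∧ (roundAt s (j, m)).2.1 = n₀ ∧
        Sifted (roundAt s (j, m))}) ↔ C ω A n fun i => b (Fin.castLE hj i) := by
      refine and_congr (hB _ _ fun i' hi' => ?_) Iff.rfl
      have h := fst_le_of_finProdFinEquiv_lt hi'
      have h' : i'.1.1 < j.1 + 1 := Nat.lt_succ_of_le h
      simp [roundAt, h']
    by_cases h : C ω A n fun i => b (Fin.castLE hj i)
    · rw [if_pos h, if_pos (hiff.2 h)]
    · rw [if_neg h, if_neg fun h' => h (hiff.1 h')]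
  rw [hred, hred, ← ENNReal.tsum_mul_left, ← ENNReal.tsum_mul_left,
    ← (swapIntensity_involutive (j, m) ω ω').toPerm.tsum_eq]
  refine tsum_congr fun A => ?_
  rw [← ENNReal.tsum_mul_left, ← ENNReal.tsum_mul_left]
  refine tsum_congr fun n => ?_
  rw [← ENNReal.tsum_mul_left, ← ENNReal.tsum_mul_left]
  refine tsum_congr fun b => ?_
  rw [Function.Involutive.coe_toPerm]
  set A' := swapIntensity (j, m) ω ω' A with hA'
  have hsame : SameExcept j m A A' := sameExcept_swapIntensity (j, m) ω ω' A
  have hint : (A' j m).1 = Equiv.swap ω ω' (A j m).1 := by simp [hA', swapIntensity]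
  have hC : C ω A' n b ↔ C ω' A n b := by
    refine and_congr (hB _ _ fun i' hi' => ?_) (and_congr ?_ (and_congr Iff.rfl ?_))
    · have hne : i'.1 ≠ j ∨ i'.2 ≠ m := by
        by_contra! hne
        rw [show i' = (j, m) from Prod.ext hne.1 hne.2] at hi'
        exact lt_irrefl _ hi'
      simp only [roundAt, hsame.2 _ _ hne]
    · rw [hint, Equiv.swap_apply_eq_iff, Equiv.swap_apply_left]
    · simp only [Sifted, hsame.1]
  by_cases h : C ω' A n b
  · rw [if_pos h, if_pos (hC.2 h), mul_one, mul_one]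
    have hq := qDist_omega hP hs hE j.1 j.2 hsame n b
    rw [h.2.2.1, (hC.2 h).2.1, h.2.1] at hq
    exact hq.symm
  · rw [if_neg h, if_neg fun h' => h (hC.1 h')]
    simp

/-! ### The decoy-state inequality for the conditional probabilities -/

/-- The event that there is a round number `k` and that its labels have the property `Q`. -/
def roundEvent (Q : AReg × ℕ × BReg → Prop) (k : ℕ) : Set (Labels J M) :=
  {s | ∃ i : Fin J × Fin M, (finProdFinEquiv i).1 = k ∧ Q (roundAt s i)}

theorem dependsOnPrefix_roundEvent (Q : AReg × ℕ × BReg → Prop) (k : ℕ) :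
    DependsOnPrefix (k + 1) (roundEvent Q k : Set (Labels J M)) := by
  intro s s' h
  refine exists_congr fun i => and_congr_right fun hi => ?_
  rw [h i (by omega)]

/-- The indicator of a property of the labels of round number `k`; it vanishes if there is no such
round. -/
def roundInd (Q : AReg × ℕ × BReg → Prop) (k : ℕ) : Labels J M → ℝ :=
  (roundEvent Q k).indicator 1

theorem roundInd_zero_or_one (Q : AReg × ℕ × BReg → Prop) (k : ℕ) (s : Labels J M) :
    roundInd Q k s = 0 ∨ roundInd Q k s = 1 := by
  unfold roundInd
  by_cases h : s ∈ roundEvent Q k <;> simp [h]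

theorem stronglyMeasurable_roundInd (Q : AReg × ℕ × BReg → Prop) (k : ℕ) :
    StronglyMeasurable[roundFiltration J M (k + 1)] (roundInd Q k) :=
  StronglyMeasurable.indicator stronglyMeasurable_one (dependsOnPrefix_roundEvent Q k)

open Classical in
theorem sum_roundInd (Q : AReg × ℕ × BReg → Prop) (s : Labels J M) :
    ∑ k ∈ Finset.range (J * M), roundInd Q k s =
      ({i : Fin J × Fin M | Q (roundAt s i)}.ncard : ℝ) := by
  rw [← Fin.sum_univ_eq_sum_range fun k => roundInd Q k s, ← finProdFinEquiv.sum_comp,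
    Set.ncard_eq_toFinset_card', Set.toFinset_ofPred, Finset.card_filter, Nat.cast_sum]
  refine Finset.sum_congr rfl fun i _ => ?_
  have h : s ∈ roundEvent Q (finProdFinEquiv i).1 ↔ Q (roundAt s i) := by
    refine ⟨fun ⟨i', hi', h⟩ => ?_, fun h => ⟨i, rfl, h⟩⟩
    rwa [finProdFinEquiv.injective (Fin.ext hi')] at h
  unfold roundInd
  by_cases hQ : Q (roundAt s i)
  · rw [Set.indicator_of_mem (h.2 hQ), if_pos hQ, Pi.one_apply, Nat.cast_one]
  · rw [Set.indicator_of_notMem (mt h.1 hQ), if_neg hQ, Nat.cast_zero]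

/-- The property of a round to count for `N_{1,Z}`. -/
def IsSingle (r : AReg × ℕ × BReg) : Prop := r.2.1 = 1 ∧ Sifted r

/-- The property of a round to count for `N_ω^sift`. -/
def HasIntensity (ω : Intensity) (r : AReg × ℕ × BReg) : Prop := r.1.1 = ω ∧ Sifted r

/-- The difference of the two sides of the decoy-state inequality, for the indicators of round
number `k`. -/
def decoyDiff (P : Params) (k : ℕ) : Labels J M → ℝ :=
  roundInd IsSingle k - (P.lam • roundInd (HasIntensity S) k + P.zeta • roundInd (HasIntensity D) k +
    P.gam • roundInd (HasIntensity V) k)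

theorem integrable_roundInd {μ : Measure (Labels J M)} [IsFiniteMeasure μ]
    (Q : AReg × ℕ × BReg → Prop) (k : ℕ) : Integrable (roundInd Q k) μ :=
  (integrable_const 1).indicator (measurableSet_labels _)

theorem integrable_decoyDiff {μ : Measure (Labels J M)} [IsFiniteMeasure μ] (P : Params) (k : ℕ) :
    Integrable (decoyDiff P k) μ :=
  (integrable_roundInd _ k).sub ((((integrable_roundInd _ k).smul _).add
    ((integrable_roundInd _ k).smul _)).add ((integrable_roundInd _ k).smul _))

theorem setIntegral_roundInd {μ : Measure (Labels J M)} [IsFiniteMeasure μ]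
    (Q : AReg × ℕ × BReg → Prop) (k : ℕ) (B : Set (Labels J M)) :
    ∫ s in B, roundInd Q k s ∂μ = μ.real (B ∩ roundEvent Q k) := by
  unfold roundInd
  rw [integral_indicator_one (measurableSet_labels _),
    measureReal_restrict_apply (measurableSet_labels _), Set.inter_comm]

/-- The decoy-state inequality on the part of a past event where round `i` has `n₀` photons. -/
theorem setIntegral_decoyDiff_photon_nonneg (hP : P.Valid) (hs : squash.IsTP) (hE : E.IsTP)
    (i : Fin J × Fin M) {B : Set (Labels J M)} (hB : DependsOnPrefix (finProdFinEquiv i).1 B)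
    (n₀ : ℕ) :
    0 ≤ ∫ s in B ∩ {s | (roundAt s i).2.1 = n₀}, decoyDiff P (finProdFinEquiv i).1 s
      ∂labelMeasure P squash E := by
  have := isProbabilityMeasure_labelMeasure (J := J) (M := M) (E := E) hP hs hE
  set μ := labelMeasure P squash E
  have hev : ∀ Q : AReg × ℕ × BReg → Prop, (roundEvent Q (finProdFinEquiv i).1 : Set (Labels J M)) =
      {s | Q (roundAt s i)} := by
    intro Q
    ext s
    refine ⟨fun ⟨i', hi', h⟩ => ?_, fun h => ⟨i, rfl, h⟩⟩
    rwa [finProdFinEquiv.injective (Fin.ext hi')] at h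
  set y : Intensity → ℝ := fun ω => μ.real
    (B ∩ {s | (roundAt s i).1.1 = ω ∧ (roundAt s i).2.1 = n₀ ∧ Sifted (roundAt s i)}) with hy
  have hyω : ∀ ω, ∫ s in B ∩ {s | (roundAt s i).2.1 = n₀},
      roundInd (HasIntensity ω) (finProdFinEquiv i).1 s ∂μ = y ω := by
    intro ω
    rw [setIntegral_roundInd, hev, hy]
    dsimp only
    congr 1
    ext s
    simp only [HasIntensity, Set.mem_inter_iff, Set.mem_ofPred_eq]
    tauto
  have hy1 : ∫ s in B ∩ {s | (roundAt s i).2.1 = n₀},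
      roundInd IsSingle (finProdFinEquiv i).1 s ∂μ = if n₀ = 1 then ∑ ω, y ω else 0 := by
    rw [setIntegral_roundInd, hev]
    split_ifs with h
    · subst h
      rw [hy, ← measureReal_biUnion_finset (fun ω _ ω' _ hne => ?_)
        fun _ _ => measurableSet_labels _]
      · congr 1
        ext s
        simp only [IsSingle, Set.mem_inter_iff, Set.mem_ofPred_eq, Set.mem_iUnion,
          Finset.mem_univ, exists_true_left]
        constructor
        · rintro ⟨⟨h1, h2⟩, h3, h4⟩
          exact ⟨_, h1, rfl, h2, h4⟩
        · rintro ⟨ω, h1, -, h2, h3⟩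
          exact ⟨⟨h1, h2⟩, h2, h3⟩
      · refine Set.disjoint_left.2 fun s h1 h2 => hne ?_
        rw [← h1.2.1, ← h2.2.1]
    · rw [show B ∩ {s | (roundAt s i).2.1 = n₀} ∩ {s | IsSingle (roundAt s i)} = ∅ from
        Set.eq_empty_of_forall_notMem fun s hs => h (hs.1.2.symm.trans hs.2.1), measureReal_empty]
  have hratio : ∀ ω ω', P.pJoint ω' n₀ * y ω = P.pJoint ω n₀ * y ω' := by
    intro ω ω'
    have h := congrArg ENNReal.toReal (labelMeasure_intensity_ratio hP hs hE i hB n₀ ω ω')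
    rwa [ENNReal.toReal_mul, ENNReal.toReal_mul, ENNReal.toReal_ofReal (P.pJoint_nonneg hP _ _),
      ENNReal.toReal_ofReal (P.pJoint_nonneg hP _ _)] at h
  have hint : ∫ s in B ∩ {s | (roundAt s i).2.1 = n₀}, decoyDiff P (finProdFinEquiv i).1 s ∂μ =
      (if n₀ = 1 then ∑ ω, y ω else 0) - (P.lam * y S + P.zeta * y D + P.gam * y V) := by
    have hi : ∀ Q, Integrable (roundInd Q (finProdFinEquiv i).1)
        (μ.restrict (B ∩ {s | (roundAt s i).2.1 = n₀})) := fun Q => integrable_roundInd Q _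
    unfold decoyDiff
    rw [integral_sub' (hi _) ((((hi _).smul _).add ((hi _).smul _)).add ((hi _).smul _)),
      integral_add' (((hi _).smul _).add ((hi _).smul _)) ((hi _).smul _),
      integral_add' ((hi _).smul _) ((hi _).smul _)]
    simp only [Pi.smul_apply, smul_eq_mul, integral_const_mul, hy1, hyω]
  rw [hint]
  -- Multiplied by the total probability of `n₀` photons, this is the decoy-state inequality.
  have hpos := Params.sum_pJoint_pos hP n₀
  have hyp : ∀ ω, (∑ ω', P.pJoint ω' n₀) * y ω = P.pJoint ω n₀ * ∑ ω', y ω' := by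
    intro ω
    rw [Finset.sum_mul, Finset.mul_sum]
    exact Finset.sum_congr rfl fun ω' _ => hratio ω ω'
  refine le_of_mul_le_mul_left (a := ∑ ω', P.pJoint ω' n₀) ?_ hpos
  rw [mul_zero]
  have h0 : 0 ≤ ∑ ω, y ω := Finset.sum_nonneg fun _ _ => measureReal_nonneg
  have hd := mul_le_mul_of_nonneg_right (Params.decoy_combination_le hP n₀) h0
  have e : (∑ ω', P.pJoint ω' n₀) * (P.lam * y S + P.zeta * y D + P.gam * y V) =
      (P.lam * P.pJoint S n₀ + P.zeta * P.pJoint D n₀ + P.gam * P.pJoint V n₀) * ∑ ω, y ω := by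
    linear_combination P.lam * hyp S + P.zeta * hyp D + P.gam * hyp V
  rw [mul_sub, e, sub_nonneg]
  refine hd.trans_eq ?_
  split_ifs <;> simp

theorem setIntegral_decoyDiff_nonneg (hP : P.Valid) (hs : squash.IsTP) (hE : E.IsTP)
    (k : ℕ) {B : Set (Labels J M)} (hB : DependsOnPrefix k B) :
    0 ≤ ∫ s in B, decoyDiff P k s ∂labelMeasure P squash E := by
  have := isProbabilityMeasure_labelMeasure (J := J) (M := M) (E := E) hP hs hE
  by_cases hk : k < J * M
  · obtain ⟨i, hi⟩ : ∃ i : Fin J × Fin M, (finProdFinEquiv i).1 = k :=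
      ⟨finProdFinEquiv.symm ⟨k, hk⟩, by rw [Equiv.apply_symm_apply]⟩
    subst hi
    have hU : (⋃ n₀, B ∩ {s | (roundAt s i).2.1 = n₀}) = B := by
      ext s
      simp
    have h := hasSum_integral_iUnion (μ := labelMeasure P squash E)
      (f := decoyDiff P (finProdFinEquiv i).1)
      (s := fun n₀ => B ∩ {s | (roundAt s i).2.1 = n₀}) (fun _ => measurableSet_labels _)
      (fun n n' hne => Set.disjoint_left.2 fun s h1 h2 => hne (h1.2.symm.trans h2.2))
      (integrable_decoyDiff P _).integrableOn
    rw [hU] at h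
    exact h.nonneg fun n₀ => setIntegral_decoyDiff_photon_nonneg hP hs hE i hB n₀
  · have h0 : ∀ Q, (roundInd Q k : Labels J M → ℝ) = 0 := by
      intro Q
      have : (roundEvent Q k : Set (Labels J M)) = ∅ :=
        Set.eq_empty_of_forall_notMem fun s ⟨i, hi, _⟩ => hk (hi ▸ (finProdFinEquiv i).2)
      rw [roundInd, this, Set.indicator_empty]
      rfl
    simp [decoyDiff, h0]

/-- The decoy-state inequality for the conditional probabilities given the earlier rounds. -/
theorem decoy_condExp_le (hP : P.Valid) (hs : squash.IsTP) (hE : E.IsTP) (k : ℕ) :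
    ∀ᵐ s ∂labelMeasure P squash E,
      P.lam * ((labelMeasure P squash E)[roundInd (HasIntensity S) k|roundFiltration J M k]) s +
      P.zeta * ((labelMeasure P squash E)[roundInd (HasIntensity D) k|roundFiltration J M k]) s +
      P.gam * ((labelMeasure P squash E)[roundInd (HasIntensity V) k|roundFiltration J M k]) s ≤
      ((labelMeasure P squash E)[roundInd IsSingle k|roundFiltration J M k]) s := by
  have := isProbabilityMeasure_labelMeasure (J := J) (M := M) (E := E) hP hs hE
  set μ := labelMeasure P squash E
  set m := roundFiltration J M k
  have hm : m ≤ ⊤ := le_top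
  have hpos : 0 ≤ᵐ[μ] μ[decoyDiff P k|m] := by
    refine ae_le_of_ae_le_trim (hm := hm) (ae_nonneg_of_forall_setIntegral_nonneg
      (integrable_condExp.trim hm stronglyMeasurable_condExp) fun B hB _ => ?_)
    rw [← setIntegral_trim hm stronglyMeasurable_condExp hB,
      setIntegral_condExp hm (integrable_decoyDiff P k) hB]
    exact setIntegral_decoyDiff_nonneg hP hs hE k hB
  have hi : ∀ Q, Integrable (roundInd Q k) μ := fun Q => integrable_roundInd Q k
  have e1 := condExp_sub (hi IsSingle) ((((hi (HasIntensity S)).smul P.lam).add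
    ((hi (HasIntensity D)).smul P.zeta)).add ((hi (HasIntensity V)).smul P.gam)) m
  have e2 := condExp_add (((hi (HasIntensity S)).smul P.lam).add
    ((hi (HasIntensity D)).smul P.zeta)) ((hi (HasIntensity V)).smul P.gam) m
  have e3 := condExp_add ((hi (HasIntensity S)).smul P.lam) ((hi (HasIntensity D)).smul P.zeta) m
  filter_upwards [hpos, e1, e2, e3, condExp_smul P.lam (roundInd (HasIntensity S) k) m,
    condExp_smul P.zeta (roundInd (HasIntensity D) k) m,
    condExp_smul P.gam (roundInd (HasIntensity V) k) m] with s h0 h1 h2 h3 hS hD hV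
  change 0 ≤ (μ[_ - _|m]) s at h0
  rw [h1, Pi.sub_apply, h2, Pi.add_apply, h3, Pi.add_apply, hS, hD, hV] at h0
  simp only [Pi.smul_apply, smul_eq_mul] at h0
  linarith

end Labels

/-- The probability that fewer single-photon detections occur than the explicit lower bound tells. The
estimates `t` and `t1` only influence how tight the bound is. -/
theorem prEvent_N1Z_lt_lowerN1Z_lt {J M : ℕ} (hJ : 0 < J) (hM : 0 < M) {P : Params} (hP : P.Valid)
    {εs : ℝ} (hε : 0 < εs) (hε1 : εs ≤ 1) (t : Intensity → ℝ) (t1 : ℝ) {β ε : Type}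
    {squash : KrausMap β (Option Bool)} (hs : squash.IsTP) {E : Eve J M β ε} (hE : E.IsTP) :
    prEvent P squash E {o | (N1Z o : ℝ) <
        P.lowerN1Z (J * M : ℕ) (fun ω => (Nsift o ω : ℝ)) t t1 εs} <
      ENNReal.ofReal (εs ^ 2 / 8) := by
  classical
  have := isProbabilityMeasure_labelMeasure (J := J) (M := M) (E := E) hP hs hE
  have hcore : ∀ o : Fin J → Fin M → Outcome, N1Z (fun j m => core (o j m)) = N1Z o ∧
      ∀ ω, Nsift (fun j m => core (o j m)) ω = Nsift o ω := by
    intro o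
    simp [N1Z, Nsift, core]
  rw [prEvent_eq_tsum_marg hP hs hE fun o => by
    simp only [Set.mem_ofPred_eq, (hcore o).1, (hcore o).2]]
  have hbound := measure_lt_lowerN1Z_lt (ℱ := roundFiltration J M) hP (Nat.mul_pos hJ hM) hε hε1
    t t1 (roundInd_zero_or_one IsSingle) (stronglyMeasurable_roundInd IsSingle)
    (fun ω => roundInd_zero_or_one (HasIntensity ω))
    (fun ω => stronglyMeasurable_roundInd (HasIntensity ω)) (decoy_condExp_le hP hs hE)
  rw [labelMeasure_apply] at hbound
  refine lt_of_eq_of_lt ?_ hbound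
  refine tsum_congr fun A => tsum_congr fun n => tsum_congr fun b => ?_
  have h1 : (N1Z fun j m => labOf (A j m, n j m, b j m)) =
      {i : Fin J × Fin M | IsSingle (roundAt (A, n, b) i)}.ncard := by
    simp [N1Z, labOf, IsSingle, Sifted, roundAt]
  have hω : ∀ ω, Nsift (fun j m => labOf (A j m, n j m, b j m)) ω =
      {i : Fin J × Fin M | HasIntensity ω (roundAt (A, n, b) i)}.ncard := by
    intro ω
    simp [Nsift, labOf, HasIntensity, Sifted, roundAt]
  simp only [Set.mem_ofPred_eq, h1, hω, sum_roundInd]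

end DecoyBB84

end

theorem mainTheorem8 (J M : ℕ) (hJ : 0 < J) (hM : 0 < M)
    (P : DecoyBB84.Params) (hP : P.Valid)
    (εs : ℝ) (hε : 0 < εs) (hε1 : εs ≤ 1)
    (t : DecoyBB84.Intensity → ℝ) (ht : ∀ ω, 0 ≤ t ω ∧ t ω ≤ (J * M : ℕ))
    (t1 : ℝ) (ht1 : 0 ≤ t1 ∧ t1 ≤ (J * M : ℕ))
    (β ε : Type) (squash : DecoyBB84.KrausMap β (Option Bool)) (hsquash : squash.IsTP)
    (E : DecoyBB84.Eve J M β ε) (hE : E.IsTP) :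
    DecoyBB84.prEvent P squash E
        {o | (DecoyBB84.N1Z o : ℝ) <
          P.lowerN1Z (J * M : ℕ) (fun ω => (DecoyBB84.Nsift o ω : ℝ)) t t1 εs} <
      ENNReal.ofReal (εs ^ 2 / 8) :=
  DecoyBB84.prEvent_N1Z_lt_lowerN1Z_lt hJ hM hP hε hε1 t t1 hsquash hE
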